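/- **Notation.** Let $\mathrm{Im}\,\tau>0$, $\Lambda=\mathbb Z+\mathbb Z\tau$, ${\bf e}(x)=e^{2\pi i x}$, and for $\alpha=0,1,2,3$ let $\omega_\alpha=0,\frac12,\frac\tau2,\frac{1+\tau}2$ and $\partial_\tau\omega_\alpha=0,0,\frac12,\frac12$. Write $\wp(z)$ for the Weierstrass function of $\Lambda$ and $\wp(z,2\tau)$, $E_1(z,2\tau)$ for the Weierstrass function and for $\partial_z\log\vartheta$ on the doubled lattice $2\Lambda=\langle 2,2\tau\rangle$, where $E_1(z,2\tau)=\partial_z\log\vartheta(z/2|\tau)$ and $\vartheta(z|\tau)=e^{\pi i\tau/4}\sum_{n\in\mathbb Z}(-1)^n e^{\pi i(n(n+1)\tau+(2n+1)z)}$. Put $\phi(z,w)=\frac{\vartheta(w+z)\vartheta'(0)}{\vartheta(w)\vartheta(z)}$, $\varphi_\alpha(z,w)={\bf e}(z\,\partial_\tau\omega_\alpha)\phi(z,w)$, $\varphi_\alpha'=\partial_w\varphi_\alpha$, $I_{\rho\alpha}={\bf e}(2\omega_\rho\partial_\tau\omega_\alpha-2\omega_\alpha\partial_\tau\omega_\rho)$,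 and let $\mu(\alpha,\beta)$ be the index with $\omega_{\mu(\alpha,\beta)}\equiv\omega_\alpha+\omega_\beta \bmod \Lambda$. **The model.** The Painlevé–Calogero–Inozemtsev (PCI) model with couplings $g_\alpha\in\mathbb C$ has the Hamiltonian $H(v,u)=\frac12v^2+\sum_\alpha g_\alpha^2\wp(u+\omega_\alpha)$. Throughout $2u\notin\Lambda$. Let $\nu_\alpha\in\mathbb C$ with $\nu_\alpha^2=-2g_\alpha^2$, so that $2H=v^2-\sum_\alpha\nu_\alpha^2\wp(u+\omega_\alpha)$, and put $$L(z)=\begin{pmatrix}v&\sum_\alpha\nu_\alpha\varphi_\alpha(z,\omega_\alpha+u)\\ \sum_\alpha\nu_\alpha\varphi_\alpha(z,\omega_\alpha-u)&-v\end{pmatrix},\quad M(z)=\begin{pmatrix}0&\sum_\alpha\nu_\alpha\varphi'_\alpha(z,\omega_\alpha+u)\\ \sum_\alpha\nu_\alpha\varphi'_\alpha(z,\omega_\alpha-u)&0\end{pmatrix},$$ $$K_\rho=\sum_{\alpha,\beta=0}^3\nu_\alpha\nu_\beta I_{\mu(\alpha,\beta),\rho}.$$ **The Gaudin model.** For $v,u$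 and $s^\alpha=\begin{pmatrix}s_{11}^\alpha&s_{12}^\alpha\\ s_{21}^\alpha&-s_{11}^\alpha\end{pmatrix}\in sl(2,\mathbb C)$ put $\tilde s_{12}^\rho=\frac14\sum_\alpha{\bf e}(2u\,\partial_\tau\omega_\alpha)I_{\rho\alpha}s_{12}^\alpha$, $\tilde s_{21}^\rho=\frac14\sum_\alpha{\bf e}(-2u\,\partial_\tau\omega_\alpha)I_{\rho\alpha}s_{21}^\alpha$, $C_\alpha=(s_{11}^\alpha)^2+s_{12}^\alpha s_{21}^\alpha$. The Lax matrix of the $sl(2)$ elliptic Gaudin model with marked points $2\omega_\alpha$ (that is $0,1,\tau,1+\tau$) on $\mathbb C/2\Lambda$ is $$L^{G4}(z)=\begin{pmatrix}v+\sum_\alpha s_{11}^\alpha E_1(z-2\omega_\alpha,2\tau)&\sum_\alpha\tilde s_{12}^\alpha\varphi_\alpha(z,\omega_\alpha+u)\\ \sum_\alpha\tilde s_{21}^\alpha\varphi_\alpha(z,\omega_\alpha-u)&-v-\sum_\alpha s_{11}^\alpha E_1(z-2\omega_\alpha,2\tau)\end{pmatrix}.$$ **Proposition 3.1.** 1. (Reduction.)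 The residue of $L^{G4}$ at $z=2\omega_\alpha$ is $s^\alpha$. The matrix $L^{G4}$ is fixed by the involution $L(z)\mapsto-\sigma_1L(-z)\sigma_1$, $\sigma_1=\begin{pmatrix}0&1\\1&0\end{pmatrix}$, if and only if $s_{11}^\alpha=0$ and $\tilde s_{12}^\alpha=\tilde s_{21}^\alpha$ for all $\alpha$. In this case $L^{G4}$ is the Lax matrix $L$ above with $\nu_\alpha=\tilde s_{12}^\alpha$; moreover, with suitable square roots, $s_{12}^\alpha={\bf e}(-2u\,\partial_\tau\omega_\alpha)\sqrt{C_\alpha}$, $s_{21}^\alpha={\bf e}(2u\,\partial_\tau\omega_\alpha)\sqrt{C_\alpha}$, $\nu_\rho=\frac14\sum_\alpha I_{\rho\alpha}\sqrt{C_\alpha}$, and $K_\rho=C_\rho$. Every $(v,u,\nu)$ arises in this way. 2. (Spectral curve.) For $z\notin\Lambda$ the equation $\det(\lambda+L(z))=0$ is equivalent to $$\lambda^2=2H+\sum_{\rho=0}^3K_\rho\,\wp(z-2\omega_\rho,2\tau),$$ and to $\lambda^2=\mathcal R(X)$ with $X=\wp(z,2\tau)$, where $\mathcal R$ is a rational function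 that depends only on $\tau$, $\nu$ and the value of $H$. All poles of $\mathcal R$ on $\mathbb{CP}^1$ are simple, and they are the points $\wp(2\omega_\rho,2\tau)$ with $K_\rho\ne0$ (the point $\infty$ for $\rho=0$); if all $K_\rho\neq0$, these are exactly four simple poles. 3. (Algebraic integrability.) The equations of motion $\dot u=\partial H/\partial v$, $\dot v=-\partial H/\partial u$ imply the Lax equation $\dot L=[L,\frac12M]$ for all $z\notin\Lambda$, and are equivalent to it if $\nu\ne0$ and $u$ is differentiable. The involution acts on the spectral curve by $(z,\lambda)\mapsto(-z,-\lambda)$. For all but finitely many values of $H$ (depending only on $\tau$ and $\nu$) the functions $x=\wp(z,2\tau)$, $y=\lambda\,\wp'(z,2\tau)$ identify the quotient of the spectral curve over $(\mathbb C\setminus\Lambda)/2\Lambda$ by this involution with the affine curve $y^2=P(x)$, $x\ne\wp(2\omega_\rho,2\tau)$ ($\rho=1,2,3$), where $P$ is a polynomial without multiple roots, $y^2=P(x)$ is an irreducible two-fold covering of $\mathbb{CP}^1$ branched at four points, and its genus is $1$. So the genus equals the number of degrees of freedom; in this sense the model is algebraically integrable. -/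

import Mathlib

open Filter Topology Polynomial

noncomputable section

namespace PCI

/-! ### Elliptic functions on the torus `⟨1, τ⟩` and on the doubled torus `⟨2, 2τ⟩` -/

theorem indep_one_tau (c : ℝ) (hc : c ≠ 0) (τ : UpperHalfPlane) :
    LinearIndependent ℝ ![(c : ℂ), (c : ℂ) * (τ : ℂ)] := by
  rw [LinearIndependent.pair_iff]
  intro s t h
  have him := congrArg Complex.im h
  have hre := congrArg Complex.re h
  simp [hc, τ.im_ne_zero] at him
  simp [him, hc] at hre
  exact ⟨hre, him⟩

/-- The period pair `(1, τ)`. -/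
def torus (τ : UpperHalfPlane) : PeriodPair where
  ω₁ := 1
  ω₂ := τ
  indep := by simpa using indep_one_tau 1 one_ne_zero τ

/-- The period pair `(2, 2τ)`. -/
def doubledTorus (τ : UpperHalfPlane) : PeriodPair where
  ω₁ := 2
  ω₂ := 2 * τ
  indep := by simpa using indep_one_tau 2 two_ne_zero τ

/-- `e(x) = exp(2πix)`. -/
def e (x : ℂ) : ℂ := Complex.exp (2 * Real.pi * Complex.I * x)

/-- The odd theta function
`ϑ(z|τ) = q^{1/8} ∑ₙ (-1)ⁿ exp(πi(n(n+1)τ + (2n+1)z))`, `q = exp(2πiτ)`. -/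
def theta (τ : UpperHalfPlane) (z : ℂ) : ℂ :=
  Complex.exp (Real.pi * Complex.I * (τ / 4 + z)) * jacobiTheta₂ (z + (1 + τ) / 2) τ

/-- `E₁(z|τ) = ∂_z log ϑ(z|τ)`. -/
def E1 (τ : UpperHalfPlane) (z : ℂ) : ℂ := logDeriv (theta τ) z

/-- `E₁(z, 2τ)`: the function `E₁` of the lattice `⟨2, 2τ⟩`, whose theta function is
`z ↦ ϑ(z/2|τ)`. -/
def E1doubled (τ : UpperHalfPlane) (z : ℂ) : ℂ := logDeriv (fun x => theta τ (x / 2)) z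

/-- `φ(z,u) = ϑ(u+z) ϑ'(0) / (ϑ(u) ϑ(z))`. -/
def phi (τ : UpperHalfPlane) (z u : ℂ) : ℂ :=
  theta τ (u + z) * deriv (theta τ) 0 / (theta τ u * theta τ z)

/-- The half periods `ω = (0, 1/2, τ/2, (1+τ)/2)`. -/
def ω (τ : UpperHalfPlane) : Fin 4 → ℂ := ![0, 1 / 2, τ / 2, (1 + τ) / 2]

/-- `∂_τ ω = (0, 0, 1/2, 1/2)`. -/
def dω : Fin 4 → ℂ := ![0, 0, 1 / 2, 1 / 2]

/-- `φ_α(z, w) = e(z ∂_τω_α) φ(z, w)`. -/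
def phiα (τ : UpperHalfPlane) (α : Fin 4) (z w : ℂ) : ℂ := e (z * dω α) * phi τ z w

/-- `φ'_α(z, w)`: the derivative in the second argument. -/
def phiα' (τ : UpperHalfPlane) (α : Fin 4) (z w : ℂ) : ℂ := deriv (fun y => phiα τ α z y) w

/-- `I_{ρα} = e(2ω_ρ ∂_τω_α - 2ω_α ∂_τω_ρ)`. -/
def signMatrix (τ : UpperHalfPlane) (ρ α : Fin 4) : ℂ := e (2 * ω τ ρ * dω α - 2 * ω τ α * dω ρ)

/-- The index `μ(α,β)` with `ω_μ ≡ ω_α + ω_β` modulo `⟨1, τ⟩`. -/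
def halfSum : Fin 4 → Fin 4 → Fin 4 :=
  ![![0, 1, 2, 3], ![1, 0, 3, 2], ![2, 3, 0, 1], ![3, 2, 1, 0]]

/-! ### The Painlevé–Calogero–Inozemtsev model -/

/-- The Hamiltonian `H = v²/2 + ∑_α g_α² ℘(u + ω_α)`. -/
def hamiltonian (τ : UpperHalfPlane) (g : Fin 4 → ℂ) (v u : ℂ) : ℂ :=
  v ^ 2 / 2 + ∑ α, g α ^ 2 * (torus τ).weierstrassP (u + ω τ α)

/-- The Lax matrix of the model. -/
def laxL (τ : UpperHalfPlane) (ν : Fin 4 → ℂ) (v u z : ℂ) : Matrix (Fin 2) (Fin 2) ℂ :=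
  !![v, ∑ α, ν α * phiα τ α z (ω τ α + u);
     ∑ α, ν α * phiα τ α z (ω τ α - u), -v]

/-- The second matrix of the Lax pair. -/
def laxM (τ : UpperHalfPlane) (ν : Fin 4 → ℂ) (u z : ℂ) : Matrix (Fin 2) (Fin 2) ℂ :=
  !![0, ∑ α, ν α * phiα' τ α z (ω τ α + u);
     ∑ α, ν α * phiα' τ α z (ω τ α - u), 0]

/-- Hamilton's equations `u̇ = ∂H/∂v`, `v̇ = -∂H/∂u` at the time `t`. -/
def HamiltonAt (τ : UpperHalfPlane) (g : Fin 4 → ℂ) (v u : ℝ → ℂ) (t : ℝ) : Prop :=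
  HasDerivAt u (deriv (fun y => hamiltonian τ g y (u t)) (v t)) t ∧
  HasDerivAt v (-deriv (fun x => hamiltonian τ g (v t) x) (u t)) t

/-- The Lax equation `L̇ = [L, M/2]` at the time `t`, identically in the spectral parameter. -/
def LaxAt (τ : UpperHalfPlane) (ν : Fin 4 → ℂ) (v u : ℝ → ℂ) (t : ℝ) : Prop :=
  ∀ z ∉ (torus τ).lattice, ∀ i j,
    HasDerivAt (fun s => laxL τ ν (v s) (u s) z i j)
      ((1 / 2 : ℂ) * (laxL τ ν (v t) (u t) z * laxM τ ν (u t) z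
        - laxM τ ν (u t) z * laxL τ ν (v t) (u t) z) i j) t

/-- `K_ρ = ∑_{α,β} ν_α ν_β I_{μ(α,β),ρ}`. -/
def K (τ : UpperHalfPlane) (ν : Fin 4 → ℂ) (ρ : Fin 4) : ℂ :=
  ∑ α, ∑ β, ν α * ν β * signMatrix τ (halfSum α β) ρ

/-! ### The `sl(2)` elliptic Gaudin model with marked points `0, 1, τ, 1 + τ` on `⟨2, 2τ⟩` -/

/-- A point of the phase space: `v`, `u`, and for each marked point `2ω_α` the residue
`[[s₁₁, s₁₂], [s₂₁, -s₁₁]]` in `sl(2,ℂ)`. The vanishing `∑ s₁₁ = 0` of the moment map is not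
imposed. -/
structure GaudinPoint where
  v : ℂ
  u : ℂ
  s11 : Fin 4 → ℂ
  s12 : Fin 4 → ℂ
  s21 : Fin 4 → ℂ

/-- `s̃₁₂^ρ = (1/4) ∑_α e(2u ∂_τω_α) I_{ρα} s₁₂^α`. -/
def GaudinPoint.t12 (τ : UpperHalfPlane) (p : GaudinPoint) (ρ : Fin 4) : ℂ :=
  (1 / 4) * ∑ α, e (2 * p.u * dω α) * signMatrix τ ρ α * p.s12 α

/-- `s̃₂₁^ρ = (1/4) ∑_α e(-2u ∂_τω_α) I_{ρα} s₂₁^α`. -/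
def GaudinPoint.t21 (τ : UpperHalfPlane) (p : GaudinPoint) (ρ : Fin 4) : ℂ :=
  (1 / 4) * ∑ α, e (-2 * p.u * dω α) * signMatrix τ ρ α * p.s21 α

/-- The value `(s₁₁)² + s₁₂ s₂₁` of the Casimir function of the orbit at the marked point
`2ω_α`. -/
def GaudinPoint.casimir (p : GaudinPoint) (α : Fin 4) : ℂ :=
  p.s11 α ^ 2 + p.s12 α * p.s21 α

/-- The Lax matrix of the Gaudin model. -/
def gaudinLax (τ : UpperHalfPlane) (p : GaudinPoint) (z : ℂ) : Matrix (Fin 2) (Fin 2) ℂ :=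
  !![p.v + ∑ α, p.s11 α * E1doubled τ (z - 2 * ω τ α),
      ∑ α, p.t12 τ α * phiα τ α z (ω τ α + p.u);
     ∑ α, p.t21 τ α * phiα τ α z (ω τ α - p.u),
      -(p.v + ∑ α, p.s11 α * E1doubled τ (z - 2 * ω τ α))]

/-- The Pauli matrix `σ₁`. -/
def σ₁ : Matrix (Fin 2) (Fin 2) ℂ := !![0, 1; 1, 0]

/-- The involution `L(z) ↦ -σ₁ L(-z) σ₁`. -/
def involution (L : ℂ → Matrix (Fin 2) (Fin 2) ℂ) : ℂ → Matrix (Fin 2) (Fin 2) ℂ :=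
  fun z => -(σ₁ * L (-z) * σ₁)

/-- The point lies on the locus fixed by the involution. -/
def GaudinPoint.IsFixed (τ : UpperHalfPlane) (p : GaudinPoint) : Prop :=
  ∀ z ∉ (torus τ).lattice, involution (gaudinLax τ p) z = gaudinLax τ p z

/-! ### Algebraic curves -/

/-- The order of vanishing of a rational function at a point of `ℂP¹` (negative at poles;
`0` everywhere for the zero function). -/
def ratOrder (R : RatFunc ℂ) (p : OnePoint ℂ) : ℤ :=
  p.elim (-R.intDegree) fun a => (R.num.rootMultiplicity a : ℤ) - R.denom.rootMultiplicity a

/-- The branch points in `ℂP¹` of the double covering `y² = P(x)`. -/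
def branchPoints (P : ℂ[X]) : Set (OnePoint ℂ) :=
  {p | Odd (ratOrder (algebraMap ℂ[X] (RatFunc ℂ) P) p)}

/-- The coordinate ring `ℂ[x, y] / (y² - P(x))`. -/
abbrev CoordRing (P : ℂ[X]) : Type := AdjoinRoot ((X : ℂ[X][X]) ^ 2 - C P)

/-- The function field of the curve `y² = P(x)`, when this curve is irreducible. -/
abbrev CurveField (P : ℂ[X]) : Type := FractionRing (CoordRing P)

/-- A subalgebra `O ⊇ k` of a field `F` is a valuation ring of `F` if each nonzero `x ∈ F`
satisfies `x ∈ O` or `x⁻¹ ∈ O`. For a function field of one variable over an algebraically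
closed field `k`, these are `F` itself and the local rings of the points of the smooth complete
model. -/
def IsPlace {k F : Type*} [Field k] [CommRing F] [Algebra k F] (O : Subalgebra k F) : Prop :=
  ∀ x : F, x ∈ O ∨ ∃ y ∈ O, x * y = 1

/-- The space of regular differentials of a function field `F / k` : those `ω ∈ Ω_{F/k}` which at
every place `O` have the form `∑ aᵢ dbᵢ` with `aᵢ, bᵢ ∈ O`. -/
def regularDifferentials (k F : Type*) [Field k] [CommRing F] [Algebra k F] :
    Submodule k (Ω[F⁄k]) :=
  ⨅ (O : Subalgebra k F) (_ : IsPlace O),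
    (Submodule.span O ((fun b => KaehlerDifferential.D k F b) '' (O : Set F))).restrictScalars k

/-- The (geometric) genus of a function field: the dimension of its space of regular
differentials. -/
def genus (k F : Type*) [Field k] [CommRing F] [Algebra k F] : ℕ :=
  Module.finrank k (regularDifferentials k F)

/-! ### The spectral curve -/

/-- The spectral curve `det(λ + L(z)) = 0` of a Lax matrix with poles on `⟨1, τ⟩`, as a set of
pairs `(z, λ)`. -/
def spectralCurve (τ : UpperHalfPlane) (L : ℂ → Matrix (Fin 2) (Fin 2) ℂ) : Set (ℂ × ℂ) :=
  {p | p.1 ∉ (torus τ).lattice ∧ (p.2 • (1 : Matrix (Fin 2) (Fin 2) ℂ) + L p.1).det = 0}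

/-- Identification of points `(z, λ)` by the translations of `z` by `⟨2, 2τ⟩` and by the action
`(z, λ) ↦ (-z, -λ)` of the involution `L(z) ↦ -σ₁ L(-z) σ₁` on the spectral curve:
`det(λ - σ₁ L(-z) σ₁) = det(-λ + L(-z))`. -/
def SpectralEquiv (τ : UpperHalfPlane) (p q : ℂ × ℂ) : Prop :=
  (q.1 - p.1 ∈ (doubledTorus τ).lattice ∧ q.2 = p.2) ∨
  (q.1 + p.1 ∈ (doubledTorus τ).lattice ∧ q.2 = -p.2)

/-- The functions `x = ℘(z, 2τ)`, `y = λ ℘'(z, 2τ)`, which are invariant under the above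
identification. -/
def quotientMap (τ : UpperHalfPlane) (p : ℂ × ℂ) : ℂ × ℂ :=
  ((doubledTorus τ).weierstrassP p.1, p.2 * (doubledTorus τ).derivWeierstrassP p.1)

/-- The functions `x`, `y` identify the quotient of the spectral curve `Γ` by `SpectralEquiv` with
the affine curve `y² = P(x)` without its points above `x = ℘(2ω_ρ, 2τ)`, `ρ = 1, 2, 3`. -/
structure IsQuotientCurve (τ : UpperHalfPlane) (Γ : Set (ℂ × ℂ)) (P : ℂ[X]) : Prop where
  stable : ∀ p ∈ Γ, ∀ q, SpectralEquiv τ p q → q ∈ Γ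
  fibres : ∀ p ∈ Γ, ∀ q ∈ Γ, quotientMap τ p = quotientMap τ q ↔ SpectralEquiv τ p q
  image : quotientMap τ '' Γ =
    {q | q.2 ^ 2 = P.eval q.1 ∧
      ∀ ρ : Fin 4, ρ ≠ 0 → q.1 ≠ (doubledTorus τ).weierstrassP (2 * ω τ ρ)}

/-- The point `X(2ω_ρ)` of `ℂP¹`, where `X = ℘(·, 2τ)`. -/
def polePoint (τ : UpperHalfPlane) (ρ : Fin 4) : OnePoint ℂ :=
  if ρ = 0 then OnePoint.infty else (((doubledTorus τ).weierstrassP (2 * ω τ ρ) : ℂ) : OnePoint ℂ)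

/-- The equations of motion of the system with Hamiltonian `hamiltonian τ g` are represented by
the Lax pair `(laxL τ ν, laxM τ ν / 2)`. -/
def LaxRepresentation (τ : UpperHalfPlane) (g ν : Fin 4 → ℂ) : Prop :=
  ∀ (v u : ℝ → ℂ) (t : ℝ), 2 * u t ∉ (torus τ).lattice →
    (HamiltonAt τ g v u t → LaxAt τ ν v u t) ∧
    (ν ≠ 0 → DifferentiableAt ℝ u t → LaxAt τ ν v u t → HamiltonAt τ g v u t)

/-- Algebraic integrability of the system (with one degree of freedom) with Hamiltonian
`hamiltonian τ g`, by means of the Lax matrix `laxL τ ν`: the equations of motion have a Lax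
representation with a spectral parameter, and for all but finitely many values of the energy the
spectral curve, divided by the involution, is a smooth irreducible curve `y² = P(x)` which is
branched over `ℂP¹` at four points and whose genus is equal to the number `1` of degrees of
freedom. -/
def AlgebraicallyIntegrable (τ : UpperHalfPlane) (g ν : Fin 4 → ℂ) : Prop :=
  LaxRepresentation τ g ν ∧
  ∃ B : Set ℂ, B.Finite ∧
    ∀ v u : ℂ, 2 * u ∉ (torus τ).lattice → hamiltonian τ g v u ∉ B →
      ∃ P : ℂ[X], IsQuotientCurve τ (spectralCurve τ (laxL τ ν v u)) P ∧
        Squarefree P ∧ (branchPoints P).ncard = 4 ∧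
        IsDomain (CoordRing P) ∧ genus ℂ (CurveField P) = 1

end PCI

end

open PCI

/-! Everything about the spectral curve and the flow comes from one identity, `offDiag_mul`: the
product of the two off-diagonal entries of `L(z)` is `∑ K_ρ ℘(z - 2ω_ρ, 2τ) - ∑ ν_α² ℘(u + ω_α)`. A
period `m + nτ` multiplies `φ_α(z, ω_α + u)` by `e(-nu)` and a sign depending on `α` and on the
class of the period modulo `2Λ`. In the product the factors `e(±nu)` cancel, so it is elliptic for
`2Λ`. The lower entry is the upper one at `(-u)`, and changing both signs of `(u, z)` negates that
function; hence the product is even in `z` up to the sign twists, its poles have no simple part, and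
the double pole at `2ω_ρ` has coefficient `(∑ I_{ρα} ν_α)² = K_ρ`. Liouville leaves a constant. It
is found by adding the values at the four points `z + 2ω_ρ`: orthogonality of the signs removes the
mixed terms, and `φ_α(z, ω_α + u) φ_α(z, ω_α - u) = ℘(z) - ℘(u + ω_α)`.

The facts on theta functions come from Fourier series: an entire function with the multipliers of
`ϑ²` is determined by two coefficients (`eq_zero_of_two_coeff`). This gives the product formula for
`℘(z) - ℘(w)`, and from it the simple zeros of `ϑ`.

For the reduction, the off-diagonal residues are sign transforms of the coefficients. The sign
matrix has square 4, so the residues determine the coefficients and conversely.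

For the spectral curve, `℘(z - 2ω_ρ, 2τ)` is a Möbius function of `X = ℘(z, 2τ)`, which makes `λ²` a
quotient of a numerator `N_E(X)` by `(X - e₁)(X - e₂)(X - e₃)`. Its poles are read off from the
leading coefficient and the values of `N_E` at the `eᵢ`.

For the Lax equation, the identity is differentiated in `u`. The converse needs only one `z` with a
nonzero entry of `M(z)`.

For the quotient curve, `℘'² = 4(X - e₁)(X - e₂)(X - e₃)` gives `y² = 4N_E(x)`. This pencil in `E`
has a squarefree generator, so only finitely many members have multiple roots
(`finite_not_squarefree_pencil`). The genus is 1 because `dx/y` spans the regular differentials: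
integrality over `ℂ[x]` and over `ℂ[1/x]` bounds a regular differential in both charts
(`IsQuadraticField.genus_eq_one`). -/

namespace PCI

/-! ### Removable singularities and Liouville's theorem -/

/-- `f` agrees near `z`, except possibly at `z` itself, with a function analytic at `z`. -/
def HasRemovableAt (f : ℂ → ℂ) (z : ℂ) : Prop := ∃ g : ℂ → ℂ, AnalyticAt ℂ g z ∧ f =ᶠ[𝓝[≠] z] g

theorem HasRemovableAt.of_analyticAt {f : ℂ → ℂ} {z : ℂ} (h : AnalyticAt ℂ f z) :
    HasRemovableAt f z := ⟨f, h, EventuallyEq.rfl⟩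

theorem HasRemovableAt.congr {f g : ℂ → ℂ} {z : ℂ} (h : HasRemovableAt f z)
    (hfg : g =ᶠ[𝓝[≠] z] f) : HasRemovableAt g z := by
  obtain ⟨k, hk, hk'⟩ := h
  exact ⟨k, hk, hfg.trans hk'⟩

theorem HasRemovableAt.add {f g : ℂ → ℂ} {z : ℂ} (hf : HasRemovableAt f z)
    (hg : HasRemovableAt g z) : HasRemovableAt (fun x => f x + g x) z := by
  obtain ⟨k, hk, hk'⟩ := hf
  obtain ⟨l, hl, hl'⟩ := hg
  exact ⟨fun x => k x + l x, hk.add hl, hk'.add hl'⟩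

theorem HasRemovableAt.sub {f g : ℂ → ℂ} {z : ℂ} (hf : HasRemovableAt f z)
    (hg : HasRemovableAt g z) : HasRemovableAt (fun x => f x - g x) z := by
  obtain ⟨k, hk, hk'⟩ := hf
  obtain ⟨l, hl, hl'⟩ := hg
  exact ⟨fun x => k x - l x, hk.sub hl, hk'.sub hl'⟩

theorem HasRemovableAt.mul {f g : ℂ → ℂ} {z : ℂ} (hf : HasRemovableAt f z)
    (hg : HasRemovableAt g z) : HasRemovableAt (fun x => f x * g x) z := by
  obtain ⟨k, hk, hk'⟩ := hf
  obtain ⟨l, hl, hl'⟩ := hg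
  exact ⟨fun x => k x * l x, hk.mul hl, hk'.mul hl'⟩

theorem tendsto_add_punctured (z a : ℂ) : Tendsto (fun x => x + a) (𝓝[≠] z) (𝓝[≠] (z + a)) := by
  refine tendsto_nhdsWithin_of_tendsto_nhds_of_eventually_within _ ?_ ?_
  · exact ((continuous_add_const a).tendsto z).mono_left nhdsWithin_le_nhds
  · filter_upwards [self_mem_nhdsWithin] with x hx
    simpa using hx

theorem HasRemovableAt.comp_add {f : ℂ → ℂ} {z a : ℂ} (hf : HasRemovableAt f (z + a)) :
    HasRemovableAt (fun x => f (x + a)) z := by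
  obtain ⟨k, hk, hk'⟩ := hf
  refine ⟨fun x => k (x + a), ?_, (tendsto_add_punctured z a).eventually hk'⟩
  exact AnalyticAt.fun_comp (f := fun x => x + a) (g := k) hk (by fun_prop)

theorem eq_of_eventuallyEq_punctured {f g : ℂ → ℂ} {z : ℂ} (hf : ContinuousAt f z)
    (hg : ContinuousAt g z) (h : f =ᶠ[𝓝[≠] z] g) : f z = g z :=
  tendsto_nhds_unique (hf.tendsto.mono_left nhdsWithin_le_nhds)
    ((hg.tendsto.mono_left nhdsWithin_le_nhds).congr' h.symm)

/-- At points near `z₀` the local representatives `g z` and `g z₀` are both continuous extensions of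
`f`, hence have the same value. The diagonal `z ↦ g z z` therefore agrees with `g z₀` near `z₀`. -/
theorem exists_entire {f : ℂ → ℂ} (h : ∀ z, HasRemovableAt f z) :
    ∃ F : ℂ → ℂ, Differentiable ℂ F ∧ ∀ z, f =ᶠ[𝓝[≠] z] F := by
  choose g hg hfg using h
  have key : ∀ z₀, (fun z => g z z) =ᶠ[𝓝 z₀] g z₀ := by
    intro z₀
    have h1 : ∀ᶠ z in 𝓝[≠] z₀, f =ᶠ[𝓝[≠] z] g z₀ :=
      (eventually_eventually_nhdsWithin (s := {z₀}ᶜ)).2 (hfg z₀) |>.and self_mem_nhdsWithin |>.mono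
        fun z hz => by
          have : 𝓝[{z₀}ᶜ] z = 𝓝 z := isOpen_compl_singleton.nhdsWithin_eq hz.2
          have h2 := hz.1
          rw [this] at h2
          exact h2.filter_mono nhdsWithin_le_nhds
    have h2 : ∀ᶠ z in 𝓝[≠] z₀, g z z = g z₀ z := by
      filter_upwards [h1, (hg z₀).eventually_analyticAt.filter_mono nhdsWithin_le_nhds] with z hz hz'
      exact eq_of_eventuallyEq_punctured (hg z).continuousAt hz'.continuousAt
        ((hfg z).symm.trans hz)
    rw [eventually_nhdsWithin_iff] at h2
    filter_upwards [h2] with z hz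
    by_cases hzz : z = z₀
    · rw [hzz]
    · exact hz hzz
  refine ⟨fun z => g z z, fun z => ?_, fun z => ?_⟩
  · exact ((hg z).congr (key z).symm).differentiableAt
  · exact (hfg z).trans ((key z).symm.filter_mono nhdsWithin_le_nhds)

/-- Liouville's theorem for elliptic functions with removable singularities. -/
theorem elliptic_liouville (L : PeriodPair) {f : ℂ → ℂ} (h : ∀ z, HasRemovableAt f z)
    (hp : ∀ z, ∀ l ∈ L.lattice, f (z + l) = f z) :
    ∃ c, ∀ z, ContinuousAt f z → f z = c := by
  obtain ⟨F, hF, hfF⟩ := exists_entire h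
  have hFp : ∀ z, ∀ l ∈ L.lattice, F (z + l) = F z := by
    intro z l hl
    refine eq_of_eventuallyEq_punctured (f := fun x => F (x + l)) (g := F)
      (hF.continuous.comp (continuous_add_const l)).continuousAt hF.continuous.continuousAt ?_
    have h1 := (tendsto_add_punctured z l).eventually (hfF (z + l))
    filter_upwards [h1, hfF z] with x hx hx'
    rw [← hx, ← hx', hp x l hl]
  refine ⟨F 0, fun z hz => ?_⟩
  rw [eq_of_eventuallyEq_punctured hz hF.continuous.continuousAt (hfF z)]
  exact hF.apply_eq_apply_of_bounded (IsZLattice.isCompact_range_of_periodic L.lattice _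
    hF.continuous fun z w hw => hFp z w hw).isBounded z 0

/-! ### Fourier expansions of entire functions with period one -/

theorem e_add (x y : ℂ) : e (x + y) = e x * e y := by
  simp only [e, ← Complex.exp_add]; ring_nf

theorem e_zero : e 0 = 1 := by simp [e]

theorem e_ne_zero (x : ℂ) : e x ≠ 0 := Complex.exp_ne_zero _

theorem e_neg (x : ℂ) : e (-x) = (e x)⁻¹ := by
  rw [e, e, ← Complex.exp_neg]; ring_nf

theorem e_int (n : ℤ) : e n = 1 := by
  rw [e, show 2 * Real.pi * Complex.I * (n : ℂ) = n * (2 * Real.pi * Complex.I) by ring]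
  exact Complex.exp_int_mul_two_pi_mul_I n

theorem differentiable_e : Differentiable ℂ e := by
  unfold e; fun_prop

theorem hasDerivAt_e (x : ℂ) : HasDerivAt e (2 * Real.pi * Complex.I * e x) x := by
  have := ((hasDerivAt_id x).const_mul (2 * Real.pi * Complex.I)).cexp
  rw [mul_comm, ← mul_one (2 * Real.pi * Complex.I)]
  exact this

/-- A real shift is absorbed by periodicity; for an imaginary shift Cauchy's theorem is applied to a
rectangle whose vertical sides cancel by periodicity. -/
theorem integral_shift_of_periodic {h : ℂ → ℂ} (hd : Differentiable ℂ h)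
    (hp : ∀ z, h (z + 1) = h z) (w : ℂ) :
    ∫ x in (0 : ℝ)..1, h (x + w) = ∫ x in (0 : ℝ)..1, h x := by
  have h1 : ∫ x in (0 : ℝ)..1, h (x + w) = ∫ x in (0 : ℝ)..1, h (x + w.im * Complex.I) := by
    have hper : Function.Periodic (fun x : ℝ => h (x + w.im * Complex.I)) 1 := by
      intro x
      have := hp (x + w.im * Complex.I)
      simp only
      rw [← this]
      push_cast
      ring_nf
    have h2 := hper.intervalIntegral_add_eq w.re 0
    rw [zero_add] at h2
    rw [← h2]
    have h3 := intervalIntegral.integral_comp_add_right (a := 0) (b := 1)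
      (fun x : ℝ => h (x + w.im * Complex.I)) w.re
    rw [zero_add, add_comm 1 w.re] at h3
    rw [← h3]
    congr 1
    ext x
    congr 1
    conv_lhs => rw [← Complex.re_add_im w]
    push_cast
    ring
  rw [h1]
  have h2 := Complex.integral_boundary_rect_eq_zero_of_differentiableOn h 0 (1 + w.im * Complex.I)
    hd.differentiableOn
  simp at h2
  have h3 : ∀ y : ℝ, h (1 + y * Complex.I) = h (y * Complex.I) := by
    intro y; rw [add_comm, hp]
  simp only [h3] at h2
  linear_combination -h2

/-- The zero sequence is summable, so the Fourier series converges pointwise and `f` vanishes on the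
real line; the identity theorem does the rest. -/
theorem eq_zero_of_fourier_zero {f : ℂ → ℂ} (hd : Differentiable ℂ f) (hp : ∀ z, f (z + 1) = f z)
    (h0 : ∀ n : ℤ, ∫ x in (0 : ℝ)..1, f x * e (-n * x) = 0) (z : ℂ) : f z = 0 := by
  have hper : Function.Periodic (fun x : ℝ => f x) 1 := by
    intro x
    have := hp x
    simpa using this
  have : Fact ((0 : ℝ) < 1) := ⟨one_pos⟩
  let F : C(AddCircle (1 : ℝ), ℂ) := ⟨hper.lift, by
    refine continuous_coinduced_dom.mpr ?_
    exact hd.continuous.comp Complex.continuous_ofReal⟩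
  have hF : ∀ x : ℝ, F x = f x := fun x => rfl
  have hc : ∀ n, fourierCoeff F n = 0 := by
    intro n
    rw [fourierCoeff_eq_intervalIntegral _ n 0]
    simp only [hF, zero_add]
    rw [← h0 n] 
    simp only [one_div, inv_one, one_smul]
    congr 1
    ext x
    rw [fourier_coe_apply, smul_eq_mul, mul_comm]
    congr 2
    push_cast
    ring
  have hs : Summable (fourierCoeff F) := by
    rw [show fourierCoeff (F : AddCircle (1 : ℝ) → ℂ) = fun _ => 0 from funext hc]
    exact summable_zero
  have hr : ∀ x : ℝ, f x = 0 := by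
    intro x
    have h1 := has_pointwise_sum_fourier_series_of_summable hs x
    simp only [hc, zero_smul] at h1
    rw [← hF, ← h1.unique hasSum_zero]
  have han : AnalyticOnNhd ℂ f Set.univ := fun z _ => hd.analyticAt z
  refine han.eqOn_zero_of_preconnected_of_frequently_eq_zero isPreconnected_univ
    (Set.mem_univ 0) ?_ (Set.mem_univ z)
  have ht : Tendsto (fun n : ℕ => ((1 / ((n : ℝ) + 1) : ℝ) : ℂ)) atTop (𝓝[≠] 0) := by
    refine tendsto_nhdsWithin_of_tendsto_nhds_of_eventually_within _ ?_ ?_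
    · have := (Complex.continuous_ofReal.tendsto 0).comp (tendsto_one_div_add_atTop_nhds_zero_nat (𝕜 := ℝ))
      simpa [Function.comp_def] using this
    · refine Eventually.of_forall fun n => ?_
      simp only [Set.mem_compl_iff, Set.mem_singleton_iff, Complex.ofReal_eq_zero]
      positivity
  exact ht.frequently (Frequently.of_forall fun n => hr _)

/-- An entire function `f` with `f(z+1) = f(z)`, `f(z+τ) = c e(-2z) f(z)` vanishes if its Fourier
coefficients with the indices `0` and `1` do. -/
theorem eq_zero_of_two_coeff {f : ℂ → ℂ} (hd : Differentiable ℂ f) (hp : ∀ z, f (z + 1) = f z)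
    {τ c : ℂ} (hc : c ≠ 0) (hτ : ∀ z, f (z + τ) = c * e (-2 * z) * f z)
    (h0 : ∫ x in (0 : ℝ)..1, f x = 0) (h1 : ∫ x in (0 : ℝ)..1, f x * e (-x) = 0) (z : ℂ) :
    f z = 0 := by
  -- Shifting the contour by `τ` brings in the factor `e(-2x)`, which ties the coefficient of index
  -- `n + 2` to that of index `n`. So the indices `0` and `1` control all others.
  have hrec : ∀ n : ℤ, c * e (-n * τ) * (∫ x in (0 : ℝ)..1, f x * e (-((n + 2 : ℤ) : ℂ) * x)) =
      (∫ x in (0 : ℝ)..1, f x * e (-n * x)) := by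
    intro n
    rw [← integral_shift_of_periodic (h := fun x => f x * e (-n * x)) ?_ ?_ τ,
      ← intervalIntegral.integral_const_mul]
    · congr 1
      ext x
      rw [hτ, show (-n * (x + τ) : ℂ) = -n * x + (-n * τ) by ring, e_add,
        show (-((n + 2 : ℤ) : ℂ) * x : ℂ) = -2 * x + (-n * x) by push_cast; ring, e_add]
      ring
    · have := differentiable_e
      fun_prop
    · intro z
      rw [hp, show (-n * (z + 1) : ℂ) = -n * z + ((-n : ℤ) : ℂ) by push_cast; ring, e_add, e_int]
      simp
  have step : ∀ n : ℤ, (∫ x in (0 : ℝ)..1, f x * e (-((n + 2 : ℤ) : ℂ) * x)) = 0 ↔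
      (∫ x in (0 : ℝ)..1, f x * e (-n * x)) = 0 := by
    intro n
    rw [← hrec n]
    simp [hc, e_ne_zero]
  have both : ∀ n : ℕ, ((∫ x in (0 : ℝ)..1, f x * e (-((n : ℤ) : ℂ) * x)) = 0 ∧
      (∫ x in (0 : ℝ)..1, f x * e (-(((n : ℤ) + 1 : ℤ) : ℂ) * x)) = 0) ∧
      ((∫ x in (0 : ℝ)..1, f x * e (-((-(n : ℤ) : ℤ) : ℂ) * x)) = 0 ∧
      (∫ x in (0 : ℝ)..1, f x * e (-((-(n : ℤ) + 1 : ℤ) : ℂ) * x)) = 0) := by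
    intro n
    induction n with
    | zero => simpa [e_zero] using ⟨h0, h1⟩
    | succ k ih =>
      obtain ⟨⟨a, b⟩, c', d⟩ := ih
      refine ⟨⟨?_, ?_⟩, ?_, ?_⟩
      · rw [show ((k + 1 : ℕ) : ℤ) = (k : ℤ) + 1 by push_cast; ring]; exact b
      · rw [show ((k + 1 : ℕ) : ℤ) + 1 = (k : ℤ) + 2 by push_cast; ring]; exact (step _).2 a
      · rw [← step, show (-((k + 1 : ℕ) : ℤ)) + 2 = -(k : ℤ) + 1 by push_cast; ring]; exact d
      · rw [show (-((k + 1 : ℕ) : ℤ)) + 1 = -(k : ℤ) by push_cast; ring]; exact c'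
  refine eq_zero_of_fourier_zero hd hp (fun n => ?_) z
  obtain ⟨k, rfl | rfl⟩ := n.eq_nat_or_neg
  · exact (both k).1.1
  · exact (both k).2.1

/-- Functions `f, g, t` as in the preceding lemma: if `f` and `g` vanish at a point where `t` does
not, and `g ≠ 0`, then `f` is a multiple of `g`. -/
theorem proportional_of_common_zero {τ c : ℂ} (hc : c ≠ 0) {f g t : ℂ → ℂ}
    (hd : Differentiable ℂ f) (hp : ∀ z, f (z + 1) = f z) (hτ : ∀ z, f (z + τ) = c * e (-2 * z) * f z)
    (hd' : Differentiable ℂ g) (hp' : ∀ z, g (z + 1) = g z)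
    (hτ' : ∀ z, g (z + τ) = c * e (-2 * z) * g z)
    (hd'' : Differentiable ℂ t) (hp'' : ∀ z, t (z + 1) = t z)
    (hτ'' : ∀ z, t (z + τ) = c * e (-2 * z) * t z)
    {w : ℂ} (hf : f w = 0) (hg : g w = 0) (ht : t w ≠ 0) (hg0 : ∃ z, g z ≠ 0) :
    ∃ k, ∀ z, f z = k * g z := by
  have lin : ∀ a b d : ℂ,
      a * (∫ x in (0 : ℝ)..1, f x) + b * (∫ x in (0 : ℝ)..1, g x) + d * (∫ x in (0 : ℝ)..1, t x) = 0 →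
      a * (∫ x in (0 : ℝ)..1, f x * e (-x)) + b * (∫ x in (0 : ℝ)..1, g x * e (-x))
        + d * (∫ x in (0 : ℝ)..1, t x * e (-x)) = 0 →
      ∀ z, a * f z + b * g z + d * t z = 0 := by
    intro a b d h0 h1
    have cf := hd.continuous
    have cg := hd'.continuous
    have ct := hd''.continuous
    have ce := differentiable_e.continuous
    have int : ∀ h : ℂ → ℂ, Continuous h →
        IntervalIntegrable (fun x : ℝ => h x) MeasureTheory.volume 0 1 :=
      fun h hh => (hh.comp Complex.continuous_ofReal).intervalIntegrable _ _
    refine eq_zero_of_two_coeff (f := fun z => a * f z + b * g z + d * t z) (τ := τ) (by fun_prop)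
      (fun z => by simp only [hp, hp', hp'']) hc
      (fun z => by simp only [hτ, hτ', hτ'']; ring) ?_ ?_
    · rw [intervalIntegral.integral_add (int (fun z => a * f z + b * g z) (by fun_prop))
        (int (fun z => d * t z) (by fun_prop)),
        intervalIntegral.integral_add (int (fun z => a * f z) (by fun_prop))
        (int (fun z => b * g z) (by fun_prop))]
      simpa only [intervalIntegral.integral_const_mul] using h0
    · rw [← h1, ← intervalIntegral.integral_const_mul, ← intervalIntegral.integral_const_mul,
        ← intervalIntegral.integral_const_mul,
        ← intervalIntegral.integral_add (int (fun z => a * (f z * e (-z))) (by fun_prop))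
        (int (fun z => b * (g z * e (-z))) (by fun_prop)),
        ← intervalIntegral.integral_add
        (int (fun z => a * (f z * e (-z)) + b * (g z * e (-z))) (by fun_prop))
        (int (fun z => d * (t z * e (-z))) (by fun_prop))]
      congr 1
      ext x
      ring
  set f0 := ∫ x in (0 : ℝ)..1, f x
  set g0 := ∫ x in (0 : ℝ)..1, g x
  set t0 := ∫ x in (0 : ℝ)..1, t x
  set f1 := ∫ x in (0 : ℝ)..1, f x * e (-x)
  set g1 := ∫ x in (0 : ℝ)..1, g x * e (-x)
  set t1 := ∫ x in (0 : ℝ)..1, t x * e (-x)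
  -- The coefficients are the `2 × 2` minors of the `2 × 3` matrix of Fourier coefficients, so this
  -- combination of `f, g, t` is zero; at `w` only the term of `t` survives.
  have hdet : f0 * g1 - f1 * g0 = 0 := by
    have := lin (-(t0 * g1 - t1 * g0)) (-(f0 * t1 - f1 * t0)) (f0 * g1 - f1 * g0)
      (by ring) (by ring) w
    rw [hf, hg] at this
    simpa [ht] using this
  have hA := lin g0 (-f0) 0 (by ring) (by linear_combination -hdet)
  have hB := lin g1 (-f1) 0 (by linear_combination hdet) (by ring)
  by_cases hg0' : g0 = 0
  · have hg1 : g1 ≠ 0 := by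
      intro hg1
      obtain ⟨z, hz⟩ := hg0
      exact hz (by simpa using lin 0 1 0 (by simp [hg0']) (by simp [hg1]) z)
    refine ⟨f1 / g1, fun z => ?_⟩
    have := hB z
    field_simp
    linear_combination this
  · refine ⟨f0 / g0, fun z => ?_⟩
    have := hA z
    field_simp
    linear_combination this

/-! ### The lattices -/

theorem mem_torus {τ : UpperHalfPlane} {z : ℂ} :
    z ∈ (torus τ).lattice ↔ ∃ m n : ℤ, (m : ℂ) + n * τ = z := by
  simp [PeriodPair.mem_lattice, torus]

theorem mem_doubledTorus {τ : UpperHalfPlane} {z : ℂ} :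
    z ∈ (doubledTorus τ).lattice ↔ z / 2 ∈ (torus τ).lattice := by
  rw [mem_torus, PeriodPair.mem_lattice]
  refine exists_congr fun m => exists_congr fun n => ?_
  simp only [doubledTorus]
  constructor
  · rintro rfl; ring
  · intro h; linear_combination 2 * h

theorem doubledTorus_le (τ : UpperHalfPlane) {z : ℂ} (h : z ∈ (doubledTorus τ).lattice) :
    z ∈ (torus τ).lattice := by
  rw [mem_doubledTorus] at h
  have := add_mem h h
  rwa [add_halves] at this

theorem wp_add {L : PeriodPair} (z : ℂ) {l : ℂ} (h : l ∈ L.lattice) :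
    L.weierstrassP (z + l) = L.weierstrassP z := L.weierstrassP_add_coe z ⟨l, h⟩

theorem eventually_notMem (L : PeriodPair) (z : ℂ) : ∀ᶠ x in 𝓝[≠] z, x ∉ L.lattice := by
  filter_upwards [mem_nhdsWithin_of_mem_nhds (L.compl_lattice_sdiff_singleton_mem_nhds z),
    self_mem_nhdsWithin] with x hx hx'
  simp_all

theorem analyticAt_wp {L : PeriodPair} {z : ℂ} (h : z ∉ L.lattice) :
    AnalyticAt ℂ L.weierstrassP z := L.analyticOnNhd_weierstrassP z h

theorem tendsto_sq_mul_wp (L : PeriodPair) :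
    Tendsto (fun z => z ^ 2 * L.weierstrassP z) (𝓝[≠] 0) (𝓝 1) := by
  have h0 : (0 : ℂ) ∈ L.lattice := zero_mem _
  have h1 : ContinuousAt (fun z : ℂ => z ^ 2 * L.weierstrassPExcept 0 z + 1) 0 := by
    have := (L.analyticAt_weierstrassPExcept 0).continuousAt
    fun_prop
  have h2 := h1.tendsto.mono_left (nhdsWithin_le_nhds (s := {0}ᶜ))
  simp only [ne_eq, OfNat.ofNat_ne_zero, not_false_eq_true, zero_pow, zero_mul, zero_add] at h2
  refine h2.congr' ?_
  filter_upwards [self_mem_nhdsWithin] with z hz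
  have := L.ite_eq_one_sub_sq_mul_weierstrassP 0 h0 z
  rw [if_neg (show ¬ z = 0 from hz)] at this
  simpa using this.symm

/-! ### The theta function -/

section
variable (τ : UpperHalfPlane)

theorem differentiable_theta : Differentiable ℂ (theta τ) := by
  intro z
  have h : DifferentiableAt ℂ (fun z => jacobiTheta₂ z τ) (z + (1 + τ) / 2) :=
    differentiableAt_jacobiTheta₂_fst _ τ.im_pos
  have h2 : DifferentiableAt ℂ (fun z : ℂ => jacobiTheta₂ (z + (1 + τ) / 2) τ) z :=
    DifferentiableAt.comp (g := fun z => jacobiTheta₂ z τ) (f := fun z : ℂ => z + (1 + τ) / 2) z h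
      (by fun_prop)
  unfold theta
  fun_prop

theorem analyticAt_theta (z : ℂ) : AnalyticAt ℂ (theta τ) z := (differentiable_theta τ).analyticAt z

theorem exp_pi_mul_I_mul (x : ℂ) : Complex.exp (Real.pi * Complex.I * x) = e (x / 2) := by
  rw [e]; ring_nf

theorem e_half : e (1 / 2) = -1 := by
  rw [e, show 2 * Real.pi * Complex.I * (1 / 2 : ℂ) = Real.pi * Complex.I by ring,
    Complex.exp_pi_mul_I]

theorem theta_eq (z : ℂ) :
    theta τ z = e (τ / 8 + z / 2) * jacobiTheta₂ (z + (1 + τ) / 2) τ := by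
  rw [theta, exp_pi_mul_I_mul]; ring_nf

theorem theta_neg (z : ℂ) : theta τ (-z) = -theta τ z := by
  rw [theta_eq, theta_eq, ← jacobiTheta₂_neg_left]
  have h1 := jacobiTheta₂_add_left' (z + (-1 - τ) / 2) τ
  rw [← jacobiTheta₂_add_left,
    show z + (-1 - (τ : ℂ)) / 2 + τ + 1 = z + (1 + τ) / 2 by ring] at h1
  rw [h1, show -(-z + (1 + (τ : ℂ)) / 2) = z + (-1 - τ) / 2 by ring,
    show (-Real.pi * Complex.I * (τ + 2 * (z + (-1 - (τ : ℂ)) / 2)) : ℂ) =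
      Real.pi * Complex.I * (1 - 2 * z) by ring, exp_pi_mul_I_mul,
    show (τ : ℂ) / 8 + z / 2 = (τ / 8 + -z / 2) + z by ring, e_add _ z,
    show (1 - 2 * z) / 2 = 1 / 2 + (-z) by ring, e_add (1 / 2), e_half, e_neg]
  have := e_ne_zero z
  field_simp

theorem theta_zero : theta τ 0 = 0 := by
  have := theta_neg τ 0
  rw [neg_zero] at this
  exact self_eq_neg.mp this

theorem theta_add_one (z : ℂ) : theta τ (z + 1) = -theta τ z := by
  rw [theta_eq, theta_eq, show z + 1 + (1 + (τ : ℂ)) / 2 = z + (1 + τ) / 2 + 1 by ring,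
    jacobiTheta₂_add_left, show (τ : ℂ) / 8 + (z + 1) / 2 = (τ / 8 + z / 2) + 1 / 2 by ring,
    e_add _ (1 / 2), e_half]
  ring

theorem theta_add_tau (z : ℂ) : theta τ (z + τ) = -e (-τ / 2) * e (-z) * theta τ z := by
  rw [theta_eq, theta_eq, show z + τ + (1 + (τ : ℂ)) / 2 = z + (1 + τ) / 2 + τ by ring,
    jacobiTheta₂_add_left', show (-Real.pi * Complex.I * (τ + 2 * (z + (1 + (τ : ℂ)) / 2)) : ℂ) =
      Real.pi * Complex.I * (-2 * τ - 2 * z - 1) by ring, exp_pi_mul_I_mul]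
  have key : e (τ / 8 + (z + τ) / 2) * e ((-2 * τ - 2 * z - 1) / 2) =
      -e (-τ / 2) * e (-z) * e (τ / 8 + z / 2) := by
    rw [show -e (-τ / 2) * e (-z) = e (1 / 2) * (e (-τ / 2) * e (-z)) by rw [e_half]; ring,
      ← e_add, ← e_add, ← e_add, ← e_add, show (τ : ℂ) / 8 + (z + τ) / 2 + (-2 * τ - 2 * z - 1) / 2 =
      (1 / 2 + (-τ / 2 + -z) + (τ / 8 + z / 2)) + ((-1 : ℤ) : ℂ) by push_cast; ring,
      e_add _ ((-1 : ℤ) : ℂ), e_int, mul_one]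
  linear_combination jacobiTheta₂ (z + (1 + τ) / 2) τ * key

/-- Only the dependence of the multiplier on `z` is recorded, since in quotients such as `phi` the
constant `c` cancels. -/
theorem theta_add_period (m n : ℤ) :
    ∃ c : ℂ, c ≠ 0 ∧ ∀ z, theta τ (z + (m + n * τ)) = c * e (-n * z) * theta τ z := by
  have h1 : ∀ m : ℤ, ∃ c : ℂ, c ≠ 0 ∧ ∀ z, theta τ (z + m) = c * theta τ z := by
    intro m
    induction m with
    | zero => exact ⟨1, one_ne_zero, by simp⟩
    | succ k ih =>
      obtain ⟨c, hc, h⟩ := ih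
      refine ⟨-c, neg_ne_zero.2 hc, fun z => ?_⟩
      push_cast
      rw [← add_assoc, theta_add_one]
      have := h z
      push_cast at this
      rw [this]; ring
    | pred k ih =>
      obtain ⟨c, hc, h⟩ := ih
      refine ⟨-c, neg_ne_zero.2 hc, fun z => ?_⟩
      have h2 := theta_add_one τ (z + ((-k - 1 : ℤ) : ℂ))
      have := h z
      push_cast at this h2 ⊢
      rw [show z + (-(k : ℂ) - 1) + 1 = z + -k by ring, this] at h2
      linear_combination h2
  have h2 : ∀ n : ℤ, ∃ c : ℂ, c ≠ 0 ∧ ∀ z, theta τ (z + n * τ) = c * e (-n * z) * theta τ z := by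
    intro n
    induction n with
    | zero => exact ⟨1, one_ne_zero, by simp [e_zero]⟩
    | succ k ih =>
      obtain ⟨c, hc, h⟩ := ih
      refine ⟨-e (-τ / 2) * e (-(k * τ)) * c, by simp [hc, e_ne_zero], fun z => ?_⟩
      have := h z
      push_cast at this ⊢
      rw [show z + ((k : ℂ) + 1) * τ = z + k * τ + τ by ring, theta_add_tau, this,
        show -(z + k * (τ : ℂ)) = -z + -(k * τ) by ring, e_add,
        show (-((k : ℂ) + 1) * z) = -k * z + -z by ring, e_add]
      ring
    | pred k ih =>
      obtain ⟨c, hc, h⟩ := ih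
      refine ⟨-e (τ / 2) * e ((-k - 1) * τ) * c, by simp [hc, e_ne_zero], fun z => ?_⟩
      have h2 := theta_add_tau τ (z + ((-k - 1 : ℤ) : ℂ) * τ)
      have := h z
      push_cast at this h2 ⊢
      rw [show z + (-(k : ℂ) - 1) * τ + τ = z + -k * τ by ring, this,
        show -(z + (-(k : ℂ) - 1) * τ) = -(z + (-k - 1) * τ) by ring, e_neg, e_add, neg_div, e_neg]
        at h2
      rw [show (-(-(k : ℂ) - 1) * z) = - -k * z + z by ring, e_add]
      have e1 := e_ne_zero ((τ : ℂ) / 2)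
      have e2 := e_ne_zero z
      have e3 := e_ne_zero ((-(k : ℂ) - 1) * τ)
      generalize e ((-(k : ℂ) - 1) * τ) = E at *
      field_simp at h2 ⊢
      linear_combination h2
  obtain ⟨c, hc, h⟩ := h1 m
  obtain ⟨d, hd, h'⟩ := h2 n
  refine ⟨c * d, mul_ne_zero hc hd, fun z => ?_⟩
  rw [show z + (m + n * (τ : ℂ)) = z + n * τ + m by ring, h, h']
  ring

theorem theta_of_mem {l : ℂ} (hl : l ∈ (torus τ).lattice) : theta τ l = 0 := by
  obtain ⟨m, n, rfl⟩ := mem_torus.1 hl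
  obtain ⟨c, -, h⟩ := theta_add_period τ m n
  have := h 0
  rwa [theta_zero, mul_zero, zero_add] at this

/-- Integrating the series of `jacobiTheta₂` over `[0, 1]` term by term leaves only the term `n =
0`, which contributes `1`. -/
theorem exists_theta_ne_zero : ∃ z, theta τ z ≠ 0 := by
  by_contra! h
  have h0 : ∀ z : ℂ, jacobiTheta₂ z τ = 0 := by
    intro z
    have := h (z - (1 + τ) / 2)
    rw [theta_eq, sub_add_cancel] at this
    exact (mul_eq_zero.1 this).resolve_left (e_ne_zero _)
  let F : ℤ → C(ℝ, ℂ) := fun n => ⟨fun x => jacobiTheta₂_term n x τ, by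
    unfold jacobiTheta₂_term; fun_prop⟩
  have hs : Summable fun n : ℤ => Real.exp (-Real.pi * n ^ 2 * τ.im) := by
    have := ((summable_jacobiTheta₂_term_iff 0 τ).2 τ.im_pos).norm
    simpa [norm_jacobiTheta₂_term] using this
  have key := intervalIntegral.hasSum_intervalIntegral_of_summable_norm (a := 0) (b := 1) (f := F) (by
    refine Summable.of_nonneg_of_le (fun _ => norm_nonneg _) (fun n => ?_) hs
    rw [ContinuousMap.norm_le _ (Real.exp_nonneg _)]
    intro x
    simp only [F, ContinuousMap.restrict_apply, ContinuousMap.coe_mk, norm_jacobiTheta₂_term]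
    simp)
  have hz : ∀ x : ℝ, ∑' n, F n x = 0 := fun x => h0 x
  simp only [hz, intervalIntegral.integral_zero] at key
  have hi : ∀ n : ℤ, ∫ x in (0 : ℝ)..1, F n x = if n = 0 then 1 else 0 := by
    intro n
    simp only [F, ContinuousMap.coe_mk, jacobiTheta₂_term, Complex.exp_add]
    rw [intervalIntegral.integral_mul_const]
    split_ifs with hn
    · simp [hn]
    · rw [integral_exp_mul_complex]
      · have := Complex.exp_int_mul_two_pi_mul_I n
        rw [show (n : ℂ) * (2 * Real.pi * Complex.I) = 2 * Real.pi * Complex.I * n * (1 : ℝ) by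
          push_cast; ring] at this
        rw [this]
        simp
      · simp [hn, Real.pi_ne_zero, Complex.I_ne_zero]
  simp only [hi] at key
  have := (hasSum_ite_eq (0 : ℤ) (1 : ℂ)).unique key
  exact one_ne_zero this

theorem theta_eventually_ne_zero (z : ℂ) : ∀ᶠ x in 𝓝[≠] z, theta τ x ≠ 0 := by
  refine (analyticAt_theta τ z).eventually_eq_zero_or_eventually_ne_zero.resolve_left fun h => ?_
  obtain ⟨w, hw⟩ := exists_theta_ne_zero τ
  exact hw (AnalyticOnNhd.eqOn_zero_of_preconnected_of_eventuallyEq_zero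
    (fun z _ => analyticAt_theta τ z) isPreconnected_univ (Set.mem_univ z) h (Set.mem_univ w))

theorem theta_add_tau_mul (z w : ℂ) : theta τ (z + τ + w) * theta τ (z + τ - w) =
    e (-τ) * e (-2 * z) * (theta τ (z + w) * theta τ (z - w)) := by
  rw [show z + τ + w = z + w + τ by ring, show z + τ - w = z - w + τ by ring, theta_add_tau,
    theta_add_tau, show -(z + w) = -z + -w by ring, show -(z - w) = -z + w by ring, e_add, e_add,
    show -2 * z = -z + -z by ring, e_add,
    show e (-τ) = e (-τ / 2) * e (-τ / 2) by rw [← e_add, add_halves], e_neg w]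
  have := e_ne_zero w
  generalize e (-(τ : ℂ) / 2) = E
  field_simp

theorem analyticAt_dslope_theta (l z : ℂ) : AnalyticAt ℂ (dslope (theta τ) l) z := by
  have : DifferentiableOn ℂ (dslope (theta τ) l) Set.univ :=
    (Complex.differentiableOn_dslope univ_mem).2 (differentiable_theta τ).differentiableOn
  exact this.analyticAt univ_mem

theorem theta_eq_mul_dslope {l : ℂ} (hl : l ∈ (torus τ).lattice) (z : ℂ) :
    theta τ z = (z - l) * dslope (theta τ) l z := by
  have := sub_smul_dslope (theta τ) l z
  rw [theta_of_mem τ hl, sub_zero, smul_eq_mul] at this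
  exact this.symm

/-- Both sides have the multipliers of `ϑ²` and vanish at `z = w`, where `ϑ²` does not:
`proportional_of_common_zero` applies with `t = ϑ²`. The assumption reads `ϑ(w) ≠ 0` because the
zeros of `ϑ` are not yet known. -/
theorem exists_wp_sub_mul {w : ℂ} (hw : theta τ w ≠ 0) :
    ∃ k, ∀ z ∉ (torus τ).lattice,
      ((torus τ).weierstrassP z - (torus τ).weierstrassP w) * theta τ z ^ 2 =
        k * (theta τ (z + w) * theta τ (z - w)) := by
  set L := torus τ
  have hdθ := differentiable_theta τ
  set f : ℂ → ℂ := fun z => (L.weierstrassP z - L.weierstrassP w) * theta τ z ^ 2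
  have hfa : ∀ z ∉ L.lattice, AnalyticAt ℂ f z := by
    intro z hz
    exact ((analyticAt_wp hz).sub analyticAt_const).mul ((analyticAt_theta τ z).pow 2)
  have hrem : ∀ z, HasRemovableAt f z := by
    intro l
    by_cases hl : l ∈ L.lattice
    · refine ⟨fun z => ((z - l) ^ 2 * L.weierstrassPExcept l z + 1 - (z - l) ^ 2 * (l ^ 2)⁻¹
        - (z - l) ^ 2 * L.weierstrassP w) * dslope (theta τ) l z ^ 2, ?_, ?_⟩
      · have h1 := L.analyticAt_weierstrassPExcept l
        have h2 := analyticAt_dslope_theta τ l l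
        fun_prop
      · filter_upwards [self_mem_nhdsWithin] with z hz
        have := L.ite_eq_one_sub_sq_mul_weierstrassP l hl z
        rw [if_neg (show ¬ z = l from hz), div_eq_mul_inv] at this
        simp only [f]
        rw [theta_eq_mul_dslope τ hl, ← this]
        ring
    · exact .of_analyticAt (hfa l hl)
  obtain ⟨F, hF, hfF⟩ := exists_entire hrem
  have hFf : ∀ z ∉ L.lattice, F z = f z := fun z hz =>
    (eq_of_eventuallyEq_punctured (hfa z hz).continuousAt hF.continuous.continuousAt (hfF z)).symm
  have h1 : (1 : ℂ) ∈ L.lattice := L.ω₁_mem_lattice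
  have hτ : (τ : ℂ) ∈ L.lattice := L.ω₂_mem_lattice
  have hFp : ∀ z, F (z + 1) = F z := by
    intro z
    refine eq_of_eventuallyEq_punctured (f := fun z => F (z + 1))
      (hF.continuous.comp (continuous_add_const 1)).continuousAt hF.continuous.continuousAt ?_
    filter_upwards [eventually_notMem L z] with x hx
    rw [hFf x hx, hFf _ (fun h => hx ((add_mem_cancel_right h1).1 h))]
    simp only [f, wp_add x h1, theta_add_one, neg_sq]
  have hFτ : ∀ z, F (z + τ) = e (-τ) * e (-2 * z) * F z := by
    intro z
    have ce := differentiable_e.continuous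
    refine eq_of_eventuallyEq_punctured (f := fun z => F (z + τ))
      (g := fun z => e (-τ) * e (-2 * z) * F z)
      (hF.continuous.comp (continuous_add_const _)).continuousAt
      (by have := hF.continuous; fun_prop) ?_
    filter_upwards [eventually_notMem L z] with x hx
    rw [hFf x hx, hFf _ (fun h => hx ((add_mem_cancel_right hτ).1 h))]
    have := theta_add_tau_mul τ x 0
    simp only [add_zero, sub_zero] at this
    simp only [f, wp_add x hτ]
    rw [sq, this]
    ring
  have hwL : w ∉ L.lattice := fun h => hw (theta_of_mem τ h)
  obtain ⟨z₁, hz₁⟩ : ∃ z, theta τ (z + w) * theta τ (z - w) ≠ 0 := by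
    have h2 := (tendsto_add_punctured 0 w).eventually (theta_eventually_ne_zero τ (0 + w))
    have h3 := (tendsto_add_punctured 0 (-w)).eventually (theta_eventually_ne_zero τ (0 + -w))
    obtain ⟨z, hz, hz'⟩ := (h2.and h3).exists
    exact ⟨z, mul_ne_zero hz (by rwa [sub_eq_add_neg])⟩
  obtain ⟨k, hk⟩ := proportional_of_common_zero (τ := τ) (c := e (-τ)) (e_ne_zero _) hF hFp hFτ
    (g := fun z => theta τ (z + w) * theta τ (z - w)) (t := fun z => theta τ z * theta τ z)
    (w := w) (by fun_prop)
    (fun z => by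
      rw [show z + 1 + w = z + w + 1 by ring, show z + 1 - w = z - w + 1 by ring, theta_add_one,
        theta_add_one, neg_mul_neg])
    (fun z => theta_add_tau_mul τ z w) (by fun_prop)
    (fun z => by rw [theta_add_one, neg_mul_neg])
    (fun z => by simpa using theta_add_tau_mul τ z 0)
    (by rw [hFf w hwL]; simp [f]) (by simp [theta_zero]) (mul_ne_zero hw hw) ⟨z₁, hz₁⟩
  exact ⟨k, fun z hz => by rw [← hk z, hFf z hz]⟩

/-- The factor `k` is found by letting `z → 0`: the left side tends to `ϑ'(0)²`, the right side to
`-k ϑ(w)²`. -/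
theorem wp_sub_mul {w : ℂ} (hw : theta τ w ≠ 0) {z : ℂ} (hz : z ∉ (torus τ).lattice) :
    ((torus τ).weierstrassP z - (torus τ).weierstrassP w) * theta τ z ^ 2 * theta τ w ^ 2 =
        -deriv (theta τ) 0 ^ 2 * (theta τ (z + w) * theta τ (z - w)) := by
  obtain ⟨k, hk⟩ := exists_wp_sub_mul τ hw
  have h0 : (0 : ℂ) ∈ (torus τ).lattice := zero_mem _
  have hlim : Tendsto (fun z => ((torus τ).weierstrassP z - (torus τ).weierstrassP w) * theta τ z ^ 2)
      (𝓝[≠] 0) (𝓝 (deriv (theta τ) 0 ^ 2)) := by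
    have h1 := tendsto_sq_mul_wp (torus τ)
    have h2 : Tendsto (dslope (theta τ) 0) (𝓝[≠] 0) (𝓝 (deriv (theta τ) 0)) := by
      rw [← dslope_same]
      exact (analyticAt_dslope_theta τ 0 0).continuousAt.tendsto.mono_left nhdsWithin_le_nhds
    have h3 : Tendsto (fun z : ℂ => z ^ 2 * (torus τ).weierstrassP w) (𝓝[≠] 0) (𝓝 0) := by
      have : ContinuousAt (fun z : ℂ => z ^ 2 * (torus τ).weierstrassP w) 0 := by fun_prop
      simpa using this.tendsto.mono_left (nhdsWithin_le_nhds (s := {0}ᶜ))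
    have h4 := (h1.sub h3).mul (h2.pow 2)
    rw [sub_zero, one_mul] at h4
    refine h4.congr fun z => ?_
    rw [theta_eq_mul_dslope τ h0 z]
    ring
  have hlim2 : Tendsto (fun z => k * (theta τ (z + w) * theta τ (z - w))) (𝓝[≠] 0)
      (𝓝 (k * (theta τ (0 + w) * theta τ (0 - w)))) := by
    have := (differentiable_theta τ).continuous
    have : ContinuousAt (fun z => k * (theta τ (z + w) * theta τ (z - w))) 0 := by fun_prop
    exact this.tendsto.mono_left nhdsWithin_le_nhds
  have := tendsto_nhds_unique hlim (hlim2.congr' (by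
    filter_upwards [eventually_notMem (torus τ) 0] with z hz
    exact (hk z hz).symm))
  rw [zero_add, zero_sub, theta_neg] at this
  rw [hk z hz]
  linear_combination (theta τ (z + w) * theta τ (z - w)) * this

/-- Otherwise the product formula makes `℘` constant near `0`, against its double pole. -/
theorem deriv_theta_zero_ne_zero : deriv (theta τ) 0 ≠ 0 := by
  intro h
  obtain ⟨w, hw⟩ := exists_theta_ne_zero τ
  have h1 : ∀ᶠ z in 𝓝[≠] 0, (torus τ).weierstrassP z = (torus τ).weierstrassP w := by
    filter_upwards [eventually_notMem (torus τ) 0, theta_eventually_ne_zero τ 0] with z hz hz'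
    have := wp_sub_mul τ hw hz
    rw [h] at this
    simpa [hz', hw, sub_eq_zero] using this
  have h2 : Tendsto (fun z : ℂ => z ^ 2 * (torus τ).weierstrassP w) (𝓝[≠] 0) (𝓝 0) := by
    have : ContinuousAt (fun z : ℂ => z ^ 2 * (torus τ).weierstrassP w) 0 := by fun_prop
    simpa using this.tendsto.mono_left (nhdsWithin_le_nhds (s := {0}ᶜ))
  have h3 := tendsto_nhds_unique (tendsto_sq_mul_wp (torus τ)) (h2.congr' (by
    filter_upwards [h1] with z hz
    rw [hz]))
  exact one_ne_zero h3

/-- At a zero `a` outside the lattice the product formula would give `ϑ(a + w) ϑ(a - w) = 0`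
whenever `ϑ(w) ≠ 0`, but the zeros of `ϑ` are isolated. -/
theorem theta_eq_zero_iff {a : ℂ} : theta τ a = 0 ↔ a ∈ (torus τ).lattice := by
  refine ⟨fun h => ?_, theta_of_mem τ⟩
  by_contra ha
  have h2 := (tendsto_add_punctured 0 a).eventually (theta_eventually_ne_zero τ (0 + a))
  have h3 := (tendsto_add_punctured 0 (-a)).eventually (theta_eventually_ne_zero τ (0 + -a))
  obtain ⟨w, hw, hw', hw''⟩ := (h2.and (h3.and (theta_eventually_ne_zero τ 0))).exists
  have := wp_sub_mul τ hw'' ha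
  rw [h, show a - w = -(w + -a) by ring, theta_neg, add_comm a w] at this
  simp [hw, hw', deriv_theta_zero_ne_zero] at this

theorem wp_sub {z w : ℂ} (hz : z ∉ (torus τ).lattice) (hw : w ∉ (torus τ).lattice) :
    (torus τ).weierstrassP z - (torus τ).weierstrassP w =
      -deriv (theta τ) 0 ^ 2 * (theta τ (z + w) * theta τ (z - w)) /
        (theta τ z ^ 2 * theta τ w ^ 2) := by
  rw [← theta_eq_zero_iff] at hw
  have := wp_sub_mul τ hw hz
  rw [← theta_eq_zero_iff] at hz
  rw [← this]
  field_simp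

theorem wp_eq_iff {z w : ℂ} (hz : z ∉ (torus τ).lattice) (hw : w ∉ (torus τ).lattice) :
    (torus τ).weierstrassP z = (torus τ).weierstrassP w ↔
      z + w ∈ (torus τ).lattice ∨ z - w ∈ (torus τ).lattice := by
  rw [← sub_eq_zero, wp_sub τ hz hw]
  rw [← theta_eq_zero_iff] at hw hz
  simp [deriv_theta_zero_ne_zero, hw, hz, theta_eq_zero_iff]

end

/-! ### Local behaviour of `℘` at lattice points, surjectivity -/

theorem hasRemovableAt_wp_sub (L : PeriodPair) {l : ℂ} (hl : l ∈ L.lattice) :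
    HasRemovableAt (fun z => L.weierstrassP z - 1 / (z - l) ^ 2) l := by
  refine ⟨fun z => L.weierstrassPExcept l z - 1 / l ^ 2,
    (L.analyticAt_weierstrassPExcept l).sub analyticAt_const, Eventually.of_forall fun z => ?_⟩
  have := L.weierstrassPExcept_add ⟨l, hl⟩ z
  simp only at this ⊢
  rw [← this]
  ring

theorem tendsto_wp_sub (L : PeriodPair) :
    Tendsto (fun z => L.weierstrassP z - 1 / z ^ 2) (𝓝[≠] 0) (𝓝 0) := by
  have h0 : L.weierstrassPExcept 0 0 = 0 := by
    rw [PeriodPair.weierstrassPExcept]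
    simp
  have h1 := (L.analyticAt_weierstrassPExcept 0).continuousAt.tendsto.mono_left
    (nhdsWithin_le_nhds (s := {0}ᶜ))
  rw [h0] at h1
  refine h1.congr fun z => ?_
  have := L.weierstrassPExcept_add 0 z
  simp at this
  rw [← this]
  simp

/-- If `x` were omitted, `1 / (℘ - x)` would be elliptic with removable singularities only, hence
constant, and `℘` would have no pole. -/
theorem wp_surjective (L : PeriodPair) (x : ℂ) : ∃ z ∉ L.lattice, L.weierstrassP z = x := by
  by_contra! h
  have hcont : ∀ z ∉ L.lattice, AnalyticAt ℂ (fun z => (L.weierstrassP z - x)⁻¹) z := fun z hz =>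
    ((analyticAt_wp hz).sub analyticAt_const).inv (sub_ne_zero.2 (h z hz))
  obtain ⟨c, hc⟩ := elliptic_liouville L (f := fun z => (L.weierstrassP z - x)⁻¹) (by
    intro l
    by_cases hl : l ∈ L.lattice
    · refine ⟨fun z => (z - l) ^ 2 * ((z - l) ^ 2 * L.weierstrassPExcept l z + 1
        - (z - l) ^ 2 * (l ^ 2)⁻¹ - (z - l) ^ 2 * x)⁻¹, ?_, ?_⟩
      · have h1 := L.analyticAt_weierstrassPExcept l
        refine AnalyticAt.mul (by fun_prop) (AnalyticAt.inv (by fun_prop) (by simp))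
      · filter_upwards [self_mem_nhdsWithin] with z hz
        have := L.ite_eq_one_sub_sq_mul_weierstrassP l hl z
        rw [if_neg (show ¬ z = l from hz), div_eq_mul_inv] at this
        rw [← this, ← mul_sub, mul_inv, mul_inv_cancel_left₀]
        exact pow_ne_zero _ (sub_ne_zero.2 hz)
    · exact .of_analyticAt (hcont l hl)) (fun z l hl => by simp only [wp_add z hl])
  have h2 : ∀ z ∉ L.lattice, L.weierstrassP z = x + c⁻¹ := by
    intro z hz
    rw [← hc z (hcont z hz).continuousAt, inv_inv]; ring
  have h3 : Tendsto (fun z : ℂ => z ^ 2 * (x + c⁻¹)) (𝓝[≠] 0) (𝓝 0) := by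
    have : ContinuousAt (fun z : ℂ => z ^ 2 * (x + c⁻¹)) 0 := by fun_prop
    simpa using this.tendsto.mono_left (nhdsWithin_le_nhds (s := {0}ᶜ))
  have h4 := tendsto_nhds_unique (tendsto_sq_mul_wp L) (h3.congr' (by
    filter_upwards [eventually_notMem L 0] with z hz
    rw [h2 z hz]))
  exact one_ne_zero h4

/-! ### Half periods -/

/-- The coefficient of `1` in `2ω_ρ`. -/
def mω : Fin 4 → ℤ := ![0, 1, 0, 1]

/-- The coefficient of `τ` in `2ω_ρ`. -/
def nω : Fin 4 → ℤ := ![0, 0, 1, 1]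

section
variable (τ : UpperHalfPlane)

theorem two_mul_ω (ρ : Fin 4) : 2 * ω τ ρ = mω ρ + nω ρ * τ := by
  fin_cases ρ <;> simp [ω, mω, nω] <;> ring

theorem dω_eq (ρ : Fin 4) : dω ρ = nω ρ / 2 := by
  fin_cases ρ <;> simp [dω, nω]

theorem int_comb_injective {m n m' n' : ℤ} (h : (m : ℂ) + n * τ = m' + n' * τ) :
    m = m' ∧ n = n' := by
  have him := congrArg Complex.im h
  have hre := congrArg Complex.re h
  simp [τ.im_ne_zero] at him
  simp [him] at hre
  exact ⟨hre, him⟩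

theorem int_comb_mem_doubled {m n : ℤ} :
    (m : ℂ) + n * τ ∈ (doubledTorus τ).lattice ↔ 2 ∣ m ∧ 2 ∣ n := by
  rw [mem_doubledTorus, mem_torus]
  constructor
  · rintro ⟨a, b, h⟩
    have : ((2 * a : ℤ) : ℂ) + (2 * b : ℤ) * τ = m + n * τ := by
      push_cast
      linear_combination 2 * h
    obtain ⟨h1, h2⟩ := int_comb_injective τ this
    exact ⟨⟨a, h1.symm⟩, ⟨b, h2.symm⟩⟩
  · rintro ⟨⟨a, rfl⟩, ⟨b, rfl⟩⟩
    exact ⟨a, b, by push_cast; ring⟩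

theorem two_ω_mem (ρ : Fin 4) : 2 * ω τ ρ ∈ (torus τ).lattice :=
  mem_torus.2 ⟨mω ρ, nω ρ, (two_mul_ω τ ρ).symm⟩

theorem four_ω_mem (ρ : Fin 4) : 4 * ω τ ρ ∈ (doubledTorus τ).lattice := by
  rw [mem_doubledTorus]
  convert two_ω_mem τ ρ using 1
  ring

theorem two_ω_sub_mem {ρ α : Fin 4} :
    2 * ω τ ρ - 2 * ω τ α ∈ (doubledTorus τ).lattice ↔ ρ = α := by
  have : 2 * ω τ ρ - 2 * ω τ α = ((mω ρ - mω α : ℤ) : ℂ) + ((nω ρ - nω α : ℤ) : ℂ) * τ := by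
    rw [two_mul_ω, two_mul_ω]; push_cast; ring
  rw [this, int_comb_mem_doubled]
  clear this
  revert ρ α
  decide

theorem two_ω_add_mem {ρ α : Fin 4} :
    2 * ω τ ρ + 2 * ω τ α ∈ (doubledTorus τ).lattice ↔ ρ = α := by
  rw [← two_ω_sub_mem τ, ← add_mem_cancel_right (neg_mem (four_ω_mem τ α))]
  ring_nf

theorem exists_two_ω {l : ℂ} (hl : l ∈ (torus τ).lattice) :
    ∃ ρ, l - 2 * ω τ ρ ∈ (doubledTorus τ).lattice := by
  obtain ⟨m, n, rfl⟩ := mem_torus.1 hl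
  have : ∃ ρ, 2 ∣ m - mω ρ ∧ 2 ∣ n - nω ρ := by
    rcases Int.even_or_odd' m with ⟨a, rfl | rfl⟩ <;> rcases Int.even_or_odd' n with ⟨b, rfl | rfl⟩
    · exact ⟨0, by simp [mω], by simp [nω]⟩
    · exact ⟨2, by simp [mω], by simp [nω]⟩
    · exact ⟨1, by simp [mω], by simp [nω]⟩
    · exact ⟨3, by simp [mω], by simp [nω]⟩
  obtain ⟨ρ, hρ⟩ := this
  refine ⟨ρ, ?_⟩
  rw [two_mul_ω, ← int_comb_mem_doubled τ] at *
  convert hρ using 1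
  push_cast; ring

theorem two_ω_zero : 2 * ω τ 0 = 0 := by simp [ω]

theorem two_ω_notMem {ρ : Fin 4} (h : ρ ≠ 0) : 2 * ω τ ρ ∉ (doubledTorus τ).lattice := by
  have := (two_ω_sub_mem τ (ρ := ρ) (α := 0)).not.2 h
  rwa [two_ω_zero, sub_zero] at this

theorem ω_add_notMem {u : ℂ} (hu : 2 * u ∉ (torus τ).lattice) (α : Fin 4) :
    ω τ α + u ∉ (torus τ).lattice := by
  intro h
  have h1 := sub_mem (add_mem h h) (two_ω_mem τ α)
  exact hu (by convert h1 using 1; ring)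

/-! ### The function `℘(z, 2τ)` -/

/-- Homogeneity of degree `-2`. It reduces statements on `2Λ` to the theta function of `Λ` at `z /
2`. -/
theorem wp_doubled (z : ℂ) :
    (doubledTorus τ).weierstrassP z = (torus τ).weierstrassP (z / 2) / 4 := by
  let φ : (torus τ).lattice ≃ (doubledTorus τ).lattice :=
    { toFun := fun l => ⟨2 * l.1, by rw [mem_doubledTorus]; simp [l.2]⟩
      invFun := fun l => ⟨l.1 / 2, mem_doubledTorus.1 l.2⟩
      left_inv := fun l => by simp
      right_inv := fun l => by ext; simp [mul_div_cancel₀] }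
  rw [PeriodPair.weierstrassP, PeriodPair.weierstrassP, ← φ.tsum_eq, ← tsum_div_const]
  congr 1
  ext l
  simp only [φ, Equiv.coe_fn_mk]
  rw [show z - 2 * (l : ℂ) = 2 * (z / 2 - l) by ring, mul_pow, mul_pow, one_div, one_div, mul_inv,
    mul_inv]
  norm_num
  ring

theorem wp_doubled_eq_iff {z w : ℂ} (hz : z ∉ (doubledTorus τ).lattice)
    (hw : w ∉ (doubledTorus τ).lattice) :
    (doubledTorus τ).weierstrassP z = (doubledTorus τ).weierstrassP w ↔
      z + w ∈ (doubledTorus τ).lattice ∨ z - w ∈ (doubledTorus τ).lattice := by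
  rw [mem_doubledTorus] at *
  rw [wp_doubled, wp_doubled, div_left_inj' (by norm_num : (4 : ℂ) ≠ 0), wp_eq_iff τ hz hw, mem_doubledTorus,
    add_div, sub_div]

/-- The value `℘(2ω_ρ, 2τ)`. -/
noncomputable def halfValue (ρ : Fin 4) : ℂ := (doubledTorus τ).weierstrassP (2 * ω τ ρ)

theorem halfValue_injective {ρ α : Fin 4} (hρ : ρ ≠ 0) (hα : α ≠ 0)
    (h : halfValue τ ρ = halfValue τ α) : ρ = α := by
  rw [halfValue, halfValue, wp_doubled_eq_iff τ (two_ω_notMem τ hρ) (two_ω_notMem τ hα)] at h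
  exact h.elim (two_ω_add_mem τ).1 (two_ω_sub_mem τ).1

theorem wp_doubled_eq_halfValue {z : ℂ} (hz : z ∉ (doubledTorus τ).lattice) {ρ : Fin 4}
    (hρ : ρ ≠ 0) :
    (doubledTorus τ).weierstrassP z = halfValue τ ρ ↔ z - 2 * ω τ ρ ∈ (doubledTorus τ).lattice := by
  rw [halfValue, wp_doubled_eq_iff τ hz (two_ω_notMem τ hρ)]
  refine ⟨fun h => h.elim (fun h => ?_) id, Or.inr⟩
  have := sub_mem h (four_ω_mem τ ρ)
  convert this using 1
  ring

theorem mem_torus_iff_halfValue {z : ℂ} (hz : z ∉ (doubledTorus τ).lattice) :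
    z ∈ (torus τ).lattice ↔ ∃ ρ, ρ ≠ 0 ∧ (doubledTorus τ).weierstrassP z = halfValue τ ρ := by
  constructor
  · intro h
    obtain ⟨ρ, hρ⟩ := exists_two_ω τ h
    have : ρ ≠ 0 := by
      rintro rfl
      rw [two_ω_zero, sub_zero] at hρ
      exact hz hρ
    exact ⟨ρ, this, (wp_doubled_eq_halfValue τ hz this).2 hρ⟩
  · rintro ⟨ρ, hρ, h⟩
    rw [wp_doubled_eq_halfValue τ hz hρ] at h
    have := add_mem (doubledTorus_le τ h) (two_ω_mem τ ρ)
    rwa [sub_add_cancel] at this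

theorem wp_doubled_ne_halfValue {z : ℂ} (hz : z ∉ (torus τ).lattice) {ρ : Fin 4} (hρ : ρ ≠ 0) :
    (doubledTorus τ).weierstrassP z ≠ halfValue τ ρ := fun h =>
  hz ((mem_torus_iff_halfValue τ fun h => hz (doubledTorus_le τ h)).2 ⟨ρ, hρ, h⟩)

theorem derivWp_halfPeriod (ρ : Fin 4) : (doubledTorus τ).derivWeierstrassP (2 * ω τ ρ) = 0 := by
  have h1 := (doubledTorus τ).derivWeierstrassP_neg (2 * ω τ ρ)
  have h2 := (doubledTorus τ).derivWeierstrassP_add_coe (-(2 * ω τ ρ)) ⟨_, four_ω_mem τ ρ⟩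
  simp only at h2
  rw [show -(2 * ω τ ρ) + 4 * ω τ ρ = 2 * ω τ ρ by ring, h1] at h2
  exact self_eq_neg.mp h2

theorem halfValue_cubic {ρ : Fin 4} (hρ : ρ ≠ 0) :
    4 * halfValue τ ρ ^ 3 - (doubledTorus τ).g₂ * halfValue τ ρ - (doubledTorus τ).g₃ = 0 := by
  have := (doubledTorus τ).derivWeierstrassP_sq _ (two_ω_notMem τ hρ)
  rw [derivWp_halfPeriod] at this
  rw [halfValue, ← this]
  ring

theorem halfValue_12 : halfValue τ 1 - halfValue τ 2 ≠ 0 := sub_ne_zero.2 fun h => by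
  have := halfValue_injective τ (by decide) (by decide) h
  revert this; decide

theorem halfValue_13 : halfValue τ 1 - halfValue τ 3 ≠ 0 := sub_ne_zero.2 fun h => by
  have := halfValue_injective τ (by decide) (by decide) h
  revert this; decide

theorem halfValue_23 : halfValue τ 2 - halfValue τ 3 ≠ 0 := sub_ne_zero.2 fun h => by
  have := halfValue_injective τ (by decide) (by decide) h
  revert this; decide

/-- The difference of the cubic equations of two distinct roots, divided by the difference of the
roots. Two such expressions for `g₂` give the vanishing of the sum of the roots. -/
theorem g₂_eq {a b : Fin 4} (ha : a ≠ 0) (hb : b ≠ 0) (h : halfValue τ a - halfValue τ b ≠ 0) :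
    (doubledTorus τ).g₂ =
      4 * (halfValue τ a ^ 2 + halfValue τ a * halfValue τ b + halfValue τ b ^ 2) := by
  have h1 := halfValue_cubic τ ha
  have h2 := halfValue_cubic τ hb
  apply mul_left_cancel₀ h
  linear_combination h2 - h1

theorem halfValue_sum : halfValue τ 1 + halfValue τ 2 + halfValue τ 3 = 0 := by
  have h1 := g₂_eq τ (by decide) (by decide) (halfValue_12 τ)
  have h2 := g₂_eq τ (by decide) (by decide) (halfValue_13 τ)
  apply mul_left_cancel₀ (halfValue_23 τ)
  linear_combination (h2 - h1) / 4

theorem derivWp_sq {z : ℂ} (hz : z ∉ (doubledTorus τ).lattice) :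
    (doubledTorus τ).derivWeierstrassP z ^ 2 =
      4 * (((doubledTorus τ).weierstrassP z - halfValue τ 1) *
        ((doubledTorus τ).weierstrassP z - halfValue τ 2) *
        ((doubledTorus τ).weierstrassP z - halfValue τ 3)) := by
  rw [(doubledTorus τ).derivWeierstrassP_sq z hz]
  set X := (doubledTorus τ).weierstrassP z
  have h1 := g₂_eq τ (by decide) (by decide) (halfValue_12 τ)
  have h2 := halfValue_cubic τ (ρ := 1) (by decide)
  have h3 := halfValue_sum τ
  have h4 : halfValue τ 3 = -halfValue τ 1 - halfValue τ 2 := by linear_combination h3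
  rw [h4]
  linear_combination h2 - (X - halfValue τ 1) * h1

theorem derivWp_ne_zero {z : ℂ} (hz : z ∉ (torus τ).lattice) :
    (doubledTorus τ).derivWeierstrassP z ≠ 0 := by
  intro h
  have h1 := derivWp_sq τ (fun h => hz (doubledTorus_le τ h))
  rw [h] at h1
  have h2 := fun ρ (hρ : ρ ≠ 0) => sub_ne_zero.2 (wp_doubled_ne_halfValue τ hz (ρ := ρ) hρ)
  simp [h2] at h1

/-- With `y = z/2` and `w = ω_ρ` the product formula turns the left side into a constant times `ϑ(y
+ w) ϑ(y - 2w) / (ϑ(y) ϑ(y - w))`. As `2w` is a period of `Λ`, quasi-periodicity reduces this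
quotient to `e(-n_ρ w)`. The `16` comes from `℘(z, 2τ) = ℘(z/2) / 4`, used twice. -/
theorem exists_shift_mul (ρ : Fin 4) (hρ : ρ ≠ 0) :
    ∃ C, ∀ z ∉ (doubledTorus τ).lattice, z - 2 * ω τ ρ ∉ (doubledTorus τ).lattice →
      ((doubledTorus τ).weierstrassP (z - 2 * ω τ ρ) - halfValue τ ρ) *
        ((doubledTorus τ).weierstrassP z - halfValue τ ρ) = C := by
  obtain ⟨c, hc, hθ⟩ := theta_add_period τ (mω ρ) (nω ρ)
  rw [← two_mul_ω] at hθ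
  set w := ω τ ρ
  have hw : w ∉ (torus τ).lattice := by
    have := two_ω_notMem τ hρ
    rwa [mem_doubledTorus, mul_div_cancel_left₀ _ two_ne_zero] at this
  refine ⟨deriv (theta τ) 0 ^ 4 / (16 * theta τ w ^ 4) * e (-nω ρ * w), ?_⟩
  intro z hz hz'
  rw [mem_doubledTorus] at hz hz'
  rw [halfValue, wp_doubled, wp_doubled, wp_doubled, mul_div_cancel_left₀ _ two_ne_zero,
    ← sub_div, ← sub_div]
  rw [show (z - 2 * w) / 2 = z / 2 - w by ring] at hz' ⊢
  set y := z / 2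
  rw [wp_sub τ hz hw, wp_sub τ hz' hw]
  have h1 := hθ (y - w)
  have h2 := hθ (y - 2 * w)
  rw [show y - w + 2 * w = y + w by ring, show -(nω ρ : ℂ) * (y - w) =
    -nω ρ * (y - 2 * w) + -nω ρ * w by ring, e_add] at h1
  rw [show y - 2 * w + 2 * w = y by ring] at h2
  rw [← theta_eq_zero_iff] at hz hz' hw
  rw [show y - w + w = y by ring, show y - w - w = y - 2 * w by ring, h1]
  have h3 : theta τ (y - 2 * w) ≠ 0 := by
    intro h; rw [h, mul_zero] at h2; exact hz h2
  rw [h2]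
  have h4 := e_ne_zero (-(nω ρ : ℂ) * (y - 2 * w))
  generalize e (-(nω ρ : ℂ) * (y - 2 * w)) = A at *
  generalize e (-(nω ρ : ℂ) * w) = B at *
  field_simp
  ring

/-- The constant of `exists_shift_mul` is evaluated at `z = 2ω_j`: the shifted point is then
congruent to `-2ω_k`, so the constant is `(e_k - e_i)(e_j - e_i)`. -/
theorem shift_mul {i j k : Fin 4} (hi : i ≠ 0) (hj : j ≠ 0) (hij : i ≠ j)
    (hk : 2 * ω τ j - 2 * ω τ i + 2 * ω τ k ∈ (doubledTorus τ).lattice) {z : ℂ}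
    (hz : z ∉ (torus τ).lattice) :
    (doubledTorus τ).weierstrassP (z - 2 * ω τ i) = halfValue τ i +
      (halfValue τ i - halfValue τ j) * (halfValue τ i - halfValue τ k) /
        ((doubledTorus τ).weierstrassP z - halfValue τ i) := by
  obtain ⟨C, hC⟩ := exists_shift_mul τ i hi
  have h1 := hC (2 * ω τ j) (two_ω_notMem τ hj) (fun h => hij ((two_ω_sub_mem τ).1 h).symm)
  have h2 : (doubledTorus τ).weierstrassP (2 * ω τ j - 2 * ω τ i) = halfValue τ k := by
    rw [halfValue, ← PeriodPair.weierstrassP_neg _ (2 * ω τ k), ← wp_add (-(2 * ω τ k)) hk]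
    congr 1
    ring
  rw [h2] at h1
  have hz2 : z - 2 * ω τ i ∉ (torus τ).lattice := fun h =>
    hz (by simpa using add_mem h (two_ω_mem τ i))
  have h3 := hC z (fun h => hz (doubledTorus_le τ h)) (fun h => hz2 (doubledTorus_le τ h))
  have h4 := sub_ne_zero.2 (wp_doubled_ne_halfValue τ hz hi)
  rw [← h1] at h3
  change _ * _ = _ * (halfValue τ j - halfValue τ i) at h3
  field_simp
  linear_combination h3

theorem wp_shift_one {z : ℂ} (hz : z ∉ (torus τ).lattice) :
    (doubledTorus τ).weierstrassP (z - 2 * ω τ 1) = halfValue τ 1 +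
      (halfValue τ 1 - halfValue τ 2) * (halfValue τ 1 - halfValue τ 3) /
        ((doubledTorus τ).weierstrassP z - halfValue τ 1) := by
  refine shift_mul τ (by decide) (by decide) (by decide) ?_ hz
  convert (four_ω_mem τ 2) using 1
  simp [ω]; ring

theorem wp_shift_two {z : ℂ} (hz : z ∉ (torus τ).lattice) :
    (doubledTorus τ).weierstrassP (z - 2 * ω τ 2) = halfValue τ 2 +
      (halfValue τ 2 - halfValue τ 1) * (halfValue τ 2 - halfValue τ 3) /
        ((doubledTorus τ).weierstrassP z - halfValue τ 2) := by
  refine shift_mul τ (by decide) (by decide) (by decide) ?_ hz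
  convert (four_ω_mem τ 1) using 1
  simp [ω]; ring

theorem wp_shift_three {z : ℂ} (hz : z ∉ (torus τ).lattice) :
    (doubledTorus τ).weierstrassP (z - 2 * ω τ 3) = halfValue τ 3 +
      (halfValue τ 3 - halfValue τ 1) * (halfValue τ 3 - halfValue τ 2) /
        ((doubledTorus τ).weierstrassP z - halfValue τ 3) := by
  refine shift_mul τ (by decide) (by decide) (by decide) ?_ hz
  convert zero_mem (doubledTorus τ).lattice using 1
  simp [ω]; ring

theorem sub_two_ω_mem_torus {z : ℂ} (ρ : Fin 4) :
    z - 2 * ω τ ρ ∈ (torus τ).lattice ↔ z ∈ (torus τ).lattice :=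
  (sub_eq_add_neg z _) ▸ add_mem_cancel_right (neg_mem (two_ω_mem τ ρ))

/-- A combination of the functions `℘(z - 2ω_ρ, 2τ)` differs at the point `z₀ ≡ 2ω_ρ` from the
principal part of its `ρ`-th term by a function with a removable singularity. -/
theorem hasRemovableAt_sum_wp (K : Fin 4 → ℂ) {l : ℂ} {ρ : Fin 4}
    (hl : l - 2 * ω τ ρ ∈ (doubledTorus τ).lattice) :
    HasRemovableAt (fun z => ∑ α, K α * (doubledTorus τ).weierstrassP (z - 2 * ω τ α) -
      K ρ / (z - l) ^ 2) l := by
  have h1 : HasRemovableAt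
      (fun z => K ρ * ((doubledTorus τ).weierstrassP (z - 2 * ω τ ρ) - 1 / (z - l) ^ 2)) l := by
    refine (HasRemovableAt.of_analyticAt analyticAt_const).mul ?_
    have := (hasRemovableAt_wp_sub (doubledTorus τ) hl)
    rw [sub_eq_add_neg] at this
    have := this.comp_add
    refine this.congr (Eventually.of_forall fun z => ?_)
    simp only
    ring_nf
  have h2 : HasRemovableAt (fun z => ∑ α ∈ Finset.univ.erase ρ,
      K α * (doubledTorus τ).weierstrassP (z - 2 * ω τ α)) l := by
    refine .of_analyticAt (Finset.analyticAt_fun_sum _ fun α hα => ?_)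
    refine analyticAt_const.mul (AnalyticAt.fun_comp (f := fun z => z - 2 * ω τ α)
      (g := (doubledTorus τ).weierstrassP) (analyticAt_wp fun h => ?_) (by fun_prop))
    refine (Finset.mem_erase.1 hα).1 ((two_ω_sub_mem τ).1 ?_)
    convert sub_mem hl h using 1
    ring
  refine (h1.add h2).congr (Eventually.of_forall fun z => ?_)
  simp only
  rw [← Finset.add_sum_erase _ _ (Finset.mem_univ ρ)]
  ring

theorem wp_doubled_neg_half (ρ : Fin 4) :
    (doubledTorus τ).weierstrassP (-(2 * ω τ ρ)) = halfValue τ ρ :=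
  PeriodPair.weierstrassP_neg _ _

/-- The principal parts agree, so the difference is constant; its limit at `0` is `e₁ + e₂ + e₃ =
0`. -/
theorem sum_wp_doubled {z : ℂ} (hz : z ∉ (torus τ).lattice) :
    ∑ ρ, (doubledTorus τ).weierstrassP (z - 2 * ω τ ρ) = (torus τ).weierstrassP z := by
  set f : ℂ → ℂ := fun z => ∑ ρ, (doubledTorus τ).weierstrassP (z - 2 * ω τ ρ) -
    (torus τ).weierstrassP z
  have hfa : ∀ z ∉ (torus τ).lattice, AnalyticAt ℂ f z := by
    intro z hz
    refine AnalyticAt.sub (Finset.analyticAt_fun_sum _ fun α _ => ?_) (analyticAt_wp hz)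
    refine AnalyticAt.fun_comp (f := fun z => z - 2 * ω τ α)
      (g := (doubledTorus τ).weierstrassP) (analyticAt_wp fun h => ?_) (by fun_prop)
    exact hz ((sub_two_ω_mem_torus τ α).1 (doubledTorus_le τ h))
  obtain ⟨c, hc⟩ := elliptic_liouville (doubledTorus τ) (f := f) (by
    intro l
    by_cases hl : l ∈ (torus τ).lattice
    · obtain ⟨ρ, hρ⟩ := exists_two_ω τ hl
      refine ((hasRemovableAt_sum_wp τ (fun _ => 1) hρ).sub
        (hasRemovableAt_wp_sub (torus τ) hl)).congr (Eventually.of_forall fun z => ?_)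
      simp only [f, one_mul]
      ring
    · exact .of_analyticAt (hfa l hl)) (by
    intro z l hl
    simp only [f]
    rw [wp_add z (doubledTorus_le τ hl)]
    congr 1
    refine Finset.sum_congr rfl fun ρ _ => ?_
    rw [← wp_add (z - 2 * ω τ ρ) hl]
    congr 1
    ring)
  have hlim : Tendsto f (𝓝[≠] 0) (𝓝 0) := by
    have h1 := tendsto_wp_sub (torus τ)
    have h2 := tendsto_wp_sub (doubledTorus τ)
    have h3 : ∀ ρ : Fin 4, ρ ≠ 0 → Tendsto (fun z => (doubledTorus τ).weierstrassP (z - 2 * ω τ ρ))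
        (𝓝[≠] 0) (𝓝 (halfValue τ ρ)) := by
      intro ρ hρ
      have : ContinuousAt (fun z => (doubledTorus τ).weierstrassP (z - 2 * ω τ ρ)) 0 := by
        refine ContinuousAt.comp (f := fun z => z - 2 * ω τ ρ) (g := (doubledTorus τ).weierstrassP)
          (analyticAt_wp ?_).continuousAt (by fun_prop)
        rw [zero_sub, neg_mem_iff]
        exact two_ω_notMem τ hρ
      have := this.tendsto.mono_left (nhdsWithin_le_nhds (s := {0}ᶜ))
      rwa [zero_sub, wp_doubled_neg_half] at this
    have h4 := ((h2.add ((h3 1 (by decide)).add ((h3 2 (by decide)).add (h3 3 (by decide))))).sub h1)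
    rw [zero_add, sub_zero, ← add_assoc, halfValue_sum] at h4
    refine h4.congr fun z => ?_
    simp only [f, Fin.sum_univ_four, two_ω_zero, sub_zero]
    ring
  have hc0 : c = 0 := by
    refine tendsto_nhds_unique (tendsto_const_nhds.congr' ?_) hlim
    filter_upwards [eventually_notMem (torus τ) 0] with z hz
    exact (hc z (hfa z hz).continuousAt).symm
  have := hc z (hfa z hz).continuousAt
  rw [hc0] at this
  exact sub_eq_zero.1 this

end

section
variable (τ : UpperHalfPlane)

/-! ### The signs `I_{ρα}` -/

/-- The character `α ↦ e((m n_α - n m_α)/2)` attached to the period `m + nτ`. -/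
noncomputable def periodSign (m n : ℤ) (α : Fin 4) : ℂ :=
  e (((m * nω α - n * mω α : ℤ) : ℂ) / 2)

theorem e_half_int (k : ℤ) : e ((k : ℂ) / 2) = (-1) ^ k := by
  rw [e, ← Complex.exp_pi_mul_I, ← Complex.exp_int_mul]
  congr 1
  ring

theorem periodSign_eq (m n : ℤ) (α : Fin 4) :
    periodSign m n α = (-1) ^ (m * nω α - n * mω α) := e_half_int _

theorem signMatrix_eq_periodSign (ρ α : Fin 4) :
    signMatrix τ ρ α = periodSign (mω ρ) (nω ρ) α := by
  rw [signMatrix, periodSign, two_mul_ω, two_mul_ω, dω_eq, dω_eq]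
  congr 1
  push_cast
  ring

theorem signMatrix_eq (ρ α : Fin 4) :
    signMatrix τ ρ α = ![![1, 1, 1, 1], ![1, 1, -1, -1], ![1, -1, 1, -1], ![1, -1, -1, 1]] ρ α := by
  rw [signMatrix_eq_periodSign, periodSign_eq]
  fin_cases ρ <;> fin_cases α <;> simp [mω, nω]

theorem periodSign_eq_of_mem {m n : ℤ} {ρ : Fin 4}
    (h : (m : ℂ) + n * τ - 2 * ω τ ρ ∈ (doubledTorus τ).lattice) (α : Fin 4) :
    periodSign m n α = signMatrix τ ρ α := by
  have : (m : ℂ) + n * τ - 2 * ω τ ρ = ((m - mω ρ : ℤ) : ℂ) + ((n - nω ρ : ℤ) : ℂ) * τ := by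
    rw [two_mul_ω]; push_cast; ring
  rw [this, int_comb_mem_doubled] at h
  obtain ⟨⟨a, ha⟩, ⟨b, hb⟩⟩ := h
  rw [signMatrix_eq_periodSign, periodSign, periodSign, show m = mω ρ + 2 * a by lia,
    show n = nω ρ + 2 * b by lia, show ((((mω ρ + 2 * a) * nω α - (nω ρ + 2 * b) * mω α : ℤ) : ℂ) / 2) =
      ((mω ρ * nω α - nω ρ * mω α : ℤ) : ℂ) / 2 + ((a * nω α - b * mω α : ℤ) : ℂ) by push_cast; ring,
    e_add, e_int, mul_one]

/-- The signs form the symmetric character table of `(ℤ/2)²`, whose square is `4`. -/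
theorem signMatrix_inversion (x : Fin 4 → ℂ) (ρ : Fin 4) :
    ∑ α, signMatrix τ ρ α * (1 / 4 * ∑ β, signMatrix τ α β * x β) = x ρ := by
  simp only [Fin.sum_univ_four, signMatrix_eq]
  fin_cases ρ <;> simp <;> ring

theorem signMatrix_inversion' (x : Fin 4 → ℂ) (ρ : Fin 4) :
    1 / 4 * ∑ α, signMatrix τ ρ α * (∑ β, signMatrix τ α β * x β) = x ρ := by
  rw [← signMatrix_inversion τ x ρ, Finset.mul_sum]
  exact Finset.sum_congr rfl fun α _ => by ring

theorem eq_zero_of_signMatrix {x : Fin 4 → ℂ} (h : ∀ ρ, ∑ α, signMatrix τ ρ α * x α = 0) : x = 0 := by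
  ext ρ
  rw [← signMatrix_inversion' τ x ρ]
  simp [h]

/-- For fixed `ρ` the sign is a character of the group of half periods, `I_{μ(α,β),ρ} = I_{αρ}
I_{βρ}`, so the double sum factors. In this form `K_ρ` appears as the coefficient of a double pole.
-/
theorem K_eq_sq (ν : Fin 4 → ℂ) (ρ : Fin 4) : K τ ν ρ = (∑ α, signMatrix τ ρ α * ν α) ^ 2 := by
  simp only [K, Fin.sum_univ_four, signMatrix_eq]
  fin_cases ρ <;> simp [halfSum] <;> ring

theorem K_sum (ν : Fin 4 → ℂ) : ∑ ρ, K τ ν ρ = 4 * ∑ α, ν α ^ 2 := by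
  simp only [K_eq_sq, Fin.sum_univ_four, signMatrix_eq]
  simp
  ring

/-! ### The functions `φ` and `φ_α` -/

theorem phi_comm (z u : ℂ) : phi τ z u = phi τ u z := by
  rw [phi, phi, add_comm u z, mul_comm (theta τ u)]

theorem phi_neg (z u : ℂ) : phi τ (-z) (-u) = -phi τ z u := by
  rw [phi, phi, ← neg_add, theta_neg, theta_neg, theta_neg, neg_mul_neg, neg_mul, neg_div]

theorem phi_add_period (m n : ℤ) (z w : ℂ) :
    phi τ (z + (m + n * τ)) w = e (-n * w) * phi τ z w := by
  obtain ⟨c, hc, h⟩ := theta_add_period τ m n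
  rw [phi, phi, ← add_assoc, h, h, show -(n : ℂ) * (w + z) = -n * w + -n * z by ring, e_add]
  have := e_ne_zero (-(n : ℂ) * z)
  rw [show c * (e (-n * w) * e (-n * z)) * theta τ (w + z) * deriv (theta τ) 0 =
    (c * e (-n * z)) * (e (-n * w) * (theta τ (w + z) * deriv (theta τ) 0)) by ring,
    show theta τ w * (c * e (-n * z) * theta τ z) = (c * e (-n * z)) * (theta τ w * theta τ z) by ring,
    mul_div_mul_left _ _ (mul_ne_zero hc this), mul_div_assoc]

/-- Up to sign, `ω_α - u` is `u - ω_α`, which differs from `u + ω_α` by the period `2ω_α`. The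
multiplier `e(-n_α z)` of this period inverts the prefactor `e(z ∂_τω_α)`. -/
theorem phiα_neg (α : Fin 4) (z u : ℂ) :
    phiα τ α (-z) (ω τ α - u) = -phiα τ α z (ω τ α + u) := by
  have h := phi_add_period τ (mω α) (nω α) (u - ω τ α) z
  rw [← two_mul_ω, show u - ω τ α + 2 * ω τ α = ω τ α + u by ring, phi_comm] at h
  rw [phiα, phiα, h, show ω τ α - u = -(u - ω τ α) by ring, phi_neg, phi_comm, dω_eq,
    show -z * ((nω α : ℂ) / 2) = z * (nω α / 2) + -nω α * z by ring, e_add]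
  ring

/-- The prefactor of `φ_α` is chosen so that `ω_α` drops out of the multiplier up to a sign: all
four functions share the factor `e(-nu)`. -/
theorem phiα_add_period (α : Fin 4) (m n : ℤ) (z u : ℂ) :
    phiα τ α (z + (m + n * τ)) (ω τ α + u) =
      periodSign m n α * e (-n * u) * phiα τ α z (ω τ α + u) := by
  rw [phiα, phiα, phi_add_period, periodSign, ← mul_assoc, ← mul_assoc, ← e_add, ← e_add, ← e_add]
  congr 2
  have := two_mul_ω τ α
  rw [dω_eq]
  push_cast
  linear_combination (-(n : ℂ) / 2) * this

/-- By `phiα_neg` the second factor is `-φ_α(-z, ω_α + u)`; the exponentials cancel and the theta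
quotient is that of `wp_sub`. -/
theorem phiα_mul (α : Fin 4) {z u : ℂ} (hz : z ∉ (torus τ).lattice)
    (hu : 2 * u ∉ (torus τ).lattice) :
    phiα τ α z (ω τ α + u) * phiα τ α z (ω τ α - u) =
      (torus τ).weierstrassP z - (torus τ).weierstrassP (u + ω τ α) := by
  have h := phiα_neg τ α (-z) u
  rw [neg_neg] at h
  have hw := ω_add_notMem τ hu α
  rw [h, add_comm u, wp_sub τ hz hw, phiα, phiα, neg_mul, e_neg, phi, phi, theta_neg,
    show ω τ α + u + -z = -(z - (ω τ α + u)) by ring, theta_neg, add_comm _ z]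
  have := e_ne_zero (z * dω α)
  rw [← theta_eq_zero_iff] at hz hw
  field_simp

/-! ### The off-diagonal part of the Lax matrix -/

/-- The upper right entry of the Lax matrix. The lower left one arises from it by `u ↦ -u`. -/
noncomputable def offDiag (ν : Fin 4 → ℂ) (u z : ℂ) : ℂ := ∑ α, ν α * phiα τ α z (ω τ α + u)

theorem laxL_eq (ν : Fin 4 → ℂ) (v u z : ℂ) :
    laxL τ ν v u z = !![v, offDiag τ ν u z; offDiag τ ν (-u) z, -v] := by
  simp only [laxL, offDiag, sub_eq_add_neg]

theorem offDiag_neg_neg (ν : Fin 4 → ℂ) (u z : ℂ) :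
    offDiag τ ν (-u) (-z) = -offDiag τ ν u z := by
  simp only [offDiag, ← sub_eq_add_neg, phiα_neg, mul_neg, Finset.sum_neg_distrib]

theorem offDiag_add_period (ν : Fin 4 → ℂ) (m n : ℤ) (u z : ℂ) :
    offDiag τ ν u (z + (m + n * τ)) =
      e (-n * u) * offDiag τ (fun α => periodSign m n α * ν α) u z := by
  simp only [offDiag, phiα_add_period, Finset.mul_sum]
  exact Finset.sum_congr rfl fun α _ => by ring

/-- The holomorphic function which agrees near `0` with `z ↦ z offDiag(z)`. -/
noncomputable def offDiagReg (ν : Fin 4 → ℂ) (u z : ℂ) : ℂ :=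
  ∑ α, ν α * (e (z * dω α) * (theta τ (ω τ α + u + z) * deriv (theta τ) 0 /
    (theta τ (ω τ α + u) * dslope (theta τ) 0 z)))

/-- No condition on `z` is needed: at `z = 0` both sides are `0` because division by zero gives
zero. -/
theorem offDiag_eq_div (ν : Fin 4 → ℂ) (u z : ℂ) :
    offDiag τ ν u z = offDiagReg τ ν u z / z := by
  simp only [offDiag, offDiagReg, phiα, phi, Finset.sum_div]
  refine Finset.sum_congr rfl fun α _ => ?_
  rw [theta_eq_mul_dslope τ (zero_mem _) z, sub_zero]
  simp only [div_eq_mul_inv, mul_inv]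
  ring

theorem dslope_theta_zero_ne : dslope (theta τ) 0 0 ≠ 0 := by
  rw [dslope_same]; exact deriv_theta_zero_ne_zero τ

theorem analyticAt_offDiagReg (ν : Fin 4 → ℂ) {u : ℂ} (hu : 2 * u ∉ (torus τ).lattice) :
    AnalyticAt ℂ (offDiagReg τ ν u) 0 := by
  unfold offDiagReg
  refine Finset.analyticAt_fun_sum _ fun α _ => analyticAt_const.mul (AnalyticAt.mul ?_ ?_)
  · have := differentiable_e
    exact Differentiable.analyticAt (f := fun z => e (z * dω α)) (by fun_prop) 0
  · have h1 := differentiable_theta τ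
    refine AnalyticAt.div ?_ (analyticAt_const.mul (analyticAt_dslope_theta τ 0 0)) ?_
    · exact Differentiable.analyticAt
        (f := fun z => theta τ (ω τ α + u + z) * deriv (theta τ) 0) (by fun_prop) 0
    · exact mul_ne_zero ((theta_eq_zero_iff τ).not.2 (ω_add_notMem τ hu α))
        (dslope_theta_zero_ne τ)

theorem offDiagReg_zero (ν : Fin 4 → ℂ) {u : ℂ} (hu : 2 * u ∉ (torus τ).lattice) :
    offDiagReg τ ν u 0 = ∑ α, ν α := by
  refine Finset.sum_congr rfl fun α _ => ?_
  have h1 := (theta_eq_zero_iff τ).not.2 (ω_add_notMem τ hu α)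
  have h2 := deriv_theta_zero_ne_zero τ
  rw [zero_mul, e_zero, add_zero, dslope_same]
  field_simp

/-- An even function has derivative `0` at the origin, so division by `z²` produces no simple pole.
-/
theorem hasRemovableAt_even {g : ℂ → ℂ} (hg : AnalyticAt ℂ g 0) (he : ∀ z, g (-z) = g z) :
    HasRemovableAt (fun z => g z / z ^ 2 - g 0 / z ^ 2) 0 := by
  have hd : deriv g 0 = 0 := by
    have h1 := hg.differentiableAt.hasDerivAt
    have h2 : HasDerivAt (fun z => g (-z)) (-deriv g 0) 0 := by
      have h3 : HasDerivAt g (deriv g 0) (-0) := by rwa [neg_zero]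
      have h4 := h3.comp (0 : ℂ) (hasDerivAt_neg (0 : ℂ))
      rw [mul_neg_one] at h4
      exact h4
    simp only [he] at h2
    exact self_eq_neg.mp (h1.unique h2)
  have hs : ∀ f : ℂ → ℂ, AnalyticAt ℂ f 0 → AnalyticAt ℂ (dslope f 0) 0 := by
    rintro f ⟨p, hp⟩
    exact hp.has_fpower_series_dslope_fslope.analyticAt
  refine ⟨dslope (dslope g 0) 0, hs _ (hs _ hg), ?_⟩
  filter_upwards [self_mem_nhdsWithin] with z hz
  have hz' : z ≠ 0 := hz
  rw [dslope_of_ne _ hz', slope_def_field, dslope_of_ne _ hz', slope_def_field, dslope_same, hd]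
  field_simp
  ring

theorem analyticAt_offDiag (ν : Fin 4 → ℂ) {u z : ℂ} (hz : z ∉ (torus τ).lattice)
    (hu : 2 * u ∉ (torus τ).lattice) : AnalyticAt ℂ (offDiag τ ν u) z := by
  unfold offDiag phiα phi
  refine Finset.analyticAt_fun_sum _ fun α _ => analyticAt_const.mul (AnalyticAt.mul ?_ ?_)
  · have := differentiable_e
    exact Differentiable.analyticAt (f := fun z => e (z * dω α)) (by fun_prop) z
  · have h1 := differentiable_theta τ
    refine AnalyticAt.div ?_ (analyticAt_const.mul (analyticAt_theta τ z)) ?_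
    · exact Differentiable.analyticAt
        (f := fun z => theta τ (ω τ α + u + z) * deriv (theta τ) 0) (by fun_prop) z
    · exact mul_ne_zero ((theta_eq_zero_iff τ).not.2 (ω_add_notMem τ hu α))
        ((theta_eq_zero_iff τ).not.2 hz)

theorem offDiag_mul_add_period (ν : Fin 4 → ℂ) (m n : ℤ) (u z : ℂ) :
    offDiag τ ν u (z + (m + n * τ)) * offDiag τ ν (-u) (z + (m + n * τ)) =
      offDiag τ (fun α => periodSign m n α * ν α) u z *
        offDiag τ (fun α => periodSign m n α * ν α) (-u) z := by
  rw [offDiag_add_period, offDiag_add_period, mul_neg, e_neg]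
  have := e_ne_zero (-(n : ℂ) * u)
  generalize e (-(n : ℂ) * u) = E at *
  field_simp

/-- By `offDiag_neg_neg` the product is `g(z) / z²` with `g(z) = offDiagReg(z) offDiagReg(-z)`,
which is even. -/
theorem hasRemovableAt_offDiag_mul_zero (ν : Fin 4 → ℂ) {u : ℂ} (hu : 2 * u ∉ (torus τ).lattice) :
    HasRemovableAt (fun z => offDiag τ ν u z * offDiag τ ν (-u) z - (∑ α, ν α) ^ 2 / z ^ 2) 0 := by
  have h1 := analyticAt_offDiagReg τ ν hu
  have h2 : AnalyticAt ℂ (fun z => offDiagReg τ ν u z * offDiagReg τ ν u (-z)) 0 := by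
    refine h1.mul (AnalyticAt.fun_comp (g := offDiagReg τ ν u) (f := fun z => -z) ?_ (by fun_prop))
    rwa [neg_zero]
  refine (hasRemovableAt_even h2 fun z => by rw [neg_neg, mul_comm]).congr
    (Eventually.of_forall fun z => ?_)
  have h3 := offDiag_neg_neg τ ν u (-z)
  rw [neg_neg] at h3
  simp only
  rw [h3, offDiag_eq_div, offDiag_eq_div, neg_zero, offDiagReg_zero τ ν hu]
  ring

/-- Translation of `l` to `0` replaces `ν_α` by `I_{ρα} ν_α`, and then the coefficient `(∑ ν_α)²`
becomes `K_ρ`. -/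
theorem hasRemovableAt_offDiag_mul (ν : Fin 4 → ℂ) {u : ℂ} (hu : 2 * u ∉ (torus τ).lattice)
    {l : ℂ} (hl : l ∈ (torus τ).lattice) {ρ : Fin 4}
    (hρ : l - 2 * ω τ ρ ∈ (doubledTorus τ).lattice) :
    HasRemovableAt (fun z => offDiag τ ν u z * offDiag τ ν (-u) z - K τ ν ρ / (z - l) ^ 2) l := by
  obtain ⟨m, n, rfl⟩ := mem_torus.1 hl
  have h1 := hasRemovableAt_offDiag_mul_zero τ (fun α => periodSign m n α * ν α) hu
  rw [← sub_self ((m : ℂ) + n * τ), sub_eq_add_neg] at h1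
  refine h1.comp_add.congr (Eventually.of_forall fun z => ?_)
  have h2 := offDiag_mul_add_period τ ν m n u (z + -(m + n * τ))
  rw [neg_add_cancel_right] at h2
  simp only
  rw [h2, K_eq_sq]
  simp only [periodSign_eq_of_mem τ hρ, ← sub_eq_add_neg]

/-- Each translate twists `ν` by a row of the sign matrix. By orthogonality of its columns only the
products with equal indices survive the sum, each four times. -/
theorem sum_offDiag_mul (ν : Fin 4 → ℂ) {u z : ℂ} (hu : 2 * u ∉ (torus τ).lattice)
    (hz : z ∉ (torus τ).lattice) :
    ∑ ρ, offDiag τ ν u (z + 2 * ω τ ρ) * offDiag τ ν (-u) (z + 2 * ω τ ρ) =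
      4 * ∑ α, ν α ^ 2 * ((torus τ).weierstrassP z - (torus τ).weierstrassP (u + ω τ α)) := by
  simp only [← phiα_mul τ _ hz hu]
  have h : ∀ ρ, offDiag τ ν u (z + 2 * ω τ ρ) * offDiag τ ν (-u) (z + 2 * ω τ ρ) =
      offDiag τ (fun α => signMatrix τ ρ α * ν α) u z *
        offDiag τ (fun α => signMatrix τ ρ α * ν α) (-u) z := by
    intro ρ
    rw [two_mul_ω, offDiag_mul_add_period]
    simp only [← signMatrix_eq_periodSign τ]
  simp only [h]
  simp only [offDiag, ← sub_eq_add_neg, Fin.sum_univ_four, signMatrix_eq]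
  simp
  ring

/-- The product of the off-diagonal entries of the Lax matrix. -/
theorem offDiag_mul (ν : Fin 4 → ℂ) {u z : ℂ} (hu : 2 * u ∉ (torus τ).lattice)
    (hz : z ∉ (torus τ).lattice) :
    offDiag τ ν u z * offDiag τ ν (-u) z =
      ∑ ρ, K τ ν ρ * (doubledTorus τ).weierstrassP (z - 2 * ω τ ρ) -
        ∑ α, ν α ^ 2 * (torus τ).weierstrassP (u + ω τ α) := by
  have hu' : 2 * -u ∉ (torus τ).lattice := by rwa [mul_neg, neg_mem_iff]
  set f : ℂ → ℂ := fun z => offDiag τ ν u z * offDiag τ ν (-u) z -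
    ∑ ρ, K τ ν ρ * (doubledTorus τ).weierstrassP (z - 2 * ω τ ρ)
  have hfa : ∀ z ∉ (torus τ).lattice, AnalyticAt ℂ f z := by
    intro z hz
    refine ((analyticAt_offDiag τ ν hz hu).mul (analyticAt_offDiag τ ν hz hu')).sub
      (Finset.analyticAt_fun_sum _ fun α _ => analyticAt_const.mul ?_)
    refine AnalyticAt.fun_comp (f := fun z => z - 2 * ω τ α)
      (g := (doubledTorus τ).weierstrassP) (analyticAt_wp fun h => ?_) (by fun_prop)
    exact hz ((sub_two_ω_mem_torus τ α).1 (doubledTorus_le τ h))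
  have hW : ∀ z, ∀ l ∈ (doubledTorus τ).lattice, ∀ ρ,
      (doubledTorus τ).weierstrassP (z + l - 2 * ω τ ρ) =
        (doubledTorus τ).weierstrassP (z - 2 * ω τ ρ) := by
    intro z l hl ρ
    rw [← wp_add (z - 2 * ω τ ρ) hl]
    congr 1
    ring
  obtain ⟨c, hc⟩ := elliptic_liouville (doubledTorus τ) (f := f) (by
    intro l
    by_cases hl : l ∈ (torus τ).lattice
    · obtain ⟨ρ, hρ⟩ := exists_two_ω τ hl
      refine ((hasRemovableAt_offDiag_mul τ ν hu hl hρ).sub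
        (hasRemovableAt_sum_wp τ (K τ ν) hρ)).congr (Eventually.of_forall fun z => ?_)
      simp only [f]
      ring
    · exact .of_analyticAt (hfa l hl)) (by
    intro z l hl
    simp only [f, hW z l hl]
    congr 1
    obtain ⟨m, n, rfl⟩ := mem_torus.1 (doubledTorus_le τ hl)
    -- A period in `2Λ` is in the class `ρ = 0`, whose signs are all `1`.
    have h0 : (m : ℂ) + n * τ - 2 * ω τ 0 ∈ (doubledTorus τ).lattice := by
      rwa [two_ω_zero, sub_zero]
    rw [offDiag_mul_add_period]
    have h1 : ∀ α, signMatrix τ 0 α = 1 := fun α => by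
      rw [signMatrix_eq]; fin_cases α <;> rfl
    simp [periodSign_eq_of_mem τ h0, h1])
  have hval : ∀ z ∉ (torus τ).lattice, f z = c := fun z hz => hc z (hfa z hz).continuousAt
  have hz' : ∀ ρ, z + 2 * ω τ ρ ∉ (torus τ).lattice := fun ρ h =>
    hz ((add_mem_cancel_right (two_ω_mem τ ρ)).1 h)
  -- The constant `c` is computed from four translates: by `sum_wp_doubled` and `K_sum` the terms
  -- with `℘(z)` cancel, leaving `c = -∑ ν_α² ℘(u + ω_α)`.
  have hsum : ∑ ρ, f (z + 2 * ω τ ρ) = 4 * c := by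
    simp [hval _ (hz' _)]
  simp only [f, Finset.sum_sub_distrib] at hsum
  rw [sum_offDiag_mul τ ν hu hz, Finset.sum_comm] at hsum
  have h2 : ∀ σ, ∑ ρ, K τ ν σ * (doubledTorus τ).weierstrassP (z + 2 * ω τ ρ - 2 * ω τ σ) =
      K τ ν σ * (torus τ).weierstrassP z := by
    intro σ
    rw [← Finset.mul_sum]
    congr 1
    rw [← wp_add z (neg_mem (two_ω_mem τ σ)), ← sub_eq_add_neg, ← sum_wp_doubled τ
      (fun h => hz ((sub_two_ω_mem_torus τ σ).1 h))]
    refine Finset.sum_congr rfl fun ρ _ => ?_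
    rw [← wp_add (z - 2 * ω τ σ - 2 * ω τ ρ) (four_ω_mem τ ρ)]
    congr 1
    ring
  simp only [h2, ← Finset.sum_mul, K_sum] at hsum
  have h3 := hval z hz
  simp only [f] at h3
  simp only [mul_sub, Finset.sum_sub_distrib, ← Finset.sum_mul] at hsum
  linear_combination h3 - hsum / 4

end

section
variable (τ : UpperHalfPlane)

/-! ### Residues -/

theorem deriv_theta_ne_zero {l : ℂ} (hl : l ∈ (torus τ).lattice) : deriv (theta τ) l ≠ 0 := by
  obtain ⟨m, n, rfl⟩ := mem_torus.1 hl
  obtain ⟨c, hc, h⟩ := theta_add_period τ m n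
  set l : ℂ := m + n * τ
  have h1 : HasDerivAt (fun z => theta τ (z + l)) (deriv (theta τ) l) 0 := by
    have := (differentiable_theta τ (0 + l)).hasDerivAt.comp_add_const 0 l
    rwa [zero_add] at this
  have h2 : HasDerivAt (fun z => c * e (-n * z) * theta τ z) (c * deriv (theta τ) 0) 0 := by
    have h3 : DifferentiableAt ℂ (fun z : ℂ => c * e (-n * z)) 0 := by
      have := differentiable_e
      exact Differentiable.differentiableAt (by fun_prop)
    have := h3.hasDerivAt.fun_mul (differentiable_theta τ 0).hasDerivAt
    rwa [theta_zero, mul_zero, zero_add, mul_zero, e_zero, mul_one] at this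
  simp only [h] at h1
  rw [h1.unique h2]
  exact mul_ne_zero hc (deriv_theta_zero_ne_zero τ)

theorem tendsto_mul_logDeriv {f : ℂ → ℂ} (hf : Differentiable ℂ f) {l : ℂ} (h0 : f l = 0)
    (h1 : deriv f l ≠ 0) : Tendsto (fun z => (z - l) * logDeriv f z) (𝓝[≠] l) (𝓝 1) := by
  have h2 : DifferentiableOn ℂ (dslope f l) Set.univ :=
    (Complex.differentiableOn_dslope univ_mem).2 hf.differentiableOn
  have h3 : ContinuousAt (fun z => deriv f z / dslope f l z) l :=
    (hf.analyticAt l).deriv.continuousAt.div (h2.analyticAt univ_mem).continuousAt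
      (by rwa [dslope_same])
  have h4 := h3.tendsto.mono_left (nhdsWithin_le_nhds (s := {l}ᶜ))
  rw [dslope_same, div_self h1] at h4
  refine h4.congr' ?_
  filter_upwards [self_mem_nhdsWithin] with z hz
  have hz' : z - l ≠ 0 := sub_ne_zero.2 hz
  rw [dslope_of_ne _ hz, slope_def_field, h0, sub_zero, logDeriv_apply]
  simp only [div_eq_mul_inv, mul_inv, inv_inv]
  ring

theorem hasDerivAt_theta_half (z : ℂ) :
    HasDerivAt (fun x => theta τ (x / 2)) (deriv (theta τ) (z / 2) / 2) z := by
  have := (differentiable_theta τ (z / 2)).hasDerivAt.comp z ((hasDerivAt_id z).div_const 2)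
  rw [mul_one_div] at this
  exact this

theorem tendsto_mul_E1doubled {l : ℂ} (hl : l ∈ (doubledTorus τ).lattice) :
    Tendsto (fun z => (z - l) * E1doubled τ z) (𝓝[≠] l) (𝓝 1) := by
  rw [mem_doubledTorus] at hl
  refine tendsto_mul_logDeriv (fun z => (hasDerivAt_theta_half τ z).differentiableAt)
    (theta_of_mem τ hl) ?_
  rw [(hasDerivAt_theta_half τ l).deriv]
  exact div_ne_zero (deriv_theta_ne_zero τ hl) two_ne_zero

theorem continuousAt_E1doubled {z : ℂ} (hz : z ∉ (doubledTorus τ).lattice) :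
    ContinuousAt (E1doubled τ) z := by
  rw [mem_doubledTorus, ← theta_eq_zero_iff] at hz
  have hd : Differentiable ℂ (fun x => theta τ (x / 2)) :=
    fun z => (hasDerivAt_theta_half τ z).differentiableAt
  have := (hd.analyticAt z).deriv.continuousAt.div (hd.analyticAt z).continuousAt hz
  exact this

theorem tendsto_mul_of_continuousAt {f : ℂ → ℂ} {l : ℂ} (hf : ContinuousAt f l) :
    Tendsto (fun z => (z - l) * f z) (𝓝[≠] l) (𝓝 0) := by
  have : ContinuousAt (fun z => (z - l) * f z) l := by fun_prop
  simpa using this.tendsto.mono_left (nhdsWithin_le_nhds (s := {l}ᶜ))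

theorem tendsto_mul_E1doubled_sub {l : ℂ} {ρ : Fin 4}
    (hl : l - 2 * ω τ ρ ∈ (doubledTorus τ).lattice) (α : Fin 4) :
    Tendsto (fun z => (z - l) * E1doubled τ (z - 2 * ω τ α)) (𝓝[≠] l)
      (𝓝 (if α = ρ then 1 else 0)) := by
  split_ifs with h
  · subst h
    have := (tendsto_mul_E1doubled τ hl).comp (tendsto_add_punctured l (-(2 * ω τ α)))
    refine this.congr fun z => ?_
    simp only [Function.comp, ← sub_eq_add_neg]
    ring
  · refine tendsto_mul_of_continuousAt (ContinuousAt.comp (f := fun z => z - 2 * ω τ α)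
      (g := E1doubled τ) (continuousAt_E1doubled τ fun h' => ?_) (by fun_prop))
    refine h ((two_ω_sub_mem τ).1 ?_)
    convert sub_mem hl h' using 1
    ring

theorem tendsto_mul_offDiag_zero (ν : Fin 4 → ℂ) {u : ℂ} (hu : 2 * u ∉ (torus τ).lattice) :
    Tendsto (fun z => z * offDiag τ ν u z) (𝓝[≠] 0) (𝓝 (∑ α, ν α)) := by
  have h := (analyticAt_offDiagReg τ ν hu).continuousAt.tendsto.mono_left
    (nhdsWithin_le_nhds (s := {0}ᶜ))
  rw [offDiagReg_zero τ ν hu] at h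
  refine h.congr' ?_
  filter_upwards [self_mem_nhdsWithin] with z hz
  have : z ≠ 0 := hz
  rw [offDiag_eq_div]
  field_simp

theorem tendsto_mul_offDiag (ν : Fin 4 → ℂ) {u : ℂ} (hu : 2 * u ∉ (torus τ).lattice) (m n : ℤ) :
    Tendsto (fun z => (z - (m + n * τ)) * offDiag τ ν u z) (𝓝[≠] (m + n * τ : ℂ))
      (𝓝 (e (-n * u) * ∑ α, periodSign m n α * ν α)) := by
  have h1 := tendsto_mul_offDiag_zero τ (fun α => periodSign m n α * ν α) hu
  have h2 := tendsto_add_punctured (m + n * τ : ℂ) (-(m + n * τ))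
  rw [add_neg_cancel] at h2
  refine ((h1.comp h2).const_mul (e (-n * u))).congr fun z => ?_
  have := offDiag_add_period τ ν m n u (z + -(m + n * τ))
  rw [neg_add_cancel_right] at this
  rw [this]
  simp only [Function.comp]
  ring

theorem tendsto_mul_offDiag_two_ω (ν : Fin 4 → ℂ) {u : ℂ} (hu : 2 * u ∉ (torus τ).lattice)
    (ρ : Fin 4) :
    Tendsto (fun z => (z - 2 * ω τ ρ) * offDiag τ ν u z) (𝓝[≠] (2 * ω τ ρ))
      (𝓝 (e (-2 * u * dω ρ) * ∑ α, signMatrix τ ρ α * ν α)) := by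
  have := tendsto_mul_offDiag τ ν hu (mω ρ) (nω ρ)
  rw [← two_mul_ω] at this
  simp only [signMatrix_eq_periodSign]
  rwa [dω_eq, show -2 * u * ((nω ρ : ℂ) / 2) = -nω ρ * u by ring]

/-! ### The Gaudin model -/

/-- The upper left entry of the Lax matrix of the Gaudin model. -/
noncomputable def gaudinDiag (p : GaudinPoint) (z : ℂ) : ℂ :=
  p.v + ∑ α, p.s11 α * E1doubled τ (z - 2 * ω τ α)

theorem gaudinLax_eq (p : GaudinPoint) (z : ℂ) :
    gaudinLax τ p z = !![gaudinDiag τ p z, offDiag τ (p.t12 τ) p.u z;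
      offDiag τ (p.t21 τ) (-p.u) z, -gaudinDiag τ p z] := by
  simp only [gaudinLax, gaudinDiag, offDiag, sub_eq_add_neg]

/-- Because the off-diagonal function changes sign under `(u, z) ↦ (-u, -z)`, the involution merely
exchanges the two coefficient vectors. -/
theorem involution_gaudinLax (p : GaudinPoint) (z : ℂ) :
    involution (gaudinLax τ p) z = !![gaudinDiag τ p (-z), offDiag τ (p.t21 τ) p.u z;
      offDiag τ (p.t12 τ) (-p.u) z, -gaudinDiag τ p (-z)] := by
  have h1 := offDiag_neg_neg τ (p.t21 τ) p.u z
  have h2 := offDiag_neg_neg τ (p.t12 τ) p.u (-z)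
  rw [neg_neg] at h2
  ext i j
  fin_cases i <;> fin_cases j <;>
    simp [involution, gaudinLax_eq, σ₁, h1, h2]

theorem tendsto_mul_gaudinDiag (p : GaudinPoint) {l : ℂ} {ρ : Fin 4}
    (hl : l - 2 * ω τ ρ ∈ (doubledTorus τ).lattice) :
    Tendsto (fun z => (z - l) * gaudinDiag τ p z) (𝓝[≠] l) (𝓝 (p.s11 ρ)) := by
  have h1 := tendsto_mul_of_continuousAt (continuousAt_const (x := l) (y := p.v))
  have h2 := tendsto_finsetSum Finset.univ fun α _ =>
    (tendsto_mul_E1doubled_sub τ hl α).const_mul (p.s11 α)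
  have h3 := h1.add h2
  simp only [mul_ite, mul_one, mul_zero, Finset.sum_ite_eq', Finset.mem_univ, if_true,
    zero_add] at h3
  refine h3.congr fun z => ?_
  rw [gaudinDiag, mul_add, Finset.mul_sum]
  congr 1
  exact Finset.sum_congr rfl fun α _ => by ring

theorem sum_signMatrix_t12 (p : GaudinPoint) (ρ : Fin 4) :
    ∑ α, signMatrix τ ρ α * p.t12 τ α = e (2 * p.u * dω ρ) * p.s12 ρ := by
  rw [← signMatrix_inversion τ (fun ρ => e (2 * p.u * dω ρ) * p.s12 ρ) ρ]
  refine Finset.sum_congr rfl fun α _ => ?_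
  rw [GaudinPoint.t12]
  congr 2
  exact Finset.sum_congr rfl fun β _ => by ring

theorem sum_signMatrix_t21 (p : GaudinPoint) (ρ : Fin 4) :
    ∑ α, signMatrix τ ρ α * p.t21 τ α = e (-2 * p.u * dω ρ) * p.s21 ρ := by
  rw [← signMatrix_inversion τ (fun ρ => e (-2 * p.u * dω ρ) * p.s21 ρ) ρ]
  refine Finset.sum_congr rfl fun α _ => ?_
  rw [GaudinPoint.t21]
  congr 2
  exact Finset.sum_congr rfl fun β _ => by ring

theorem e_mul_e_neg (u : ℂ) (ρ : Fin 4) : e (-2 * u * dω ρ) * e (2 * u * dω ρ) = 1 := by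
  rw [← e_add, ← e_zero]; ring_nf

theorem gaudin_residue (p : GaudinPoint) (hu : 2 * p.u ∉ (torus τ).lattice) (ρ : Fin 4)
    (i j : Fin 2) :
    Tendsto (fun z => (z - 2 * ω τ ρ) * gaudinLax τ p z i j) (𝓝[≠] (2 * ω τ ρ))
      (𝓝 (!![p.s11 ρ, p.s12 ρ; p.s21 ρ, -p.s11 ρ] i j)) := by
  have hu' : 2 * -p.u ∉ (torus τ).lattice := by rwa [mul_neg, neg_mem_iff]
  have h1 := tendsto_mul_gaudinDiag τ p (l := 2 * ω τ ρ) (ρ := ρ) (by simp)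
  have h2 := tendsto_mul_offDiag_two_ω τ (p.t12 τ) hu ρ
  have h3 := tendsto_mul_offDiag_two_ω τ (p.t21 τ) hu' ρ
  have h4 := e_mul_e_neg p.u ρ
  rw [sum_signMatrix_t12, ← mul_assoc, h4, one_mul] at h2
  rw [sum_signMatrix_t21, show -2 * -p.u * dω ρ = 2 * p.u * dω ρ by ring, ← mul_assoc, mul_comm (e _),
    h4, one_mul] at h3
  simp only [gaudinLax_eq]
  fin_cases i <;> fin_cases j
  · simpa using h1
  · simpa using h2
  · simpa using h3
  · simpa using h1.neg

/-- The residues at the four points `2ω_ρ` are, up to nonzero factors, the sign transform of `ν`,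
which is invertible. -/
theorem eq_of_offDiag_eq {ν ν' : Fin 4 → ℂ} {u : ℂ} (hu : 2 * u ∉ (torus τ).lattice)
    (h : ∀ z ∉ (torus τ).lattice, offDiag τ ν u z = offDiag τ ν' u z) : ν = ν' := by
  rw [← sub_eq_zero]
  refine eq_zero_of_signMatrix τ fun ρ => ?_
  have h1 := tendsto_mul_offDiag_two_ω τ ν hu ρ
  have h2 := tendsto_mul_offDiag_two_ω τ ν' hu ρ
  have h3 := tendsto_nhds_unique h1 (h2.congr' (by
    filter_upwards [eventually_notMem (torus τ) (2 * ω τ ρ)] with z hz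
    rw [h z hz]))
  have h4 := mul_left_cancel₀ (e_ne_zero _) h3
  simp only [Pi.sub_apply, mul_sub, Finset.sum_sub_distrib, h4, sub_self]

theorem gaudin_fixed_iff (p : GaudinPoint) (hu : 2 * p.u ∉ (torus τ).lattice) :
    p.IsFixed τ ↔ (∀ α, p.s11 α = 0) ∧ ∀ α, p.t12 τ α = p.t21 τ α := by
  constructor
  · intro h
    constructor
    · intro ρ
      -- The points `±2ω_ρ` are congruent modulo `2Λ`, so the diagonal entry has the residue `s₁₁`
      -- at both. If this entry is even, the residue equals its own negative.
      have h1 := tendsto_mul_gaudinDiag τ p (l := 2 * ω τ ρ) (ρ := ρ) (by simp)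
      have h2 := tendsto_mul_gaudinDiag τ p (l := -(2 * ω τ ρ)) (ρ := ρ) (by
        convert neg_mem (four_ω_mem τ ρ) using 1
        ring)
      have h3 : Tendsto (fun z : ℂ => -z) (𝓝[≠] (2 * ω τ ρ)) (𝓝[≠] (-(2 * ω τ ρ))) := by
        refine tendsto_nhdsWithin_of_tendsto_nhds_of_eventually_within _ ?_ ?_
        · exact (continuous_neg.tendsto _).mono_left nhdsWithin_le_nhds
        · filter_upwards [self_mem_nhdsWithin] with z hz
          simpa using hz
      have h4 := tendsto_nhds_unique h1 ((h2.comp h3).neg.congr' (by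
        filter_upwards [eventually_notMem (torus τ) (2 * ω τ ρ)] with z hz
        have := congrFun (congrFun (h z hz) 0) 0
        rw [involution_gaudinLax, gaudinLax_eq] at this
        simp only [Matrix.of_apply, Matrix.cons_val_zero] at this
        simp only [Function.comp, this]
        ring))
      exact self_eq_neg.mp h4
    · refine fun α => congrFun (eq_of_offDiag_eq τ hu fun z hz => ?_) α
      have := congrFun (congrFun (h z hz) 0) 1
      rw [involution_gaudinLax, gaudinLax_eq] at this
      simpa using this.symm
  · rintro ⟨h1, h2⟩ z -
    have h3 : p.t12 τ = p.t21 τ := funext h2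
    rw [involution_gaudinLax, gaudinLax_eq, h3]
    simp [gaudinDiag, h1]

theorem gaudinLax_of_fixed {p : GaudinPoint} (h1 : ∀ α, p.s11 α = 0)
    (h2 : ∀ α, p.t12 τ α = p.t21 τ α) (z : ℂ) :
    gaudinLax τ p z = laxL τ (p.t12 τ) p.v p.u z := by
  rw [gaudinLax_eq, laxL_eq, ← show p.t12 τ = p.t21 τ from funext h2]
  simp [gaudinDiag, h1]

/-- Equality of the transforms gives `e(2u ∂_τω_α) s₁₂ = e(-2u ∂_τω_α) s₂₁`. This common value is
the square root `r α`: its square is `s₁₂ s₂₁`, the Casimir value when `s₁₁ = 0`. -/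
theorem gaudin_reduction {p : GaudinPoint} (h1 : ∀ α, p.s11 α = 0)
    (h2 : ∀ α, p.t12 τ α = p.t21 τ α) :
    (∃ r : Fin 4 → ℂ, (∀ α, r α ^ 2 = p.casimir α) ∧
      (∀ α, p.s12 α = e (-2 * p.u * dω α) * r α) ∧
      (∀ α, p.s21 α = e (2 * p.u * dω α) * r α) ∧
      (∀ ρ, p.t12 τ ρ = (1 / 4) * ∑ α, signMatrix τ ρ α * r α)) ∧
    (∀ ρ, K τ (p.t12 τ) ρ = p.casimir ρ) := by
  have key : ∀ α, e (2 * p.u * dω α) * p.s12 α = e (-2 * p.u * dω α) * p.s21 α := by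
    intro α
    rw [← sum_signMatrix_t12 τ, ← sum_signMatrix_t21 τ]
    simp only [h2]
  have hcas : ∀ α, (e (2 * p.u * dω α) * p.s12 α) ^ 2 = p.casimir α := by
    intro α
    have := e_mul_e_neg p.u α
    rw [sq]
    nth_rewrite 2 [key]
    rw [GaudinPoint.casimir, h1]
    linear_combination (p.s12 α * p.s21 α) * this
  refine ⟨⟨fun α => e (2 * p.u * dω α) * p.s12 α, hcas, fun α => ?_, fun α => ?_, fun ρ => ?_⟩,
    fun ρ => ?_⟩
  · rw [← mul_assoc, e_mul_e_neg, one_mul]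
  · simp only [key]
    rw [← mul_assoc, mul_comm (e (2 * p.u * dω α)), e_mul_e_neg, one_mul]
  · rw [GaudinPoint.t12]
    congr 1
    exact Finset.sum_congr rfl fun β _ => by ring
  · rw [K_eq_sq, sum_signMatrix_t12, hcas]

theorem gaudin_exists (ν : Fin 4 → ℂ) (v u : ℂ) (hu : 2 * u ∉ (torus τ).lattice) :
    ∃ p : GaudinPoint, p.v = v ∧ p.u = u ∧ p.IsFixed τ ∧ p.t12 τ = ν ∧
      ∀ z, gaudinLax τ p z = laxL τ ν v u z := by
  let p : GaudinPoint :=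
    { v := v, u := u, s11 := 0
      -- The residues at `2ω_α` are prescribed by inverting the transform that defines `t12` and
      -- `t21`.
      s12 := fun α => e (-2 * u * dω α) * ∑ β, signMatrix τ α β * ν β
      s21 := fun α => e (2 * u * dω α) * ∑ β, signMatrix τ α β * ν β }
  have h12 : p.t12 τ = ν := by
    ext ρ
    rw [GaudinPoint.t12, ← signMatrix_inversion' τ ν ρ]
    congr 1
    refine Finset.sum_congr rfl fun α _ => ?_
    have := e_mul_e_neg u α
    simp only [p]
    linear_combination (signMatrix τ ρ α * ∑ β, signMatrix τ α β * ν β) * this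
  have h21 : p.t21 τ = ν := by
    ext ρ
    rw [GaudinPoint.t21, ← signMatrix_inversion' τ ν ρ]
    congr 1
    refine Finset.sum_congr rfl fun α _ => ?_
    have := e_mul_e_neg u α
    simp only [p]
    linear_combination (signMatrix τ ρ α * ∑ β, signMatrix τ α β * ν β) * this
  have h11 : ∀ α, p.s11 α = 0 := fun α => rfl
  have h : ∀ α, p.t12 τ α = p.t21 τ α := fun α => by rw [h12, h21]
  refine ⟨p, rfl, rfl, (gaudin_fixed_iff τ p hu).2 ⟨h11, h⟩, h12, fun z => ?_⟩
  rw [gaudinLax_of_fixed τ h11 h, h12]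

end

/-! ### Orders of rational functions -/

theorem ratOrder_infty (R : RatFunc ℂ) : ratOrder R OnePoint.infty = -R.intDegree := rfl

theorem ratOrder_coe (R : RatFunc ℂ) (a : ℂ) : ratOrder R (a : OnePoint ℂ) =
    (R.num.rootMultiplicity a : ℤ) - R.denom.rootMultiplicity a := rfl

theorem ratOrder_zero (p : OnePoint ℂ) : ratOrder 0 p = 0 := by
  induction p using OnePoint.rec <;> simp [ratOrder_infty, ratOrder_coe]

theorem num_mul_denom_div (N : ℂ[X]) {D : ℂ[X]} (hD : D ≠ 0) :
    (algebraMap ℂ[X] (RatFunc ℂ) N / algebraMap ℂ[X] (RatFunc ℂ) D).num * D =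
      N * (algebraMap ℂ[X] (RatFunc ℂ) N / algebraMap ℂ[X] (RatFunc ℂ) D).denom :=
  (RatFunc.num_mul_eq_mul_denom_iff hD).2 rfl

/-- Root multiplicities are additive in `num * D = N * denom`, so the order can be computed from an
unreduced fraction. -/
theorem ratOrder_div_coe {N D : ℂ[X]} (hN : N ≠ 0) (hD : D ≠ 0) (a : ℂ) :
    ratOrder (algebraMap ℂ[X] (RatFunc ℂ) N / algebraMap ℂ[X] (RatFunc ℂ) D) (a : OnePoint ℂ) =
      (N.rootMultiplicity a : ℤ) - D.rootMultiplicity a := by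
  have h := congrArg (rootMultiplicity a) (num_mul_denom_div N hD)
  have h0 : N * (algebraMap ℂ[X] (RatFunc ℂ) N / algebraMap ℂ[X] (RatFunc ℂ) D).denom ≠ 0 :=
    mul_ne_zero hN (RatFunc.denom_ne_zero _)
  rw [rootMultiplicity_mul h0, rootMultiplicity_mul (by rwa [num_mul_denom_div N hD])] at h
  rw [ratOrder_coe]
  lia

theorem ratOrder_div_infty {N D : ℂ[X]} (hN : N ≠ 0) (hD : D ≠ 0) :
    ratOrder (algebraMap ℂ[X] (RatFunc ℂ) N / algebraMap ℂ[X] (RatFunc ℂ) D) OnePoint.infty =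
      (D.natDegree : ℤ) - N.natDegree := by
  rw [ratOrder_infty, RatFunc.intDegree_div (RatFunc.algebraMap_ne_zero hN)
    (RatFunc.algebraMap_ne_zero hD), RatFunc.intDegree_polynomial, RatFunc.intDegree_polynomial]
  ring

theorem ratFunc_eval_div {N D : ℂ[X]} {x : ℂ} (hx : D.eval x ≠ 0) :
    (algebraMap ℂ[X] (RatFunc ℂ) N / algebraMap ℂ[X] (RatFunc ℂ) D).eval (RingHom.id ℂ) x =
      N.eval x / D.eval x := by
  have hD : D ≠ 0 := by rintro rfl; simp at hx
  have h := congrArg (eval x) (num_mul_denom_div N hD)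
  rw [eval_mul, eval_mul] at h
  obtain ⟨S, hS⟩ := RatFunc.denom_div_dvd N D
  have h1 : (algebraMap ℂ[X] (RatFunc ℂ) N / algebraMap ℂ[X] (RatFunc ℂ) D).denom.eval x ≠ 0 := by
    intro h0
    rw [hS, eval_mul, h0, zero_mul] at hx
    exact hx rfl
  rw [RatFunc.eval, eval₂_id, eval₂_id, div_eq_div_iff h1 hx, h]

/-! ### The polynomials of the spectral curve -/

/-- The polynomial with the roots `a`, `b`, `c`. -/
noncomputable def cubic (a b c : ℂ) : ℂ[X] := (X - C a) * (X - C b) * (X - C c)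

/-- The numerator of `2E + k₀X + ∑ kᵢ (eᵢ + (eᵢ - eⱼ)(eᵢ - eₗ) / (X - eᵢ))`. -/
noncomputable def curveNum (a b c : ℂ) (k : Fin 4 → ℂ) (E : ℂ) : ℂ[X] :=
  (C (2 * E + k 1 * a + k 2 * b + k 3 * c) + C (k 0) * X) * cubic a b c +
    C (k 1 * ((a - b) * (a - c))) * ((X - C b) * (X - C c)) +
    C (k 2 * ((b - a) * (b - c))) * ((X - C a) * (X - C c)) +
    C (k 3 * ((c - a) * (c - b))) * ((X - C a) * (X - C b))

section
variable {a b c : ℂ}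

theorem cubic_eval (x : ℂ) : (cubic a b c).eval x = (x - a) * (x - b) * (x - c) := by
  simp [cubic]

theorem cubic_monic : (cubic a b c).Monic :=
  ((monic_X_sub_C a).mul (monic_X_sub_C b)).mul (monic_X_sub_C c)

theorem cubic_ne_zero : cubic a b c ≠ 0 := cubic_monic.ne_zero

theorem cubic_natDegree : (cubic a b c).natDegree = 3 := by
  rw [cubic, ((monic_X_sub_C a).mul (monic_X_sub_C b)).natDegree_mul (monic_X_sub_C c),
    (monic_X_sub_C a).natDegree_mul (monic_X_sub_C b)]
  simp

theorem cubic_rootMultiplicity (x : ℂ) : (cubic a b c).rootMultiplicity x =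
    (if x = a then 1 else 0) + (if x = b then 1 else 0) + (if x = c then 1 else 0) := by
  rw [cubic, rootMultiplicity_mul cubic_ne_zero, rootMultiplicity_mul
    ((monic_X_sub_C a).mul (monic_X_sub_C b)).ne_zero, rootMultiplicity_X_sub_C,
    rootMultiplicity_X_sub_C, rootMultiplicity_X_sub_C]

theorem curveNum_eval (k : Fin 4 → ℂ) (E : ℂ) {x : ℂ} (ha : x ≠ a) (hb : x ≠ b) (hc : x ≠ c) :
    (curveNum a b c k E).eval x = (cubic a b c).eval x *
      (2 * E + (k 0 * x + k 1 * (a + (a - b) * (a - c) / (x - a)) +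
        k 2 * (b + (b - a) * (b - c) / (x - b)) + k 3 * (c + (c - a) * (c - b) / (x - c)))) := by
  have h1 := sub_ne_zero.2 ha
  have h2 := sub_ne_zero.2 hb
  have h3 := sub_ne_zero.2 hc
  simp only [curveNum, cubic_eval, eval_add, eval_mul, eval_C, eval_X, eval_sub]
  field_simp
  ring

theorem curveNum_eval_a (k : Fin 4 → ℂ) (E : ℂ) :
    (curveNum a b c k E).eval a = k 1 * ((a - b) * (a - c)) ^ 2 := by
  simp only [curveNum, cubic_eval, eval_add, eval_mul, eval_C, eval_X, eval_sub]
  ring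

theorem curveNum_eval_b (k : Fin 4 → ℂ) (E : ℂ) :
    (curveNum a b c k E).eval b = k 2 * ((a - b) * (b - c)) ^ 2 := by
  simp only [curveNum, cubic_eval, eval_add, eval_mul, eval_C, eval_X, eval_sub]
  ring

theorem curveNum_eval_c (k : Fin 4 → ℂ) (E : ℂ) :
    (curveNum a b c k E).eval c = k 3 * ((a - c) * (b - c)) ^ 2 := by
  simp only [curveNum, cubic_eval, eval_add, eval_mul, eval_C, eval_X, eval_sub]
  ring

/-- Only the two leading coefficients matter later: they decide whether the degree is `4` or `3`. -/
theorem curveNum_expand (k : Fin 4 → ℂ) (E : ℂ) : ∃ m₂ m₁ m₀ : ℂ, curveNum a b c k E =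
    C (k 0) * X ^ 4 + C (2 * E + k 1 * a + k 2 * b + k 3 * c - k 0 * (a + b + c)) * X ^ 3 +
      C m₂ * X ^ 2 + C m₁ * X + C m₀ := by
  set s := 2 * E + k 1 * a + k 2 * b + k 3 * c with hs
  set k1 := k 1 * ((a - b) * (a - c)) with hk1
  set k2 := k 2 * ((b - a) * (b - c)) with hk2
  set k3 := k 3 * ((c - a) * (c - b)) with hk3
  refine ⟨k 0 * (a * b + b * c + c * a) - s * (a + b + c) + k1 + k2 + k3,
    -k 0 * a * b * c + s * (a * b + b * c + c * a) - k1 * (b + c) - k2 * (a + c) - k3 * (a + b),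
    -s * a * b * c + k1 * b * c + k2 * a * c + k3 * a * b, ?_⟩
  rw [curveNum, cubic, ← hs, ← hk1, ← hk2, ← hk3]
  simp only [C_add, C_sub, C_mul, C_neg]
  ring

theorem curveNum_natDegree_le (k : Fin 4 → ℂ) (E : ℂ) : (curveNum a b c k E).natDegree ≤ 4 := by
  obtain ⟨m₂, m₁, m₀, h⟩ := curveNum_expand (a := a) (b := b) (c := c) k E
  rw [h]
  compute_degree

theorem curveNum_coeff_four (k : Fin 4 → ℂ) (E : ℂ) : (curveNum a b c k E).coeff 4 = k 0 := by
  obtain ⟨m₂, m₁, m₀, h⟩ := curveNum_expand (a := a) (b := b) (c := c) k E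
  rw [h]
  compute_degree!

theorem curveNum_natDegree_le_three {k : Fin 4 → ℂ} (hk : k 0 = 0) (E : ℂ) :
    (curveNum a b c k E).natDegree ≤ 3 := by
  obtain ⟨m₂, m₁, m₀, h⟩ := curveNum_expand (a := a) (b := b) (c := c) k E
  rw [h, hk]
  simp only [C_0, zero_mul, zero_add]
  compute_degree

theorem curveNum_coeff_three {k : Fin 4 → ℂ} (hk : k 0 = 0) (E : ℂ) :
    (curveNum a b c k E).coeff 3 = 2 * E + k 1 * a + k 2 * b + k 3 * c := by
  obtain ⟨m₂, m₁, m₀, h⟩ := curveNum_expand (a := a) (b := b) (c := c) k E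
  rw [h, hk]
  simp only [C_0, zero_mul, zero_add, sub_zero]
  compute_degree!

theorem curveNum_natDegree_of_ne {k : Fin 4 → ℂ} (hk : k 0 ≠ 0) (E : ℂ) :
    (curveNum a b c k E).natDegree = 4 :=
  natDegree_eq_of_le_of_coeff_ne_zero (curveNum_natDegree_le k E) (by rwa [curveNum_coeff_four])

/-- `2E + k₀X + ∑ kᵢ (eᵢ + (eᵢ - eⱼ)(eᵢ - eₗ) / (X - eᵢ))`. -/
noncomputable def curveRat (a b c : ℂ) (k : Fin 4 → ℂ) (E : ℂ) : RatFunc ℂ :=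
  algebraMap ℂ[X] (RatFunc ℂ) (curveNum a b c k E) / algebraMap ℂ[X] (RatFunc ℂ) (cubic a b c)

/-- The leading coefficient and the values at `a, b, c` are the `kᵢ` up to nonzero squares. This
settles the zero function, whose `ratOrder` is `0` by convention. -/
theorem coeff_eq_zero_of_curveNum_eq_zero (hab : a - b ≠ 0) (hac : a - c ≠ 0) (hbc : b - c ≠ 0)
    {k : Fin 4 → ℂ} {E : ℂ} (h : curveNum a b c k E = 0) : k = 0 := by
  have h0 := curveNum_coeff_four (a := a) (b := b) (c := c) k E
  have h1 := curveNum_eval_a (a := a) (b := b) (c := c) k E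
  have h2 := curveNum_eval_b (a := a) (b := b) (c := c) k E
  have h3 := curveNum_eval_c (a := a) (b := b) (c := c) k E
  rw [h] at h0 h1 h2 h3
  simp [hab, hac, hbc] at h0 h1 h2 h3
  ext i
  fin_cases i
  · exact h0.symm
  · exact h1
  · exact h2
  · exact h3

theorem curveRat_order_infty (hab : a - b ≠ 0) (hac : a - c ≠ 0) (hbc : b - c ≠ 0)
    (k : Fin 4 → ℂ) (E : ℂ) :
    (ratOrder (curveRat a b c k E) OnePoint.infty < 0 ↔ k 0 ≠ 0) ∧
      -1 ≤ ratOrder (curveRat a b c k E) OnePoint.infty := by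
  by_cases hN : curveNum a b c k E = 0
  · rw [curveRat, hN, map_zero, zero_div, ratOrder_zero]
    simp [coeff_eq_zero_of_curveNum_eq_zero hab hac hbc hN]
  · rw [curveRat, ratOrder_div_infty hN cubic_ne_zero, cubic_natDegree]
    by_cases hk : k 0 = 0
    · have := curveNum_natDegree_le_three (a := a) (b := b) (c := c) hk E
      simp only [hk, ne_eq, not_true_eq_false, iff_false]
      lia
    · rw [curveNum_natDegree_of_ne hk]
      simp [hk]

/-- The denominator has simple roots, and the numerator at `a` is `k 1` times a nonzero square,
similarly at `b` and `c`. So the pole is simple, or cancelled exactly when the coefficient vanishes.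
-/
theorem curveRat_order_coe (hab : a - b ≠ 0) (hac : a - c ≠ 0) (hbc : b - c ≠ 0)
    (k : Fin 4 → ℂ) (E x : ℂ) :
    (ratOrder (curveRat a b c k E) (x : OnePoint ℂ) < 0 ↔
      (x = a ∧ k 1 ≠ 0) ∨ (x = b ∧ k 2 ≠ 0) ∨ (x = c ∧ k 3 ≠ 0)) ∧
      -1 ≤ ratOrder (curveRat a b c k E) (x : OnePoint ℂ) := by
  by_cases hN : curveNum a b c k E = 0
  · rw [curveRat, hN, map_zero, zero_div, ratOrder_zero]
    simp [coeff_eq_zero_of_curveNum_eq_zero hab hac hbc hN]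
  have key : ∀ {y κ t : ℂ}, (curveNum a b c k E).eval y = κ * t ^ 2 → t ≠ 0 →
      (κ = 0 ↔ 0 < (curveNum a b c k E).rootMultiplicity y) := fun {y κ t} h ht => by
    rw [rootMultiplicity_pos hN, IsRoot.def, h, mul_eq_zero_iff_right (pow_ne_zero 2 ht)]
  have hab' : a ≠ b := sub_ne_zero.1 hab
  have hac' : a ≠ c := sub_ne_zero.1 hac
  have hbc' : b ≠ c := sub_ne_zero.1 hbc
  rw [curveRat, ratOrder_div_coe hN cubic_ne_zero, cubic_rootMultiplicity]
  by_cases ha : x = a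
  · subst ha
    have h := key (curveNum_eval_a k E) (mul_ne_zero hab hac)
    simp only [hab', hac', if_true, if_false, true_and, false_and, or_false, ne_eq, h]
    lia
  by_cases hb : x = b
  · subst hb
    have h := key (curveNum_eval_b k E) (mul_ne_zero hab hbc)
    simp only [hab'.symm, hbc', if_true, if_false, true_and, false_and, or_false, ne_eq, h, false_or]
    lia
  by_cases hc : x = c
  · subst hc
    have h := key (curveNum_eval_c k E) (mul_ne_zero hac hbc)
    simp only [hac'.symm, hbc'.symm, if_true, if_false, true_and, false_and, ne_eq, h,
      false_or]
    lia
  · simp only [ha, hb, hc, if_false, false_and, false_or, iff_false]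
    lia

end

section
variable (τ : UpperHalfPlane)

theorem polePoint_zero : polePoint τ 0 = OnePoint.infty := if_pos rfl

theorem polePoint_of_ne {ρ : Fin 4} (h : ρ ≠ 0) :
    polePoint τ ρ = ((halfValue τ ρ : ℂ) : OnePoint ℂ) := if_neg h

theorem polePoint_injective : Function.Injective (polePoint τ) := by
  intro ρ α h
  by_cases hρ : ρ = 0 <;> by_cases hα : α = 0
  · rw [hρ, hα]
  · rw [hρ, polePoint_zero, polePoint_of_ne τ hα] at h
    exact absurd h (OnePoint.infty_ne_coe _)
  · rw [hα, polePoint_zero, polePoint_of_ne τ hρ] at h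
    exact absurd h (OnePoint.coe_ne_infty _)
  · rw [polePoint_of_ne τ hα, polePoint_of_ne τ hρ] at h
    exact halfValue_injective τ hρ hα (OnePoint.coe_injective h)

/-- The function `R` with `λ² = R(℘(z, 2τ))` on the spectral curve. -/
noncomputable def spectralRat (ν : Fin 4 → ℂ) (E : ℂ) : RatFunc ℂ :=
  curveRat (halfValue τ 1) (halfValue τ 2) (halfValue τ 3) (K τ ν) E

theorem spectralRat_order (ν : Fin 4 → ℂ) (E : ℂ) (p : OnePoint ℂ) :
    (ratOrder (spectralRat τ ν E) p < 0 ↔ ∃ ρ, K τ ν ρ ≠ 0 ∧ p = polePoint τ ρ) ∧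
      -1 ≤ ratOrder (spectralRat τ ν E) p := by
  have hp : (∃ ρ, K τ ν ρ ≠ 0 ∧ p = polePoint τ ρ) ↔ (K τ ν 0 ≠ 0 ∧ p = OnePoint.infty) ∨
      (K τ ν 1 ≠ 0 ∧ p = (halfValue τ 1 : ℂ)) ∨ (K τ ν 2 ≠ 0 ∧ p = (halfValue τ 2 : ℂ)) ∨
      (K τ ν 3 ≠ 0 ∧ p = (halfValue τ 3 : ℂ)) := by
    rw [← polePoint_zero τ, ← polePoint_of_ne τ (ρ := 1) (by decide),
      ← polePoint_of_ne τ (ρ := 2) (by decide), ← polePoint_of_ne τ (ρ := 3) (by decide)]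
    constructor
    · rintro ⟨ρ, hρ⟩
      fin_cases ρ
      · exact Or.inl hρ
      · exact Or.inr (Or.inl hρ)
      · exact Or.inr (Or.inr (Or.inl hρ))
      · exact Or.inr (Or.inr (Or.inr hρ))
    · rintro (h | h | h | h)
      exacts [⟨0, h⟩, ⟨1, h⟩, ⟨2, h⟩, ⟨3, h⟩]
  rw [hp]
  induction p using OnePoint.rec with
  | infty =>
    have := curveRat_order_infty (halfValue_12 τ) (halfValue_13 τ) (halfValue_23 τ) (K τ ν) E
    simpa [spectralRat] using this
  | coe x =>
    have := curveRat_order_coe (halfValue_12 τ) (halfValue_13 τ) (halfValue_23 τ) (K τ ν) E x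
    simpa [spectralRat, and_comm] using this

theorem spectralRat_ncard {ν : Fin 4 → ℂ} (hK : ∀ ρ, K τ ν ρ ≠ 0) (E : ℂ) :
    {p | ratOrder (spectralRat τ ν E) p = -1}.ncard = 4 := by
  have : {p | ratOrder (spectralRat τ ν E) p = -1} = Set.range (polePoint τ) := by
    ext p
    have h := spectralRat_order τ ν E p
    simp only [hK, ne_eq, not_false_eq_true, true_and] at h
    have h' : p ∈ Set.range (polePoint τ) ↔ ∃ ρ, p = polePoint τ ρ := by
      simp [eq_comm]
    rw [h', ← h.1, Set.mem_ofPred_eq]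
    have := h.2
    lia
  rw [this, ← Set.image_univ, Set.ncard_image_of_injective _ (polePoint_injective τ),
    Set.ncard_univ, Nat.card_eq_fintype_card, Fintype.card_fin]

/-! ### The equation of the spectral curve -/

theorem two_mul_hamiltonian {g ν : Fin 4 → ℂ} (hg : ∀ α, ν α ^ 2 = -2 * g α ^ 2) (v u : ℂ) :
    2 * hamiltonian τ g v u = v ^ 2 - ∑ α, ν α ^ 2 * (torus τ).weierstrassP (u + ω τ α) := by
  simp only [hamiltonian, hg, Fin.sum_univ_four]
  ring

theorem mem_spectralCurve {g ν : Fin 4 → ℂ} (hg : ∀ α, ν α ^ 2 = -2 * g α ^ 2) {v u : ℂ}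
    (hu : 2 * u ∉ (torus τ).lattice) {z : ℂ} (hz : z ∉ (torus τ).lattice) (l : ℂ) :
    (z, l) ∈ spectralCurve τ (laxL τ ν v u) ↔
      l ^ 2 = 2 * hamiltonian τ g v u
        + ∑ ρ, K τ ν ρ * (doubledTorus τ).weierstrassP (z - 2 * ω τ ρ) := by
  have h1 := offDiag_mul τ ν hu hz
  rw [two_mul_hamiltonian τ hg]
  simp only [spectralCurve, Set.mem_ofPred_eq, hz, not_false_eq_true, true_and, laxL_eq,
    Matrix.det_fin_two, Matrix.add_apply, Matrix.smul_apply, Matrix.one_apply, Matrix.of_apply,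
    Matrix.cons_val_zero, Matrix.cons_val_one, smul_eq_mul]
  simp
  rw [h1, ← sub_eq_zero (a := l ^ 2)]
  refine Eq.congr ?_ rfl
  ring

theorem sum_K_mul_wp (ν : Fin 4 → ℂ) (E : ℂ) {z : ℂ} (hz : z ∉ (torus τ).lattice) :
    (curveNum (halfValue τ 1) (halfValue τ 2) (halfValue τ 3) (K τ ν) E).eval
        ((doubledTorus τ).weierstrassP z) =
      (cubic (halfValue τ 1) (halfValue τ 2) (halfValue τ 3)).eval
        ((doubledTorus τ).weierstrassP z) *
      (2 * E + ∑ ρ, K τ ν ρ * (doubledTorus τ).weierstrassP (z - 2 * ω τ ρ)) := by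
  rw [Fin.sum_univ_four, two_ω_zero, sub_zero, wp_shift_one τ hz, wp_shift_two τ hz,
    wp_shift_three τ hz]
  exact curveNum_eval (K τ ν) E (wp_doubled_ne_halfValue τ hz (by decide))
    (wp_doubled_ne_halfValue τ hz (by decide)) (wp_doubled_ne_halfValue τ hz (by decide))

theorem cubic_eval_wp_ne_zero {z : ℂ} (hz : z ∉ (torus τ).lattice) :
    (cubic (halfValue τ 1) (halfValue τ 2) (halfValue τ 3)).eval
      ((doubledTorus τ).weierstrassP z) ≠ 0 := by
  rw [cubic_eval]
  exact mul_ne_zero (mul_ne_zero (sub_ne_zero.2 (wp_doubled_ne_halfValue τ hz (by decide)))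
    (sub_ne_zero.2 (wp_doubled_ne_halfValue τ hz (by decide))))
    (sub_ne_zero.2 (wp_doubled_ne_halfValue τ hz (by decide)))

theorem mem_spectralCurve_rat {g ν : Fin 4 → ℂ} (hg : ∀ α, ν α ^ 2 = -2 * g α ^ 2) {v u : ℂ}
    (hu : 2 * u ∉ (torus τ).lattice) {z : ℂ} (hz : z ∉ (torus τ).lattice) (l : ℂ) :
    (z, l) ∈ spectralCurve τ (laxL τ ν v u) ↔
      l ^ 2 = (spectralRat τ ν (hamiltonian τ g v u)).eval (RingHom.id ℂ)
        ((doubledTorus τ).weierstrassP z) := by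
  have h := cubic_eval_wp_ne_zero τ hz
  rw [mem_spectralCurve τ hg hu hz, spectralRat, curveRat, ratFunc_eval_div h,
    sum_K_mul_wp τ ν _ hz, mul_div_cancel_left₀ _ h]

end

section
variable (τ : UpperHalfPlane)

/-! ### The Lax equation -/

/-- The upper right entry of the second matrix of the Lax pair. The lower left one arises from it
by `u ↦ -u`. -/
noncomputable def offDiag' (ν : Fin 4 → ℂ) (u z : ℂ) : ℂ := ∑ α, ν α * phiα' τ α z (ω τ α + u)

theorem laxM_eq (ν : Fin 4 → ℂ) (u z : ℂ) :
    laxM τ ν u z = !![0, offDiag' τ ν u z; offDiag' τ ν (-u) z, 0] := by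
  simp only [laxM, offDiag', sub_eq_add_neg]

theorem hasDerivAt_phiα (α : Fin 4) {z w : ℂ} (hw : w ∉ (torus τ).lattice) :
    HasDerivAt (fun y => phiα τ α z y) (e (z * dω α) * (deriv (theta τ) 0 / theta τ z *
      ((deriv (theta τ) (w + z) * theta τ w - theta τ (w + z) * deriv (theta τ) w)
        / theta τ w ^ 2))) w := by
  rw [← theta_eq_zero_iff] at hw
  have h1 : HasDerivAt (fun y => theta τ (y + z)) (deriv (theta τ) (w + z)) w :=
    (differentiable_theta τ (w + z)).hasDerivAt.comp_add_const w z
  have h2 := (differentiable_theta τ w).hasDerivAt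
  have h3 := ((h1.fun_div h2 hw).const_mul (deriv (theta τ) 0 / theta τ z)).const_mul (e (z * dω α))
  refine h3.congr_of_eventuallyEq (Eventually.of_forall fun y => ?_)
  simp only [phiα, phi, div_eq_mul_inv, mul_inv]
  ring

theorem phiα'_eq (α : Fin 4) {z w : ℂ} (hw : w ∉ (torus τ).lattice) :
    phiα' τ α z w = e (z * dω α) * (deriv (theta τ) 0 / theta τ z *
      ((deriv (theta τ) (w + z) * theta τ w - theta τ (w + z) * deriv (theta τ) w)
        / theta τ w ^ 2)) := (hasDerivAt_phiα τ α hw).deriv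

theorem hasDerivAt_offDiag (ν : Fin 4 → ℂ) {u : ℂ} (hu : 2 * u ∉ (torus τ).lattice) (z : ℂ) :
    HasDerivAt (fun x => offDiag τ ν x z) (offDiag' τ ν u z) u := by
  refine HasDerivAt.fun_sum fun α _ => HasDerivAt.const_mul (ν α) ?_
  have h := hasDerivAt_phiα τ α (z := z) (ω_add_notMem τ hu α)
  rw [← phiα'_eq τ α (ω_add_notMem τ hu α)] at h
  exact h.comp_const_add (ω τ α) u

theorem hasDerivAt_offDiag_neg (ν : Fin 4 → ℂ) {u : ℂ} (hu : 2 * u ∉ (torus τ).lattice) (z : ℂ) :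
    HasDerivAt (fun x => offDiag τ ν (-x) z) (-offDiag' τ ν (-u) z) u := by
  have h := (hasDerivAt_offDiag τ ν (u := -u) (by rwa [mul_neg, neg_mem_iff]) z).comp u
    (hasDerivAt_neg u)
  rw [mul_neg_one] at h
  exact h

theorem eventually_two_mul_notMem {u : ℂ} (hu : 2 * u ∉ (torus τ).lattice) :
    ∀ᶠ x in 𝓝 u, 2 * x ∉ (torus τ).lattice := by
  have h1 : Tendsto (fun x : ℂ => 2 * x) (𝓝 u) (𝓝 (2 * u)) := (by fun_prop : Continuous
    (fun x : ℂ => 2 * x)).tendsto u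
  exact h1.eventually ((torus τ).isClosed_lattice.isOpen_compl.mem_nhds hu)

theorem hasDerivAt_sum_wp (k : Fin 4 → ℂ) {u : ℂ} (hu : 2 * u ∉ (torus τ).lattice) :
    HasDerivAt (fun x => ∑ α, k α * (torus τ).weierstrassP (x + ω τ α))
      (∑ α, k α * (torus τ).derivWeierstrassP (u + ω τ α)) u := by
  refine HasDerivAt.fun_sum fun α _ => HasDerivAt.const_mul (k α) ?_
  have h := ω_add_notMem τ hu α
  rw [add_comm] at h
  have h1 := (analyticAt_wp h).differentiableAt.hasDerivAt
  rw [PeriodPair.deriv_weierstrassP] at h1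
  exact h1.comp_add_const u (ω τ α)

/-- The derivative in `u` of `offDiag_mul`; the sum with the `K_ρ` does not depend on `u`. -/
theorem offDiag_commutator (ν : Fin 4 → ℂ) {u z : ℂ} (hu : 2 * u ∉ (torus τ).lattice)
    (hz : z ∉ (torus τ).lattice) :
    offDiag τ ν u z * offDiag' τ ν (-u) z - offDiag' τ ν u z * offDiag τ ν (-u) z =
      ∑ α, ν α ^ 2 * (torus τ).derivWeierstrassP (u + ω τ α) := by
  have h1 := (hasDerivAt_offDiag τ ν hu z).fun_mul (hasDerivAt_offDiag_neg τ ν hu z)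
  have h2 := (hasDerivAt_sum_wp τ (fun α => ν α ^ 2) hu).const_sub
    (∑ ρ, K τ ν ρ * (doubledTorus τ).weierstrassP (z - 2 * ω τ ρ))
  have h3 := h1.unique (h2.congr_of_eventuallyEq (by
    filter_upwards [eventually_two_mul_notMem τ hu] with x hx
    exact offDiag_mul τ ν hx hz))
  linear_combination -h3

/-- Differentiating the multiplier `e(-nu)` in `u` adds a multiple of the undifferentiated function;
`exists_offDiag'_ne_zero` exploits this term. -/
theorem offDiag'_add_period (ν : Fin 4 → ℂ) (m n : ℤ) {u : ℂ} (hu : 2 * u ∉ (torus τ).lattice)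
    (z : ℂ) :
    offDiag' τ ν u (z + (m + n * τ)) =
      e (-n * u) * (offDiag' τ (fun α => periodSign m n α * ν α) u z -
        2 * Real.pi * Complex.I * n * offDiag τ (fun α => periodSign m n α * ν α) u z) := by
  have h1 := hasDerivAt_offDiag τ ν hu (z + (m + n * τ))
  simp only [offDiag_add_period] at h1
  have h2 : HasDerivAt (fun x : ℂ => e (-n * x)) (2 * Real.pi * Complex.I * e (-n * u) * -n) u := by
    have := (hasDerivAt_e (-n * u)).comp u ((hasDerivAt_id u).const_mul (-n : ℂ))
    rw [mul_one] at this
    exact this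
  have h3 := h2.fun_mul (hasDerivAt_offDiag τ (fun α => periodSign m n α * ν α) hu z)
  rw [h1.unique h3]
  ring

/-- The numerator `ϑ'(w + z) ϑ(w) - ϑ(w + z) ϑ'(w)` vanishes at `z = 0`; equivalently, the residue
`∑ ν_α` of `offDiag` does not depend on `u`. -/
theorem tendsto_mul_offDiag' (ν : Fin 4 → ℂ) {u : ℂ} (hu : 2 * u ∉ (torus τ).lattice) :
    Tendsto (fun z => z * offDiag' τ ν u z) (𝓝[≠] 0) (𝓝 0) := by
  have h : ContinuousAt (fun z => ∑ α, ν α * (e (z * dω α) * (deriv (theta τ) 0 /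
      dslope (theta τ) 0 z * ((deriv (theta τ) (ω τ α + u + z) * theta τ (ω τ α + u) -
        theta τ (ω τ α + u + z) * deriv (theta τ) (ω τ α + u)) / theta τ (ω τ α + u) ^ 2)))) 0 := by
    have h1 := (analyticAt_dslope_theta τ 0 0).continuousAt
    have h2 := dslope_theta_zero_ne τ
    have h3 := differentiable_e.continuous
    have h4 := (differentiable_theta τ).continuous
    have h5 : Continuous (deriv (theta τ)) := continuous_iff_continuousAt.2 fun z =>
      (analyticAt_theta τ z).deriv.continuousAt
    have h6 : ContinuousAt (fun z => deriv (theta τ) 0 / dslope (theta τ) 0 z) 0 :=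
      continuousAt_const.div h1 h2
    fun_prop
  have h0 := h.tendsto.mono_left (nhdsWithin_le_nhds (s := {0}ᶜ))
  rw [Finset.sum_eq_zero fun α _ => by rw [add_zero]; ring] at h0
  refine h0.congr' ?_
  filter_upwards [self_mem_nhdsWithin] with z hz
  have hz' : z ≠ 0 := hz
  rw [offDiag', Finset.mul_sum]
  refine Finset.sum_congr rfl fun α _ => ?_
  rw [phiα'_eq τ α (ω_add_notMem τ hu α), theta_eq_mul_dslope τ (zero_mem _) z, sub_zero]
  field_simp

/-- If `offDiag'` vanished, its transformation law under a period with `n ≠ 0` would make the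
twisted `offDiag` a multiple of the twisted `offDiag'`. Near `0` the latter has no pole, while the
former has residue `∑ I_{ρα} ν_α`. So the sign transform of `ν`, hence `ν`, would be zero. -/
theorem exists_offDiag'_ne_zero {ν : Fin 4 → ℂ} (hν : ν ≠ 0) {u : ℂ}
    (hu : 2 * u ∉ (torus τ).lattice) : ∃ z ∉ (torus τ).lattice, offDiag' τ ν u z ≠ 0 := by
  by_contra! h
  refine hν (eq_zero_of_signMatrix τ fun ρ => ?_)
  -- Adding `2` keeps the class of the period modulo `2Λ` and makes `n` nonzero also for `nω ρ = 0`.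
  set n : ℤ := nω ρ + 2
  have hn : (n : ℂ) ≠ 0 := by
    have : n ≠ 0 := by fin_cases ρ <;> simp [n, nω]
    exact_mod_cast this
  have hl : (mω ρ : ℂ) + n * τ ∈ (torus τ).lattice := mem_torus.2 ⟨_, _, rfl⟩
  have h1 : ∀ z ∉ (torus τ).lattice, offDiag τ (fun α => periodSign (mω ρ) n α * ν α) u z =
      (2 * Real.pi * Complex.I * n)⁻¹ *
        offDiag' τ (fun α => periodSign (mω ρ) n α * ν α) u z := by
    intro z hz
    have h2 := offDiag'_add_period τ ν (mω ρ) n hu z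
    rw [h _ (fun h' => hz ((add_mem_cancel_right hl).1 h')), eq_comm, mul_eq_zero] at h2
    have h3 := sub_eq_zero.1 (h2.resolve_left (e_ne_zero _))
    rw [h3, inv_mul_cancel_left₀]
    simp [hn, Real.pi_ne_zero, Complex.I_ne_zero]
  have h2 := (tendsto_mul_offDiag' τ (fun α => periodSign (mω ρ) n α * ν α) hu).const_mul
    (2 * Real.pi * Complex.I * n)⁻¹
  rw [mul_zero] at h2
  have h3 := tendsto_nhds_unique
    (tendsto_mul_offDiag_zero τ (fun α => periodSign (mω ρ) n α * ν α) hu) (h2.congr' (by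
      filter_upwards [eventually_notMem (torus τ) 0] with z hz
      rw [h1 z hz]
      ring))
  rw [← h3]
  refine Finset.sum_congr rfl fun α _ => ?_
  rw [periodSign_eq_of_mem τ (ρ := ρ)]
  rw [two_mul_ω, show (mω ρ : ℂ) + n * τ - (mω ρ + nω ρ * τ) = ((0 : ℤ) : ℂ) + ((2 : ℤ) : ℂ) * τ by
    simp only [n]; push_cast; ring, int_comb_mem_doubled]
  simp

theorem hasDerivAt_comp_real {f : ℂ → ℂ} {f' : ℂ} {u : ℝ → ℂ} {u' : ℂ} {t : ℝ}
    (hf : HasDerivAt f f' (u t)) (hu : HasDerivAt u u' t) :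
    HasDerivAt (fun s => f (u s)) (u' * f') t := hf.scomp t hu

theorem deriv_hamiltonian_fst (g : Fin 4 → ℂ) (v u : ℂ) :
    deriv (fun y => hamiltonian τ g y u) v = v := by
  have h : HasDerivAt (fun y : ℂ => y ^ 2 / 2 + ∑ α, g α ^ 2 * (torus τ).weierstrassP (u + ω τ α))
      (2 * v / 2) v := by
    have := ((hasDerivAt_pow 2 v).div_const 2).add_const
      (∑ α, g α ^ 2 * (torus τ).weierstrassP (u + ω τ α))
    simpa using this
  have := h.deriv
  rw [mul_div_cancel_left₀ _ two_ne_zero] at this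
  exact this

theorem deriv_hamiltonian_snd {g ν : Fin 4 → ℂ} (hg : ∀ α, ν α ^ 2 = -2 * g α ^ 2) (v : ℂ) {u : ℂ}
    (hu : 2 * u ∉ (torus τ).lattice) :
    -deriv (fun x => hamiltonian τ g v x) u =
      1 / 2 * ∑ α, ν α ^ 2 * (torus τ).derivWeierstrassP (u + ω τ α) := by
  have h := ((hasDerivAt_sum_wp τ (fun α => g α ^ 2) hu).const_add (v ^ 2 / 2)).deriv
  have h1 : deriv (fun x => hamiltonian τ g v x) u =
    ∑ α, g α ^ 2 * (torus τ).derivWeierstrassP (u + ω τ α) := h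
  rw [h1]
  simp only [hg, Fin.sum_univ_four]
  ring

theorem laxRepresentation {g ν : Fin 4 → ℂ} (hg : ∀ α, ν α ^ 2 = -2 * g α ^ 2) :
    LaxRepresentation τ g ν := by
  intro v u t hu
  have hcomm : ∀ z ∉ (torus τ).lattice,
      (1 / 2 : ℂ) * (laxL τ ν (v t) (u t) z * laxM τ ν (u t) z
        - laxM τ ν (u t) z * laxL τ ν (v t) (u t) z) 0 0 =
      -deriv (fun x => hamiltonian τ g (v t) x) (u t) := by
    intro z hz
    rw [deriv_hamiltonian_snd τ hg (v t) hu, ← offDiag_commutator τ ν hu hz, laxL_eq, laxM_eq]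
    simp
  have hcomm01 : ∀ z, (1 / 2 : ℂ) * (laxL τ ν (v t) (u t) z * laxM τ ν (u t) z
        - laxM τ ν (u t) z * laxL τ ν (v t) (u t) z) 0 1 = v t * offDiag' τ ν (u t) z := by
    intro z
    rw [laxL_eq, laxM_eq]
    simp
    ring
  constructor
  · rintro ⟨h1, h2⟩ z hz i j
    rw [deriv_hamiltonian_fst] at h1
    fin_cases i <;> fin_cases j
    · have := hcomm z hz
      simp only [Fin.zero_eta, this]
      simpa [laxL_eq] using h2
    · have := hcomm01 z
      simp only [Fin.zero_eta, Fin.mk_one, this]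
      simpa [laxL_eq] using hasDerivAt_comp_real (hasDerivAt_offDiag τ ν hu z) h1
    · have := hasDerivAt_comp_real (hasDerivAt_offDiag_neg τ ν hu z) h1
      simp only [Fin.zero_eta, Fin.mk_one, laxL_eq, laxM_eq]
      simp
      convert this using 1
      ring
    · have h3 := hcomm z hz
      have : (1 / 2 : ℂ) * (laxL τ ν (v t) (u t) z * laxM τ ν (u t) z
        - laxM τ ν (u t) z * laxL τ ν (v t) (u t) z) 1 1 =
          - -deriv (fun x => hamiltonian τ g (v t) x) (u t) := by
        rw [← h3, laxL_eq, laxM_eq]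
        simp
        ring
      simp only [Fin.mk_one, this]
      have h5 := h2.fun_neg
      simpa [laxL_eq] using h5
  · intro hν hd h
    -- At such a `z` the upper right entry reads `u̇ · offDiag' = v · offDiag'`, which can be
    -- divided; the diagonal entry is the equation for `v̇`.
    obtain ⟨z, hz, hne⟩ := exists_offDiag'_ne_zero τ hν hu
    have h00 := h z hz 0 0
    have h01 := h z hz 0 1
    rw [hcomm z hz] at h00
    rw [hcomm01] at h01
    simp only [laxL_eq] at h00 h01
    simp at h01
    have h3 := hasDerivAt_comp_real (hasDerivAt_offDiag τ ν hu z) hd.hasDerivAt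
    have h4 := mul_right_cancel₀ hne (h3.unique h01)
    refine ⟨?_, ?_⟩
    · rw [deriv_hamiltonian_fst, ← h4]
      exact hd.hasDerivAt
    · simpa using h00

end

/-! ### The quotient of the spectral curve by the involution -/

theorem squarefree_iff_no_common_root {P : ℂ[X]} :
    Squarefree P ↔ ∀ x : ℂ, P.eval x = 0 → P.derivative.eval x ≠ 0 := by
  rw [← PerfectField.separable_iff_squarefree, Polynomial.Separable,
    Polynomial.isCoprime_iff_aeval_ne_zero_of_isAlgClosed ℂ ℂ]
  simp only [coe_aeval_eq_eval]
  exact forall_congr' fun x => by tauto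

/-- A multiple root `x` of `Q + sD` is a zero of the Wronskian `Q'D - QD'`, and `x` determines `s`.
If the Wronskian vanishes identically, then `D ∣ Q` because `D` is prime to `D'`, so `Q = rD` and
only `s = -r` is bad. -/
theorem finite_not_squarefree_pencil (Q : ℂ[X]) {D : ℂ[X]} (hD : Squarefree D) :
    {s : ℂ | ¬ Squarefree (Q + C s * D)}.Finite := by
  have hD' := squarefree_iff_no_common_root.1 hD
  by_cases hW : derivative Q * D - Q * derivative D = 0
  · have hdvd : D ∣ Q := (PerfectField.separable_iff_squarefree.2 hD).dvd_of_dvd_mul_right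
      ⟨derivative Q, by linear_combination -hW⟩
    obtain ⟨R, rfl⟩ := hdvd
    have hR : derivative R = 0 := by
      have : D ^ 2 * derivative R = 0 := by
        rw [← hW, derivative_mul]; ring
      simpa [hD.ne_zero] using this
    obtain ⟨r, rfl⟩ : ∃ r, R = C r := ⟨_, eq_C_of_derivative_eq_zero hR⟩
    refine (Set.finite_singleton (-r)).subset fun s hs => ?_
    by_contra hne
    refine hs ?_
    rw [mul_comm, ← add_mul, ← C_add]
    have hu : IsUnit (C (r + s) : ℂ[X]) :=
      isUnit_C.2 (isUnit_iff_ne_zero.2 fun h => hne (by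
        rw [Set.mem_singleton_iff]; linear_combination h))
    exact (associated_unit_mul_left D _ hu).squarefree_iff.2 hD
  · refine ((derivative Q * D - Q * derivative D).roots.toFinset.finite_toSet.image fun x =>
      -- Where `D` vanishes, `s` is recovered from the derivative; there `D' ≠ 0` because `D` is
      -- squarefree.
      if D.eval x = 0 then -(derivative Q).eval x / (derivative D).eval x
        else -Q.eval x / D.eval x).subset fun s hs => ?_
    simp only [Set.mem_ofPred_eq, squarefree_iff_no_common_root, not_forall, not_not] at hs
    obtain ⟨x, h1, h2⟩ := hs
    simp only [eval_add, eval_mul, eval_C, derivative_add, derivative_mul, derivative_C,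
      zero_mul, zero_add] at h1 h2
    refine ⟨x, ?_, ?_⟩
    · rw [Finset.mem_coe, Multiset.mem_toFinset, mem_roots hW, IsRoot.def]
      simp only [eval_sub, eval_mul]
      linear_combination (eval x D) * h2 - (eval x (derivative D)) * h1
    · beta_reduce
      split_ifs with h
      · rw [div_eq_iff (hD' x h)]
        linear_combination -h2
      · rw [div_eq_iff h]
        linear_combination -h1

theorem ratOrder_polynomial_coe {P : ℂ[X]} (hP : P ≠ 0) (a : ℂ) :
    ratOrder (algebraMap ℂ[X] (RatFunc ℂ) P) (a : OnePoint ℂ) = P.rootMultiplicity a := by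
  have := ratOrder_div_coe hP one_ne_zero a
  rwa [map_one, div_one, rootMultiplicity_eq_zero (p := 1) (by simp), Nat.cast_zero,
    sub_zero] at this

theorem ratOrder_polynomial_infty (P : ℂ[X]) :
    ratOrder (algebraMap ℂ[X] (RatFunc ℂ) P) OnePoint.infty = -(P.natDegree : ℤ) := by
  rw [ratOrder_infty, RatFunc.intDegree_polynomial]

theorem Squarefree.card_roots_toFinset {P : ℂ[X]} (hP : Squarefree P) :
    P.roots.toFinset.card = P.natDegree := by
  rw [Multiset.toFinset_card_of_nodup
    (nodup_roots (PerfectField.separable_iff_squarefree.2 hP)),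
    splits_iff_card_roots.1 (IsAlgClosed.splits P)]

theorem odd_ratOrder_coe_iff {P : ℂ[X]} (hP : Squarefree P) (a : ℂ) :
    Odd (ratOrder (algebraMap ℂ[X] (RatFunc ℂ) P) (a : OnePoint ℂ)) ↔ P.IsRoot a := by
  rw [ratOrder_polynomial_coe hP.ne_zero]
  constructor
  · intro h
    by_contra hr
    rw [rootMultiplicity_eq_zero hr] at h
    simp at h
  · intro h
    have h1 := (rootMultiplicity_pos hP.ne_zero).2 h
    have h2 := rootMultiplicity_le_one_of_separable
      (PerfectField.separable_iff_squarefree.2 hP) a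
    rw [show P.rootMultiplicity a = 1 by omega]
    simp

/-- The roots are simple, hence of odd order. In degree `3` the point `∞` has the odd order `-3` and
supplies the fourth branch point; in degree `4` it has even order. -/
theorem branchPoints_ncard {P : ℂ[X]} (hP : Squarefree P)
    (hd : P.natDegree = 3 ∨ P.natDegree = 4) : (branchPoints P).ncard = 4 := by
  have hcard : ((fun a : ℂ => (a : OnePoint ℂ)) '' (P.roots.toFinset : Set ℂ)).ncard =
      P.natDegree := by
    rw [Set.ncard_image_of_injective _ OnePoint.coe_injective, Set.ncard_coe_finset,
      Squarefree.card_roots_toFinset hP]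
  have hmem (a : ℂ) : a ∈ (P.roots.toFinset : Set ℂ) ↔ P.IsRoot a := by
    simp [hP.ne_zero]
  have hinf : OnePoint.infty ∉ (fun a : ℂ => (a : OnePoint ℂ)) '' (P.roots.toFinset : Set ℂ) := by
    rintro ⟨a, -, h⟩
    exact OnePoint.coe_ne_infty a h
  rcases hd with hd | hd
  · have : branchPoints P = insert OnePoint.infty
        ((fun a : ℂ => (a : OnePoint ℂ)) '' (P.roots.toFinset : Set ℂ)) := by
      ext p
      rw [branchPoints, Set.mem_ofPred_eq, Set.mem_insert_iff]
      induction p using OnePoint.rec with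
      | infty =>
        rw [ratOrder_polynomial_infty, hd]
        simp
        decide
      | coe a =>
        rw [odd_ratOrder_coe_iff hP, ← hmem]
        simp
    rw [this, Set.ncard_insert_of_notMem hinf, hcard, hd]
  · have : branchPoints P = (fun a : ℂ => (a : OnePoint ℂ)) '' (P.roots.toFinset : Set ℂ) := by
      ext p
      rw [branchPoints, Set.mem_ofPred_eq]
      induction p using OnePoint.rec with
      | infty =>
        rw [ratOrder_polynomial_infty, hd, iff_false_right hinf]
        decide
      | coe a =>
        rw [odd_ratOrder_coe_iff hP, ← hmem]
        simp
    rw [this, hcard, hd]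

theorem not_isSquare_of_squarefree {P : ℂ[X]} (hP : Squarefree P) (hd : P.natDegree ≠ 0) :
    ¬ IsSquare P := by
  rintro ⟨Q, rfl⟩
  have := (hP Q dvd_rfl)
  exact hd (natDegree_eq_zero_of_isUnit (this.mul this))

/-- A monic quadratic without a root is irreducible over a domain, and a root would be a square root
of `P`. -/
theorem isDomain_coordRing {P : ℂ[X]} (hP : Squarefree P) (hd : P.natDegree ≠ 0) :
    IsDomain (CoordRing P) := by
  have hm : ((X : ℂ[X][X]) ^ 2 - C P).Monic := monic_X_pow_sub_C P two_ne_zero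
  have hdeg : ((X : ℂ[X][X]) ^ 2 - C P).natDegree = 2 := natDegree_X_pow_sub_C
  have hirr : Irreducible ((X : ℂ[X][X]) ^ 2 - C P) := by
    rw [hm.irreducible_iff_roots_eq_zero_of_degree_le_three (by rw [hdeg]) (by rw [hdeg]; norm_num),
      Multiset.eq_zero_iff_forall_notMem]
    intro Q hQ
    have := isRoot_of_mem_roots hQ
    simp only [IsRoot.def, eval_sub, eval_pow, eval_X, eval_C] at this
    exact not_isSquare_of_squarefree hP hd ⟨Q, by linear_combination -this⟩
  exact AdjoinRoot.isDomain_of_prime hirr.prime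

theorem curveNum_eq_pencil (a b c : ℂ) (k : Fin 4 → ℂ) (E : ℂ) :
    curveNum a b c k E = curveNum a b c k 0 + C (2 * E) * cubic a b c := by
  simp only [curveNum, mul_zero, zero_add, C_add, C_mul]
  ring

theorem squarefree_cubic {a b c : ℂ} (hab : a - b ≠ 0) (hac : a - c ≠ 0) (hbc : b - c ≠ 0) :
    Squarefree (cubic a b c) := by
  rw [squarefree_iff_no_common_root]
  intro x hx
  have hd : (derivative (cubic a b c)).eval x =
      (x - b) * (x - c) + (x - a) * (x - c) + (x - a) * (x - b) := by
    simp [cubic, derivative_mul]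
    ring
  rw [cubic_eval, mul_eq_zero, mul_eq_zero] at hx
  rw [hd]
  rcases hx with (h | h) | h
  · obtain rfl : x = a := sub_eq_zero.1 h
    simp [hab, hac]
  · obtain rfl : x = b := sub_eq_zero.1 h
    simpa [hbc] using fun h => hab (by linear_combination -h)
  · obtain rfl : x = c := sub_eq_zero.1 h
    simpa using ⟨fun h => hac (by linear_combination -h), fun h => hbc (by linear_combination -h)⟩

/-! ### The curve `y² = 4 N_E(x)` as the quotient of the spectral curve -/

section
variable (τ : UpperHalfPlane)

/-- The polynomial `4 N_E` with `N_E` the numerator of `spectralRat τ ν E`. -/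
noncomputable def curvePoly (ν : Fin 4 → ℂ) (E : ℂ) : ℂ[X] :=
  C 4 * curveNum (halfValue τ 1) (halfValue τ 2) (halfValue τ 3) (K τ ν) E

theorem finite_not_squarefree_curvePoly (ν : Fin 4 → ℂ) :
    {E : ℂ | ¬ Squarefree (curvePoly τ ν E)}.Finite := by
  have h := finite_not_squarefree_pencil
    (curveNum (halfValue τ 1) (halfValue τ 2) (halfValue τ 3) (K τ ν) 0)
    (squarefree_cubic (halfValue_12 τ) (halfValue_13 τ) (halfValue_23 τ))
  refine (h.preimage (f := fun E : ℂ => 2 * E)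
    (mul_right_injective₀ two_ne_zero).injOn).subset fun E hE => ?_
  simp only [Set.mem_preimage, Set.mem_ofPred_eq] at hE ⊢
  rw [← curveNum_eq_pencil]
  intro hs
  refine hE ?_
  rw [curvePoly]
  exact (associated_unit_mul_left _ _ 
    (isUnit_C.2 (isUnit_iff_ne_zero.2 (by norm_num)))).squarefree_iff.2 hs

/-- If `K_0 = 0`, the coefficient of `X³` is a nonconstant affine function of `E`, and `E₀` is its
zero. If `K_0 ≠ 0`, the degree is always `4` and `E₀ = 0` is a dummy. -/
theorem curvePoly_natDegree (ν : Fin 4 → ℂ) : ∃ E₀ : ℂ, ∀ E ≠ E₀,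
    (curvePoly τ ν E).natDegree = 3 ∨ (curvePoly τ ν E).natDegree = 4 := by
  have h (E : ℂ) : (curvePoly τ ν E).natDegree =
      (curveNum (halfValue τ 1) (halfValue τ 2) (halfValue τ 3) (K τ ν) E).natDegree :=
    natDegree_C_mul (by norm_num)
  by_cases hk : K τ ν 0 = 0
  · refine ⟨-(K τ ν 1 * halfValue τ 1 + K τ ν 2 * halfValue τ 2 + K τ ν 3 * halfValue τ 3) / 2,
      fun E hE => Or.inl ?_⟩
    rw [h]
    refine natDegree_eq_of_le_of_coeff_ne_zero (curveNum_natDegree_le_three hk E) ?_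
    rw [curveNum_coeff_three hk]
    intro h0
    refine hE ?_
    linear_combination h0 / 2
  · exact ⟨0, fun E _ => Or.inr ((h E).trans (curveNum_natDegree_of_ne hk E))⟩

theorem curvePoly_eval_wp (ν : Fin 4 → ℂ) (E : ℂ) {z : ℂ} (hz : z ∉ (torus τ).lattice) :
    (curvePoly τ ν E).eval ((doubledTorus τ).weierstrassP z) =
      (doubledTorus τ).derivWeierstrassP z ^ 2 *
        (2 * E + ∑ ρ, K τ ν ρ * (doubledTorus τ).weierstrassP (z - 2 * ω τ ρ)) := by
  rw [derivWp_sq τ (fun h => hz (doubledTorus_le τ h)), curvePoly, eval_mul, sum_K_mul_wp τ ν E hz,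
    cubic_eval, eval_C]
  ring

/-- Outside `Λ` the value `℘'(z, 2τ)` is nonzero, so `λ` and `y` determine each other for given `z`.
The fibres of `℘` are the orbits of `z ↦ ±z + 2Λ`, and `℘'` is odd, which matches the sign of `λ`.
Surjectivity of `℘` gives the image. -/
theorem isQuotientCurve {g ν : Fin 4 → ℂ} (hg : ∀ α, ν α ^ 2 = -2 * g α ^ 2) {v u : ℂ}
    (hu : 2 * u ∉ (torus τ).lattice) :
    IsQuotientCurve τ (spectralCurve τ (laxL τ ν v u))
      (curvePoly τ ν (hamiltonian τ g v u)) := by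
  have key (z l : ℂ) (hz : z ∉ (torus τ).lattice) :
      (z, l) ∈ spectralCurve τ (laxL τ ν v u) ↔
        (l * (doubledTorus τ).derivWeierstrassP z) ^ 2 =
          (curvePoly τ ν (hamiltonian τ g v u)).eval ((doubledTorus τ).weierstrassP z) := by
    rw [mem_spectralCurve τ hg hu hz, curvePoly_eval_wp τ ν _ hz, mul_pow, mul_comm (l ^ 2)]
    exact (mul_right_injective₀ (pow_ne_zero 2 (derivWp_ne_zero τ hz))).eq_iff.symm
  have equiv_lattice (p q : ℂ × ℂ) (h : SpectralEquiv τ p q) (hp : p.1 ∉ (torus τ).lattice) :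
      q.1 ∉ (torus τ).lattice := by
    rcases h with ⟨h, -⟩ | ⟨h, -⟩ <;> intro hq <;> apply hp
    · have := sub_mem hq (doubledTorus_le τ h)
      simpa using this
    · have := sub_mem (doubledTorus_le τ h) hq
      simpa using this
  have equiv_map (p q : ℂ × ℂ) (h : SpectralEquiv τ p q) : quotientMap τ p = quotientMap τ q := by
    rcases h with ⟨h, h2⟩ | ⟨h, h2⟩
    · have h1 : q.1 = p.1 + (⟨q.1 - p.1, h⟩ : (doubledTorus τ).lattice) := by simp
      rw [quotientMap, quotientMap, h2, h1, PeriodPair.weierstrassP_add_coe,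
        PeriodPair.derivWeierstrassP_add_coe]
    · have h1 : q.1 = -p.1 + (⟨q.1 + p.1, h⟩ : (doubledTorus τ).lattice) := by simp
      rw [quotientMap, quotientMap, h2, h1, PeriodPair.weierstrassP_add_coe,
        PeriodPair.derivWeierstrassP_add_coe, PeriodPair.weierstrassP_neg,
        PeriodPair.derivWeierstrassP_neg, neg_mul_neg]
  refine ⟨?_, ?_, ?_⟩
  · intro p hp q h
    have hpl := hp.1
    have hql := equiv_lattice p q h hpl
    rw [← Prod.mk.eta (p := p), key p.1 p.2 hpl] at hp
    rw [← Prod.mk.eta (p := q), key q.1 q.2 hql]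
    have := equiv_map p q h
    simp only [quotientMap, Prod.mk.injEq] at this
    rwa [← this.1, ← this.2]
  · intro p hp q hq
    refine ⟨fun h => ?_, equiv_map p q⟩
    have hp2 : p.1 ∉ (doubledTorus τ).lattice := fun h => hp.1 (doubledTorus_le τ h)
    have hq2 : q.1 ∉ (doubledTorus τ).lattice := fun h => hq.1 (doubledTorus_le τ h)
    have hne := derivWp_ne_zero τ hq.1
    simp only [quotientMap, Prod.mk.injEq] at h
    rcases (wp_doubled_eq_iff τ hq2 hp2).1 h.1.symm with h1 | h1
    · refine Or.inr ⟨h1, ?_⟩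
      have h3 : p.1 = -q.1 + (⟨q.1 + p.1, h1⟩ : (doubledTorus τ).lattice) := by simp
      have h2 := h.2
      rw [h3, PeriodPair.derivWeierstrassP_add_coe, PeriodPair.derivWeierstrassP_neg] at h2
      refine mul_right_cancel₀ hne ?_
      linear_combination -h2
    · refine Or.inl ⟨h1, ?_⟩
      have h3 : q.1 = p.1 + (⟨q.1 - p.1, h1⟩ : (doubledTorus τ).lattice) := by simp
      have h2 := h.2
      rw [h3, PeriodPair.derivWeierstrassP_add_coe, ] at h2
      rw [h3, PeriodPair.derivWeierstrassP_add_coe] at hne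
      exact (mul_right_cancel₀ hne h2).symm
  · ext ⟨x, y⟩
    constructor
    · rintro ⟨p, hp, hpq⟩
      simp only [quotientMap, Prod.mk.injEq] at hpq
      have hpl := hp.1
      rw [← Prod.mk.eta (p := p), key p.1 p.2 hpl, hpq.2, hpq.1] at hp
      refine ⟨hp, fun ρ hρ => ?_⟩
      have := wp_doubled_ne_halfValue τ hpl hρ
      rw [hpq.1] at this
      exact this
    · rintro ⟨h1, h2⟩
      obtain ⟨z, hz, rfl⟩ := wp_surjective (doubledTorus τ) x
      have hzt : z ∉ (torus τ).lattice := by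
        rw [mem_torus_iff_halfValue τ hz]
        rintro ⟨ρ, hρ, h⟩
        exact h2 ρ hρ h
      have hne := derivWp_ne_zero τ hzt
      have hy : y / (doubledTorus τ).derivWeierstrassP z * (doubledTorus τ).derivWeierstrassP z = y :=
        div_mul_cancel₀ y hne
      refine ⟨(z, y / (doubledTorus τ).derivWeierstrassP z), ?_, ?_⟩
      · rw [key _ _ hzt, hy]
        exact h1
      · simp only [quotientMap, hy]

end

/-! ### Places and regular differentials of quadratic extensions of `ℂ(x)` -/

section QuadraticExtension

variable {K F : Type*} [Field K] [Field F] [Algebra ℂ[X] K] [IsFractionRing ℂ[X] K]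
  [Algebra ℂ[X] F] [Algebra K F] [IsScalarTower ℂ[X] K F]

/-- For `b = n/d` in lowest terms `d²` divides `Q`, so `d` is a unit. -/
theorem exists_algebraMap_of_sq_mul {Q : ℂ[X]} (hQ : Squarefree Q) {b : K} {c : ℂ[X]}
    (h : b ^ 2 * algebraMap ℂ[X] K Q = algebraMap ℂ[X] K c) : ∃ q : ℂ[X], b = algebraMap ℂ[X] K q := by
  obtain ⟨n, d, hcop, rfl⟩ := IsFractionRing.exists_reduced_fraction (A := ℂ[X]) b
  have hd : algebraMap ℂ[X] K d ≠ 0 := by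
    rw [Ne, FaithfulSMul.algebraMap_eq_zero_iff]
    exact nonZeroDivisors.coe_ne_zero d
  have h1 : n ^ 2 * Q = c * (d : ℂ[X]) ^ 2 := by
    apply FaithfulSMul.algebraMap_injective ℂ[X] K
    rw [IsFractionRing.mk'_eq_div, div_pow, div_mul_eq_mul_div, div_eq_iff (pow_ne_zero 2 hd)] at h
    simpa using h
  have h2 : (d : ℂ[X]) * d ∣ Q := by
    rw [← pow_two]
    exact (isRelPrime_iff_isCoprime.1 hcop).symm.pow.dvd_of_dvd_mul_left ⟨c, by rw [h1, mul_comm]⟩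
  obtain ⟨d', hd'⟩ := (hQ _ h2).exists_right_inv
  refine ⟨n * d', ?_⟩
  rw [IsFractionRing.mk'_eq_div, div_eq_iff hd, ← map_mul, mul_assoc, mul_comm d', hd', mul_one]

/-- For `f = a + by` with `b ≠ 0` the coefficients `-2a` and `a² - b²Q` of the minimal polynomial
lie in `ℂ[X]`, which is integrally closed. Hence `a` and `b²Q` are polynomials, and `b` is one since
`Q` is squarefree. -/
theorem exists_eq_of_isIntegral {Q : ℂ[X]} (hQ : Squarefree Q) {y : F}
    (hy : y ^ 2 = algebraMap ℂ[X] F Q) (hyK : ∀ a : K, algebraMap K F a ≠ y)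
    (hspan : ∀ f : F, ∃ a b : K, f = algebraMap K F a + algebraMap K F b * y)
    {f : F} (hf : IsIntegral ℂ[X] f) :
    ∃ p q : ℂ[X], f = algebraMap ℂ[X] F p + algebraMap ℂ[X] F q * y := by
  obtain ⟨a, b, rfl⟩ := hspan f
  by_cases hb : b = 0
  · subst hb
    rw [map_zero, zero_mul, add_zero] at hf ⊢
    obtain ⟨p, rfl⟩ := IsIntegrallyClosed.isIntegral_iff.1
      ((isIntegral_algebraMap_iff (algebraMap K F).injective).1 hf)
    exact ⟨p, 0, by simp [← IsScalarTower.algebraMap_apply]⟩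
  have hnot : algebraMap K F a + algebraMap K F b * y ∉ (algebraMap K F).range := by
    rintro ⟨c, hc⟩
    refine hyK ((c - a) / b) ?_
    rw [map_div₀, map_sub, hc, add_sub_cancel_left, mul_div_cancel_left₀]
    simpa using hb
  set f := algebraMap K F a + algebraMap K F b * y with hfdef
  set g : K[X] := X ^ 2 - C (2 * a) * X + C (a ^ 2 - b ^ 2 * algebraMap ℂ[X] K Q) with hg
  have hgm : g.Monic := by rw [hg]; monicity!
  have hgd : g.natDegree = 2 := by rw [hg]; compute_degree!
  have hfK : IsIntegral K f := hf.tower_top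
  have hroot : aeval f g = 0 := by
    simp only [hg, hfdef, map_add, map_sub, map_mul, map_pow, aeval_X, aeval_C, map_ofNat,
      ← IsScalarTower.algebraMap_apply, ← hy]
    ring
  -- The monic quadratic `g` annihilates `f ∉ K`, so it is minimal over `K`; integrality lets the
  -- minimal polynomial descend to `ℂ[X]`.
  have hmin : g = (minpoly ℂ[X] f).map (algebraMap ℂ[X] K) := by
    rw [← minpoly.isIntegrallyClosed_eq_field_fractions' K hf]
    refine minpoly.unique_of_degree_le_degree_minpoly K f hgm hroot ?_
    rw [degree_eq_natDegree hgm.ne_zero, degree_eq_natDegree (minpoly.ne_zero hfK), hgd]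
    exact_mod_cast (minpoly.two_le_natDegree_iff hfK).2 hnot
  have hc1 := congrArg (fun p : K[X] => p.coeff 1) hmin
  have hc0 := congrArg (fun p : K[X] => p.coeff 0) hmin
  simp only [hg, coeff_map] at hc1 hc0
  simp only [coeff_add, coeff_sub, coeff_X_pow, coeff_C_mul, coeff_X_one, coeff_X_zero, coeff_C_zero,
    coeff_C_succ, mul_one, mul_zero, add_zero, sub_zero, OfNat.one_ne_ofNat, OfNat.zero_ne_ofNat,
    if_false, zero_sub, zero_add] at hc1 hc0
  set c1 := (minpoly ℂ[X] f).coeff 1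
  set c0 := (minpoly ℂ[X] f).coeff 0
  have h2 : algebraMap ℂ[X] K (C (1 / 2)) * 2 = 1 := by
    rw [← map_ofNat (algebraMap ℂ[X] K) 2, ← map_mul, ← map_ofNat C 2, ← C_mul]
    simp
  have ha : a = algebraMap ℂ[X] K (-(C (1 / 2) * c1)) := by
    rw [map_neg, map_mul]
    linear_combination (-a) * h2 - algebraMap ℂ[X] K (C (1 / 2)) * hc1
  obtain ⟨q, hq⟩ := exists_algebraMap_of_sq_mul (K := K) (b := b) hQ
    (c := (-(C (1 / 2) * c1)) ^ 2 - c0) (by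
      rw [map_sub, map_pow, ← ha]
      linear_combination -hc0)
  exact ⟨-(C (1 / 2) * c1), q, by rw [hfdef, ha, hq]; simp only [← IsScalarTower.algebraMap_apply]⟩

end QuadraticExtension

/-! ### Localizations of a Dedekind domain as places -/

section Localization

theorem derivation_mem_localization {R F k : Type*} [CommRing R] [IsDomain R] [Field F]
    [Algebra R F] [IsFractionRing R F] [Field k] [Algebra k F] (δ : Derivation k F F)
    (hδ : ∀ r : R, ∃ s : R, δ (algebraMap R F r) = algebraMap R F s) (m : MaximalSpectrum R)
    {f : F} (hf : f ∈ Localization.subalgebra.ofField F _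
      m.asIdeal.primeCompl_le_nonZeroDivisors) :
    δ f ∈ Localization.subalgebra.ofField F _ m.asIdeal.primeCompl_le_nonZeroDivisors := by
  obtain ⟨a, s, hs, rfl⟩ := hf
  obtain ⟨a', ha⟩ := hδ a
  obtain ⟨s', hs'⟩ := hδ s
  have hs0 : algebraMap R F s ≠ 0 := by
    rw [Ne, FaithfulSMul.algebraMap_eq_zero_iff]
    rintro rfl
    exact hs (zero_mem _)
  refine ⟨s * a' - a * s', s * s, mul_mem hs hs, ?_⟩
  rw [Derivation.leibniz, Derivation.leibniz_inv, ha, hs']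
  simp only [smul_eq_mul, map_mul, map_sub]
  field_simp
  ring

variable {R F : Type*} [CommRing R] [IsDedekindDomain R] [Field F] [Algebra R F]
  [IsFractionRing R F] {k : Type*} [Field k] [Algebra k R] [Algebra k F] [IsScalarTower k R F]

/-- The localization is a discrete valuation ring, except when the maximal ideal is `⊥`; then it is
all of `F`. -/
theorem isPlace_localization (m : MaximalSpectrum R) :
    IsPlace ((Localization.subalgebra.ofField F _
      m.asIdeal.primeCompl_le_nonZeroDivisors).restrictScalars k) := by
  intro x
  by_cases hm : m.asIdeal = ⊥
  · left
    obtain ⟨a, s, hs, rfl⟩ := IsFractionRing.div_surjective R x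
    refine ⟨a, s, ?_, div_eq_mul_inv _ _⟩
    rw [Ideal.mem_primeCompl_iff, hm]
    exact nonZeroDivisors.ne_zero hs
  · have := IsLocalization.AtPrime.isDiscreteValuationRing_of_dedekind_domain R hm
      (Localization.subalgebra.ofField F _ m.asIdeal.primeCompl_le_nonZeroDivisors)
    rcases ValuationRing.isInteger_or_isInteger
      (Localization.subalgebra.ofField F _ m.asIdeal.primeCompl_le_nonZeroDivisors) x with h | h
    · obtain ⟨z, rfl⟩ := h
      exact Or.inl z.2
    · by_cases hx : x = 0
      · subst hx
        exact Or.inl (zero_mem _)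
      · obtain ⟨z, hz⟩ := h
        refine Or.inr ⟨z, z.2, ?_⟩
        rw [show (z : F) = x⁻¹ from hz, mul_inv_cancel₀ hx]

/-- By the quotient rule `δ` preserves every localization `O` of `R` at a maximal ideal, so it pairs
`∑ aᵢ dbᵢ` with `aᵢ, bᵢ ∈ O` to an element of `O`. The intersection of these localizations is `R`.
-/
theorem exists_of_mem_regularDifferentials (δ : Derivation k F F)
    (hδ : ∀ r : R, ∃ s : R, δ (algebraMap R F r) = algebraMap R F s) {η : Ω[F⁄k]}
    (hη : η ∈ regularDifferentials k F) :
    ∃ r : R, δ.liftKaehlerDifferential η = algebraMap R F r := by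
  have h : δ.liftKaehlerDifferential η ∈ (⨅ v : MaximalSpectrum R,
      Localization.subalgebra.ofField F _ v.asIdeal.primeCompl_le_nonZeroDivisors) := by
    rw [Algebra.mem_iInf]
    intro m
    set O := (Localization.subalgebra.ofField F _
      m.asIdeal.primeCompl_le_nonZeroDivisors).restrictScalars k with hO
    have h1 := (Submodule.mem_iInf _).1 ((Submodule.mem_iInf _).1 hη O) (isPlace_localization m)
    rw [Submodule.restrictScalars_mem] at h1
    change _ ∈ O
    clear hη
    induction h1 using Submodule.span_induction with
    | mem x hx =>
      obtain ⟨b, hb, rfl⟩ := hx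
      simp only [Derivation.liftKaehlerDifferential_comp_D]
      exact derivation_mem_localization δ hδ m hb
    | zero => simp
    | add x y _ _ hx hy => rw [map_add]; exact add_mem hx hy
    | smul a x _ hx =>
      have : δ.liftKaehlerDifferential (a • x) = (a : F) * δ.liftKaehlerDifferential x := by
        rw [← smul_eq_mul, ← map_smul]
        rfl
      rw [this]
      exact mul_mem a.2 hx
  rw [MaximalSpectrum.iInf_localization_eq_bot, Algebra.mem_bot] at h
  obtain ⟨r, hr⟩ := h
  exact ⟨r, hr.symm⟩

end Localization

/-- `F` is the function field of the curve `y² = Q(x)`, where `Q` is squarefree. -/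
structure IsQuadraticField {F : Type*} [Field F] [Algebra ℂ F] (Q : ℂ[X]) (x y : F) : Prop where
  sq : y ^ 2 = aeval x Q
  eq_zero : ∀ p q : ℂ[X], aeval x p + aeval x q * y = 0 → p = 0 ∧ q = 0
  exists_mul : ∀ f : F, ∃ p q r : ℂ[X], r ≠ 0 ∧ f * aeval x r = aeval x p + aeval x q * y
  squarefree : Squarefree Q

namespace IsQuadraticField

variable {F : Type*} [Field F] [Algebra ℂ F] {Q : ℂ[X]} {x y : F}

theorem aeval_injective (h : IsQuadraticField Q x y) : Function.Injective (aeval x : ℂ[X] →ₐ[ℂ] F) := by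
  rw [injective_iff_map_eq_zero]
  intro p hp
  exact (h.eq_zero p 0 (by simpa using hp)).1

theorem ne_zero (h : IsQuadraticField Q x y) : y ≠ 0 := by
  rintro rfl
  have := (h.eq_zero 0 1 (by simp)).2
  exact one_ne_zero this

theorem aeval_ne_zero (h : IsQuadraticField Q x y) {r : ℂ[X]} (hr : r ≠ 0) : aeval x r ≠ 0 := fun h0 =>
  hr (h.aeval_injective (h0.trans (map_zero _).symm))

theorem x_ne_zero (h : IsQuadraticField Q x y) : x ≠ 0 := by
  simpa using h.aeval_ne_zero X_ne_zero

theorem smul_D_y (h : IsQuadraticField Q x y) : (2 * y) • KaehlerDifferential.D ℂ F y =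
    aeval x (derivative Q) • KaehlerDifferential.D ℂ F x := by
  rw [← Derivation.map_aeval, ← h.sq, Derivation.leibniz_pow]
  simp [mul_smul, two_smul]

/-- A place containing `x` contains `y`, as `y = Q(x) y⁻¹` if `y⁻¹` lies in it. With `UQ + VQ' = 1`
and `2y dy = Q' dx` one gets `dx/y = Uy dx + 2V dy`, which has no denominators. -/
theorem inv_smul_D_mem (h : IsQuadraticField Q x y) {O : Subalgebra ℂ F} (hO : IsPlace O) (hx : x ∈ O) :
    y⁻¹ • KaehlerDifferential.D ℂ F x ∈
      Submodule.span O ((fun b => KaehlerDifferential.D ℂ F b) '' (O : Set F)) := by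
  have hmem (p : ℂ[X]) : aeval x p ∈ O := by
    have := (aeval (⟨x, hx⟩ : O) p).2
    rwa [← Subalgebra.coe_val, ← aeval_algHom_apply] at this
  have hy : y ∈ O := by
    rcases hO y with hy | ⟨z, hz, hyz⟩
    · exact hy
    · have : y = aeval x Q * z := by rw [← h.sq, pow_two, mul_assoc, hyz, mul_one]
      rw [this]
      exact mul_mem (hmem Q) hz
  obtain ⟨U, V, hUV⟩ := PerfectField.separable_iff_squarefree.2 h.squarefree
  have h1 : aeval x U * y ^ 2 + aeval x V * aeval x (derivative Q) = 1 := by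
    rw [h.sq, ← map_mul, ← map_mul, ← map_add, hUV, map_one]
  have h2 : y⁻¹ • KaehlerDifferential.D ℂ F x =
      (aeval x U * y) • KaehlerDifferential.D ℂ F x +
        (aeval x V * 2) • KaehlerDifferential.D ℂ F y := by
    have : (aeval x V * 2) • KaehlerDifferential.D ℂ F y =
        (aeval x V * aeval x (derivative Q) * y⁻¹) • KaehlerDifferential.D ℂ F x := by
      rw [mul_right_comm, mul_smul _ _ (KaehlerDifferential.D ℂ F x), ← h.smul_D_y, ← mul_smul]
      congr 1
      field_simp [h.ne_zero]
    rw [this, ← add_smul]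
    congr 1
    field_simp [h.ne_zero]
    linear_combination -h1
  rw [h2]
  refine add_mem ?_ ?_
  · exact Submodule.smul_mem _ (⟨_, mul_mem (hmem U) hy⟩ : O) (Submodule.subset_span ⟨x, hx, rfl⟩)
  · exact Submodule.smul_mem _ (⟨_, mul_mem (hmem V) (ofNat_mem O 2)⟩ : O)
      (Submodule.subset_span ⟨y, hy, rfl⟩)

/-- `F` is formally étale over `ℂ[x]`, so `dx` is a basis of `Ω` and `ε` is the coordinate `η ↦
η/dx`. The derivation `y d/dx` preserves the integral closure of `ℂ[x]`, so it pairs a regular `η`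
to an integral element, which has the form `p + qy`. -/
theorem exists_equiv_and_mem (h : IsQuadraticField Q x y) : ∃ ε : Ω[F⁄ℂ] ≃ₗ[F] F, ε (KaehlerDifferential.D ℂ F x) = 1 ∧
    ∀ η ∈ regularDifferentials ℂ F, ∃ p q : ℂ[X], y * ε η = aeval x p + aeval x q * y := by
  let : Algebra ℂ[X] F := (aeval x).toRingHom.toAlgebra
  have hmap (p : ℂ[X]) : algebraMap ℂ[X] F p = aeval x p := rfl
  have : IsScalarTower ℂ ℂ[X] F := IsScalarTower.of_algebraMap_eq fun c => by
    rw [hmap, Polynomial.algebraMap_eq, aeval_C]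
  have : FaithfulSMul ℂ[X] F := (faithfulSMul_iff_algebraMap_injective _ _).2 h.aeval_injective
  let : Algebra (FractionRing ℂ[X]) F := FractionRing.liftAlgebra ℂ[X] F
  have hspan (f : F) : ∃ a b : FractionRing ℂ[X], f = algebraMap _ F a + algebraMap _ F b * y := by
    obtain ⟨p, q, r, hr, hf⟩ := h.exists_mul f
    refine ⟨algebraMap ℂ[X] _ p / algebraMap ℂ[X] _ r, algebraMap ℂ[X] _ q / algebraMap ℂ[X] _ r, ?_⟩
    simp only [map_div₀, ← IsScalarTower.algebraMap_apply, hmap]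
    have := h.aeval_ne_zero hr
    field_simp
    rw [hf]
  have hyK (a : FractionRing ℂ[X]) : algebraMap _ F a ≠ y := by
    intro ha
    obtain ⟨p, r, hr, rfl⟩ := IsFractionRing.div_surjective ℂ[X] a
    have hr0 := h.aeval_ne_zero (nonZeroDivisors.ne_zero hr)
    simp only [map_div₀, ← IsScalarTower.algebraMap_apply, hmap] at ha
    rw [div_eq_iff hr0] at ha
    have := (h.eq_zero p (-r) (by rw [ha, map_neg]; ring)).2
    exact nonZeroDivisors.ne_zero hr (neg_eq_zero.1 this)
  have : FiniteDimensional (FractionRing ℂ[X]) F := by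
    classical
    refine ⟨⟨{1, y}, ?_⟩⟩
    rw [eq_top_iff]
    rintro f -
    obtain ⟨a, b, hf⟩ := hspan f
    rw [hf, ← Algebra.smul_def, Algebra.algebraMap_eq_smul_one]
    exact add_mem (Submodule.smul_mem _ _ (Submodule.subset_span (by simp)))
      (Submodule.smul_mem _ _ (Submodule.subset_span (by simp)))
  have : Algebra.FormallyEtale ℂ[X] (FractionRing ℂ[X]) :=
    Algebra.FormallyEtale.of_isLocalization (nonZeroDivisors ℂ[X])
  have : Algebra.FormallyEtale (FractionRing ℂ[X]) F := Algebra.FormallyEtale.of_isSeparable _ _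
  have : Algebra.FormallyEtale ℂ[X] F := Algebra.FormallyEtale.comp _ (FractionRing ℂ[X]) _
  let ε : Ω[F⁄ℂ] ≃ₗ[F] F :=
    (KaehlerDifferential.tensorKaehlerEquivOfFormallyEtale ℂ ℂ[X] F).symm ≪≫ₗ
      ((KaehlerDifferential.polynomialEquiv ℂ).baseChange ℂ[X] F _ _) ≪≫ₗ
      TensorProduct.AlgebraTensorModule.rid ℂ[X] F F
  have hε : ε (KaehlerDifferential.D ℂ F x) = 1 := by
    have : x = algebraMap ℂ[X] F X := by rw [hmap, aeval_X]
    rw [this]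
    simp [ε, KaehlerDifferential.tensorKaehlerEquivOfFormallyEtale_symm_D_algebraMap]
  have hint {f : F} (hf : IsIntegral ℂ[X] f) :
      ∃ p q : ℂ[X], f = aeval x p + aeval x q * y :=
    exists_eq_of_isIntegral (K := FractionRing ℂ[X]) h.squarefree h.sq hyK hspan hf
  have hint' (p q : ℂ[X]) : IsIntegral ℂ[X] (aeval x p + aeval x q * y) := by
    have hyi : IsIntegral ℂ[X] y := IsIntegral.of_pow two_pos (by
      rw [h.sq]; exact isIntegral_algebraMap (x := Q))
    exact (isIntegral_algebraMap (x := p)).add ((isIntegral_algebraMap (x := q)).mul hyi)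
  have : IsFractionRing (integralClosure ℂ[X] F) F :=
    integralClosure.isFractionRing_of_finite_extension (FractionRing ℂ[X]) F
  -- The factor `y` makes `δ` integral: `δx = y` and `δy = Q'(x)/2`.
  let δ : Derivation ℂ F F := (y • ε.toLinearMap).compDer (KaehlerDifferential.D ℂ F)
  have hδ_apply (f : F) : δ f = y * ε (KaehlerDifferential.D ℂ F f) := rfl
  have hδx : δ x = y := by rw [hδ_apply, hε, mul_one]
  have hδy : 2 * δ y = aeval x (derivative Q) := by
    have := congrArg ε h.smul_D_y
    rw [map_smul, map_smul, hε] at this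
    rw [hδ_apply]
    simp only [smul_eq_mul, mul_one] at this
    rw [← this]; ring
  have hδ (r : integralClosure ℂ[X] F) :
      ∃ s : integralClosure ℂ[X] F, δ (algebraMap _ F r) = algebraMap _ F s := by
    obtain ⟨p, q, hr⟩ := hint r.2
    refine ⟨⟨_, hint' (derivative q * Q + C (1 / 2) * q * derivative Q) (derivative p)⟩, ?_⟩
    change δ (r : F) = _ + _
    rw [hr, map_add, Derivation.leibniz, Derivation.map_aeval, Derivation.map_aeval, hδx]
    have h2 : aeval x (C (1 / 2 : ℂ)) * 2 = 1 := by
      rw [← map_ofNat (aeval x : ℂ[X] →ₐ[ℂ] F) 2, ← map_mul, ← map_ofNat C 2, ← C_mul]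
      simp
    simp only [smul_eq_mul, map_add, map_mul, ← h.sq, ← hδy]
    linear_combination (-(aeval x q * δ y)) * h2
  refine ⟨ε, hε, fun η hη => ?_⟩
  obtain ⟨r, hr⟩ := exists_of_mem_regularDifferentials δ hδ hη
  have hlift : δ.liftKaehlerDifferential = y • ε.toLinearMap :=
    Derivation.liftKaehlerDifferential_unique _ _ (Derivation.liftKaehlerDifferential_comp δ)
  rw [hlift] at hr
  obtain ⟨p, q, hpq⟩ := hint r.2
  exact ⟨p, q, hr.trans hpq⟩

end IsQuadraticField

/-! ### The genus of `y² = P(x)` -/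

theorem aeval_reflect {F : Type*} [Field F] [Algebra ℂ F] {x : F} (hx : x ≠ 0) {N : ℕ} {p : ℂ[X]}
    (hp : p.natDegree ≤ N) : aeval x (reflect N p) = aeval x⁻¹ p * x ^ N := by
  let := invertibleOfNonzero (inv_ne_zero hx)
  have h := eval₂_reflect_mul_pow (algebraMap ℂ F) x⁻¹ N p hp
  rw [invOf_eq_inv, inv_inv] at h
  rw [aeval_def, aeval_def, ← h, mul_assoc, ← mul_pow, inv_mul_cancel₀ hx, one_pow, mul_one]

theorem aeval_inv_reflect {F : Type*} [Field F] [Algebra ℂ F] {x : F} (hx : x ≠ 0) {N : ℕ}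
    {p : ℂ[X]} (hp : p.natDegree ≤ N) : aeval x⁻¹ (reflect N p) * x ^ N = aeval x p := by
  rw [aeval_reflect (inv_ne_zero hx) hp, inv_inv, mul_assoc, ← mul_pow, inv_mul_cancel₀ hx, one_pow,
    mul_one]

/-- A multiple root `a ≠ 0` of `x⁴P(1/x)` gives the multiple root `1/a` of `P`; a multiple root at
`0` would force the coefficients of `X⁴` and `X³` in `P` to vanish. -/
theorem squarefree_reflect {P : ℂ[X]} (hP : Squarefree P)
    (hd : P.natDegree = 3 ∨ P.natDegree = 4) : Squarefree (reflect 4 P) := by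
  have hlead : P.coeff 4 ≠ 0 ∨ P.coeff 3 ≠ 0 := by
    have := leadingCoeff_ne_zero.2 hP.ne_zero
    rcases hd with hd | hd <;> rw [leadingCoeff, hd] at this
    exacts [Or.inr this, Or.inl this]
  have hexp : P = C (P.coeff 4) * X ^ 4 + C (P.coeff 3) * X ^ 3 + C (P.coeff 2) * X ^ 2 +
      C (P.coeff 1) * X ^ 1 + C (P.coeff 0) * X ^ 0 := by
    conv_lhs => rw [P.as_sum_range_C_mul_X_pow' (n := 5) (by omega)]
    simp only [Finset.sum_range_succ, Finset.sum_range_zero]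
    ring
  generalize P.coeff 4 = c4, P.coeff 3 = c3, P.coeff 2 = c2, P.coeff 1 = c1, P.coeff 0 = c0
    at hlead hexp
  have hsf := squarefree_iff_no_common_root.1 hP
  rw [hexp] at hsf
  have hr : reflect 4 P = C c4 * X ^ 0 + C c3 * X ^ 1 + C c2 * X ^ 2 + C c1 * X ^ 3 +
      C c0 * X ^ 4 := by
    rw [hexp]
    simp only [reflect_add, reflect_C_mul_X_pow]
    rfl
  rw [squarefree_iff_no_common_root, hr]
  simp only [eval_add, eval_mul, eval_C, eval_pow, eval_X, derivative_add, derivative_mul,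
    derivative_C, derivative_X_pow, Nat.cast_ofNat, Nat.cast_one, Nat.cast_zero, map_zero, map_one,
    eval_zero, eval_one, zero_mul, zero_add] at hsf ⊢
  intro a ha ha'
  by_cases h0 : a = 0
  · subst h0
    simp at ha ha'
    simp [ha, ha'] at hlead
  · refine hsf a⁻¹ ?_ ?_
    · field_simp
      linear_combination ha
    · norm_num at ha' ⊢
      field_simp
      linear_combination 4 * ha - a * ha'

namespace IsQuadraticField

variable {F : Type*} [Field F] [Algebra ℂ F] {P : ℂ[X]} {x y : F}

/-- The chart at infinity, `x' = 1/x` and `y' = y/x²`; it has the same form, so the results of the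
affine chart apply again. -/
theorem inversion (h : IsQuadraticField P x y) (hd : P.natDegree = 3 ∨ P.natDegree = 4) :
    IsQuadraticField (reflect 4 P) x⁻¹ (y / x ^ 2) := by
  have hx := h.x_ne_zero
  refine ⟨?_, ?_, ?_, squarefree_reflect h.squarefree hd⟩
  · have := aeval_inv_reflect hx (N := 4) (p := P) (by omega)
    rw [← h.sq] at this
    rw [div_pow, ← this, ← pow_mul, mul_div_cancel_right₀ _ (pow_ne_zero 4 hx)]
  · intro p q hpq
    set N := max p.natDegree q.natDegree
    have hp := aeval_reflect hx (N := N) (p := p) (le_max_left _ _)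
    have hq := aeval_reflect hx (N := N) (p := q) (le_max_right _ _)
    have := h.eq_zero (reflect N p * X ^ 2) (reflect N q) (by
      rw [map_mul, map_pow, aeval_X, hp, hq]
      field_simp at hpq
      simp only [one_div] at hpq
      linear_combination x ^ N * hpq)
    simpa using this
  · intro f
    obtain ⟨p, q, r, hr, hf⟩ := h.exists_mul f
    set N := max r.natDegree (max p.natDegree q.natDegree)
    have hr' := aeval_inv_reflect hx (N := N) (p := r) (le_max_left _ _)
    have hp := aeval_inv_reflect hx (N := N) (p := p) ((le_max_left _ _).trans (le_max_right _ _))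
    have hq := aeval_inv_reflect hx (N := N) (p := q) ((le_max_right _ _).trans (le_max_right _ _))
    refine ⟨reflect N p * X ^ 2, reflect N q, reflect N r * X ^ 2, by simpa using hr, ?_⟩
    rw [← hr', ← hp, ← hq] at hf
    have hf' : f * aeval x⁻¹ (reflect N r) =
        aeval x⁻¹ (reflect N p) + aeval x⁻¹ (reflect N q) * y :=
      mul_right_cancel₀ (pow_ne_zero N hx) (by linear_combination hf)
    simp only [map_mul, map_pow, aeval_X]
    linear_combination x⁻¹ ^ 2 * hf'

theorem D_inv (x : F) : KaehlerDifferential.D ℂ F x⁻¹ =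
    (-(x ^ 2)⁻¹) • KaehlerDifferential.D ℂ F x := by
  rw [Derivation.leibniz_inv, inv_pow]

/-- Every place contains `x` or `1/x`, and `dx/y = -dx'/y'` in the chart at infinity. -/
theorem inv_smul_D_mem_regularDifferentials (h : IsQuadraticField P x y)
    (hd : P.natDegree = 3 ∨ P.natDegree = 4) :
    y⁻¹ • KaehlerDifferential.D ℂ F x ∈ regularDifferentials ℂ F := by
  have hx := h.x_ne_zero
  refine (Submodule.mem_iInf _).2 fun O => (Submodule.mem_iInf _).2 fun hO => ?_
  rw [Submodule.restrictScalars_mem]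
  rcases hO x with hxO | ⟨z, hz, hxz⟩
  · exact h.inv_smul_D_mem hO hxO
  · obtain rfl := eq_inv_of_mul_eq_one_right hxz
    have := neg_mem ((h.inversion hd).inv_smul_D_mem hO hz)
    convert this using 1
    rw [D_inv, ← mul_smul, ← neg_smul]
    congr 1
    field_simp

/-- The two charts give `y η/dx = p(x) + q(x) y` and `-y η/dx = p'(1/x) + q'(1/x) y/x²`. A
polynomial in `x` that is also one in `1/x` is constant, and the extra `x⁻²` forces `q = 0`; so `y
η/dx` is a constant. -/
theorem eq_smul_of_mem_regularDifferentials (h : IsQuadraticField P x y)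
    (hd : P.natDegree = 3 ∨ P.natDegree = 4) {η : Ω[F⁄ℂ]} (hη : η ∈ regularDifferentials ℂ F) :
    ∃ c : ℂ, c • (y⁻¹ • KaehlerDifferential.D ℂ F x) = η := by
  have hx := h.x_ne_zero
  have hy := h.ne_zero
  obtain ⟨ε, hε, hreg⟩ := h.exists_equiv_and_mem
  obtain ⟨ε', hε', hreg'⟩ := (h.inversion hd).exists_equiv_and_mem
  obtain ⟨p, q, hpq⟩ := hreg η hη
  obtain ⟨p', q', hpq'⟩ := hreg' η hη
  have hηeq : η = ε η • KaehlerDifferential.D ℂ F x := by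
    apply ε.injective
    rw [map_smul, hε, smul_eq_mul, mul_one]
  have hDx : ε' (KaehlerDifferential.D ℂ F x) = -x ^ 2 := by
    rw [D_inv, map_smul, smul_eq_mul] at hε'
    field_simp at hε'
    linear_combination -hε'
  have hε'η : ε' η = -x ^ 2 * ε η := by
    conv_lhs => rw [hηeq]
    rw [map_smul, hDx, smul_eq_mul, mul_comm]
  set N := max p'.natDegree q'.natDegree with hN
  have hp' := aeval_reflect hx (N := N) (p := p') (le_max_left _ _)
  have hq' := aeval_reflect hx (N := N) (p := q') (le_max_right _ _)
  -- The sum of the two chart expressions is zero; multiplication by `x^(N+2)` makes it polynomial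
  -- in `x`, and its two components vanish separately.
  have hzero := h.eq_zero (X ^ (N + 2) * p + X ^ 2 * reflect N p') (X ^ (N + 2) * q + reflect N q')
    (by
      simp only [map_add, map_mul, map_pow, aeval_X, hp', hq']
      rw [hε'η] at hpq'
      field_simp at hpq'
      simp only [one_div] at hpq'
      rw [pow_add]
      linear_combination (-x ^ N * x ^ 2) * hpq - x ^ N * hpq')
  have hdeg {r : ℂ[X]} (hr : r.natDegree ≤ N) : (reflect N r).natDegree ≤ N :=
    natDegree_reflect_le.trans (max_le le_rfl hr)
  -- If `q ≠ 0`, the degree of `X^(N+2) q` is at least `N + 2`, whereas that of `reflect N q'` is at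
  -- most `N`.
  have hq0 : q = 0 := by
    by_contra hne
    have h1 := congrArg natDegree (eq_neg_of_add_eq_zero_left hzero.2)
    rw [natDegree_neg, natDegree_X_pow_mul _ hne] at h1
    have := hdeg (r := q') (le_max_right _ _)
    omega
  have hp0 : p.natDegree = 0 := by
    by_contra hne
    have hp : p ≠ 0 := by rintro rfl; simp at hne
    have h2 : X ^ N * p = -reflect N p' := by
      refine mul_left_cancel₀ (pow_ne_zero 2 (X_ne_zero (R := ℂ))) ?_
      linear_combination hzero.1
    have h1 := congrArg natDegree h2
    rw [natDegree_neg, natDegree_X_pow_mul _ hp] at h1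
    have := hdeg (r := p') (le_max_left _ _)
    omega
  obtain ⟨c, rfl⟩ := natDegree_eq_zero.1 hp0
  refine ⟨c, ?_⟩
  rw [hq0, map_zero, zero_mul, add_zero, aeval_C] at hpq
  rw [← algebraMap_smul F c, ← mul_smul, ← hpq]
  conv_rhs => rw [hηeq]
  congr 1
  field_simp

theorem genus_eq_one (h : IsQuadraticField P x y) (hd : P.natDegree = 3 ∨ P.natDegree = 4) :
    genus ℂ F = 1 := by
  obtain ⟨ε, hε, -⟩ := h.exists_equiv_and_mem
  rw [genus, finrank_eq_one_iff_of_nonzero'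
    (⟨_, h.inv_smul_D_mem_regularDifferentials hd⟩ : regularDifferentials ℂ F)]
  · rintro ⟨η, hη⟩
    obtain ⟨c, hc⟩ := h.eq_smul_of_mem_regularDifferentials hd hη
    exact ⟨c, Subtype.ext hc⟩
  · intro h0
    have := congrArg ε (Subtype.ext_iff.1 h0)
    simp [hε, h.ne_zero] at this

end IsQuadraticField

/-! ### The fraction field of `ℂ[x, y] / (y² - P)` -/

section CoordRing

variable (P : ℂ[X])

theorem coordRing_root_sq : (AdjoinRoot.root ((X : ℂ[X][X]) ^ 2 - C P)) ^ 2 =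
    AdjoinRoot.of ((X : ℂ[X][X]) ^ 2 - C P) P := by
  have := AdjoinRoot.eval₂_root ((X : ℂ[X][X]) ^ 2 - C P)
  simpa [sub_eq_zero] using this

theorem exists_coordRing_eq (a : CoordRing P) : ∃ p q : ℂ[X],
    a = AdjoinRoot.of _ p + AdjoinRoot.of _ q * AdjoinRoot.root ((X : ℂ[X][X]) ^ 2 - C P) := by
  have hm : ((X : ℂ[X][X]) ^ 2 - C P).Monic := monic_X_pow_sub_C P two_ne_zero
  obtain ⟨f, rfl⟩ := AdjoinRoot.mk_surjective a
  have hdeg : (f %ₘ (X ^ 2 - C P)).natDegree ≤ 1 := by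
    have := natDegree_modByMonic_lt f hm (fun h => by
      have := congrArg natDegree h
      rw [natDegree_X_pow_sub_C, natDegree_one] at this
      omega)
    rw [natDegree_X_pow_sub_C] at this
    omega
  obtain ⟨q, p, hqp⟩ := exists_eq_X_add_C_of_natDegree_le_one hdeg
  refine ⟨p, q, ?_⟩
  have : AdjoinRoot.mk (X ^ 2 - C P) f = AdjoinRoot.mk _ (f %ₘ (X ^ 2 - C P)) := by
    rw [AdjoinRoot.mk_eq_mk]
    exact ⟨f /ₘ (X ^ 2 - C P), sub_eq_iff_eq_add'.2 (modByMonic_add_div f _).symm⟩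
  rw [this, hqp]
  simp [add_comm]

theorem coordRing_eq_zero {p q : ℂ[X]} (h : AdjoinRoot.of _ p +
    AdjoinRoot.of _ q * AdjoinRoot.root ((X : ℂ[X][X]) ^ 2 - C P) = 0) : p = 0 ∧ q = 0 := by
  have hm : ((X : ℂ[X][X]) ^ 2 - C P).Monic := monic_X_pow_sub_C P two_ne_zero
  have h1 : AdjoinRoot.mk ((X : ℂ[X][X]) ^ 2 - C P) (C q * X + C p) = 0 := by
    simpa [add_comm] using h
  rw [AdjoinRoot.mk_eq_zero] at h1
  have h2 := Polynomial.eq_zero_of_dvd_of_natDegree_lt h1 (by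
    rw [natDegree_X_pow_sub_C]
    exact (natDegree_linear_le).trans_lt one_lt_two)
  have hc0 := congrArg (fun f => f.coeff 0) h2
  have hc1 := congrArg (fun f => f.coeff 1) h2
  simp at hc0 hc1
  exact ⟨hc0, hc1⟩

theorem isQuadraticField_curveField {P : ℂ[X]} (hP : Squarefree P) [IsDomain (CoordRing P)] :
    IsQuadraticField P (algebraMap (CoordRing P) (CurveField P) (AdjoinRoot.of _ X))
      (algebraMap (CoordRing P) (CurveField P) (AdjoinRoot.root _)) := by
  have haeval (p : ℂ[X]) : aeval (algebraMap (CoordRing P) (CurveField P) (AdjoinRoot.of _ X)) p =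
      algebraMap (CoordRing P) (CurveField P) (AdjoinRoot.of _ p) := by
    induction p using Polynomial.induction_on' with
    | add p q hp hq => rw [map_add, hp, hq, map_add, map_add]
    | monomial n c =>
      rw [aeval_monomial, ← C_mul_X_pow_eq_monomial, map_mul, map_mul, map_pow, map_pow]
      rfl
  refine ⟨?_, ?_, ?_, hP⟩
  · rw [haeval, ← map_pow, coordRing_root_sq]
  · intro p q h
    rw [haeval, haeval, ← map_mul, ← map_add, FaithfulSMul.algebraMap_eq_zero_iff] at h
    exact coordRing_eq_zero P h
  · intro f
    obtain ⟨a, b, hb, rfl⟩ := IsFractionRing.div_surjective (CoordRing P) f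
    obtain ⟨p, q, rfl⟩ := exists_coordRing_eq P a
    obtain ⟨r, s, rfl⟩ := exists_coordRing_eq P b
    have hsq := coordRing_root_sq P
    have hb0 := nonZeroDivisors.ne_zero hb
    -- The fraction `(p + qy)/(r + sy)` is expanded by the conjugate `r - sy`; the new denominator
    -- is the norm `r² - s²P`.
    refine ⟨p * r - q * s * P, q * r - p * s, r ^ 2 - s ^ 2 * P, ?_, ?_⟩
    · intro h0
      have h1 : (AdjoinRoot.of _ r + AdjoinRoot.of _ s * AdjoinRoot.root ((X : ℂ[X][X]) ^ 2 - C P)) *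
          (AdjoinRoot.of _ r + AdjoinRoot.of _ (-s) * AdjoinRoot.root ((X : ℂ[X][X]) ^ 2 - C P)) =
          0 := by
        rw [← map_zero (AdjoinRoot.of ((X : ℂ[X][X]) ^ 2 - C P)), ← h0]
        simp only [map_sub, map_neg, map_mul, map_pow, ← hsq]
        ring
      have h2 := coordRing_eq_zero P ((mul_eq_zero.1 h1).resolve_left hb0)
      refine hb0 ?_
      rw [h2.1, neg_eq_zero.1 h2.2]
      simp
    · have hb1 := (map_ne_zero_iff _ (FaithfulSMul.algebraMap_injective (CoordRing P)
        (CurveField P))).2 hb0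
      rw [haeval, haeval, haeval, div_mul_eq_mul_div, div_eq_iff hb1]
      have key : (AdjoinRoot.of _ p + AdjoinRoot.of _ q * AdjoinRoot.root ((X : ℂ[X][X]) ^ 2 - C P)) *
          AdjoinRoot.of _ (r ^ 2 - s ^ 2 * P) =
          (AdjoinRoot.of _ (p * r - q * s * P) +
            AdjoinRoot.of _ (q * r - p * s) * AdjoinRoot.root ((X : ℂ[X][X]) ^ 2 - C P)) *
          (AdjoinRoot.of _ r + AdjoinRoot.of _ s * AdjoinRoot.root ((X : ℂ[X][X]) ^ 2 - C P)) := by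
        simp only [map_sub, map_mul, map_pow, ← hsq]
        ring
      have := congrArg (algebraMap (CoordRing P) (CurveField P)) key
      rw [map_mul (algebraMap (CoordRing P) (CurveField P)),
        map_mul (algebraMap (CoordRing P) (CurveField P)),
        map_add (algebraMap (CoordRing P) (CurveField P)) (AdjoinRoot.of _ (p * r - q * s * P)),
        map_mul (algebraMap (CoordRing P) (CurveField P)) (AdjoinRoot.of _ (q * r - p * s))] at this
      exact this

theorem genus_curveField {P : ℂ[X]} (hP : Squarefree P)
    (hd : P.natDegree = 3 ∨ P.natDegree = 4) : genus ℂ (CurveField P) = 1 := by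
  have : IsDomain (CoordRing P) := isDomain_coordRing hP (by omega)
  exact (isQuadraticField_curveField hP).genus_eq_one hd

end CoordRing

theorem algebraicallyIntegrable (τ : UpperHalfPlane) {g ν : Fin 4 → ℂ}
    (hg : ∀ α, ν α ^ 2 = -2 * g α ^ 2) : AlgebraicallyIntegrable τ g ν := by
  obtain ⟨E₀, hE₀⟩ := curvePoly_natDegree τ ν
  -- The excluded energies are those for which `4 N_E` has a multiple root, together with the one at
  -- which its degree may drop below `3`.
  refine ⟨laxRepresentation τ hg, {E | ¬ Squarefree (curvePoly τ ν E)} ∪ {E₀},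
    (finite_not_squarefree_curvePoly τ ν).union (Set.finite_singleton E₀), fun v u hu hE => ?_⟩
  rw [Set.mem_union, not_or, Set.mem_ofPred_eq, not_not, Set.mem_singleton_iff] at hE
  have hd := hE₀ _ hE.2
  exact ⟨_, isQuotientCurve τ hg hu, hE.1, branchPoints_ncard hE.1 hd,
    isDomain_coordRing hE.1 (by omega), genus_curveField hE.1 hd⟩

end PCI

theorem proposition3p1 (τ : UpperHalfPlane) :
    -- the model is the reduction of the Gaudin model by the involution
    (∀ p : GaudinPoint, 2 * p.u ∉ (torus τ).lattice →
      (∀ ρ i j, Tendsto (fun z => (z - 2 * ω τ ρ) * gaudinLax τ p z i j) (𝓝[≠] (2 * ω τ ρ))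
        (𝓝 (!![p.s11 ρ, p.s12 ρ; p.s21 ρ, -p.s11 ρ] i j))) ∧
      (p.IsFixed τ ↔ (∀ α, p.s11 α = 0) ∧ ∀ α, p.t12 τ α = p.t21 τ α) ∧
      (p.IsFixed τ →
        (∀ z, gaudinLax τ p z = laxL τ (p.t12 τ) p.v p.u z) ∧
        (∃ r : Fin 4 → ℂ, (∀ α, r α ^ 2 = p.casimir α) ∧
          (∀ α, p.s12 α = e (-2 * p.u * dω α) * r α) ∧
          (∀ α, p.s21 α = e (2 * p.u * dω α) * r α) ∧
          (∀ ρ, p.t12 τ ρ = (1 / 4) * ∑ α, signMatrix τ ρ α * r α)) ∧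
        (∀ ρ, K τ (p.t12 τ) ρ = p.casimir ρ))) ∧
    (∀ (ν : Fin 4 → ℂ) (v u : ℂ), 2 * u ∉ (torus τ).lattice →
      ∃ p : GaudinPoint, p.v = v ∧ p.u = u ∧ p.IsFixed τ ∧ p.t12 τ = ν ∧
        ∀ z, gaudinLax τ p z = laxL τ ν v u z) ∧
    ∀ g ν : Fin 4 → ℂ, (∀ α, ν α ^ 2 = -2 * g α ^ 2) →
      -- the spectral curve
      (∀ v u : ℂ, 2 * u ∉ (torus τ).lattice → ∀ z ∉ (torus τ).lattice, ∀ l : ℂ,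
        (z, l) ∈ spectralCurve τ (laxL τ ν v u) ↔
          l ^ 2 = 2 * hamiltonian τ g v u
            + ∑ ρ, K τ ν ρ * (doubledTorus τ).weierstrassP (z - 2 * ω τ ρ)) ∧
      (∃ R : ℂ → RatFunc ℂ,
        (∀ v u : ℂ, 2 * u ∉ (torus τ).lattice → ∀ z ∉ (torus τ).lattice, ∀ l : ℂ,
          (z, l) ∈ spectralCurve τ (laxL τ ν v u) ↔
            l ^ 2 = (R (hamiltonian τ g v u)).eval (RingHom.id ℂ)
              ((doubledTorus τ).weierstrassP z)) ∧
        ∀ E : ℂ,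
          (∀ p, ratOrder (R E) p < 0 ↔ ∃ ρ, K τ ν ρ ≠ 0 ∧ p = polePoint τ ρ) ∧
          (∀ p, -1 ≤ ratOrder (R E) p) ∧
          ((∀ ρ, K τ ν ρ ≠ 0) → {p | ratOrder (R E) p = -1}.ncard = 4)) ∧
      AlgebraicallyIntegrable τ g ν := by
  refine ⟨fun p hu => ⟨gaudin_residue τ p hu, gaudin_fixed_iff τ p hu, fun hf => ?_⟩,
    gaudin_exists τ, fun g ν hg => ⟨fun v u hu z hz l => mem_spectralCurve τ hg hu hz l,
      ⟨spectralRat τ ν, fun v u hu z hz l => mem_spectralCurve_rat τ hg hu hz l,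
        fun E => ⟨fun p => (spectralRat_order τ ν E p).1, fun p => (spectralRat_order τ ν E p).2,
          fun hK => spectralRat_ncard τ hK E⟩⟩, algebraicallyIntegrable τ hg⟩⟩
  obtain ⟨h1, h2⟩ := (gaudin_fixed_iff τ p hu).1 hf
  obtain ⟨h3, h4⟩ := gaudin_reduction τ h1 h2
  exact ⟨gaudinLax_of_fixed τ h1 h2, h3, h4⟩
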